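/- Let $\mathbb{K}$ be $\mathbb{R}$ or $\mathbb{C}$ and let $V = V_{\mathbf 0} \oplus V_{\mathbf 1}$ be a $\mathbb{Z}_2$-graded Hausdorff locally convex space over $\mathbb{K}$ whose projections onto the even and odd part are continuous. Let $\mathrm{S}^\bullet(V) = \bigoplus_n \mathrm{S}^n(V) \subseteq \bigoplus_n V^{\otimes n}$ be the symmetric algebra, i.e. the image of the graded symmetrizer $\mathscr{S}$ (permutations act on $V^{\otimes n}$ with the Koszul sign), with the symmetric tensor product $vw = \mu(v \otimes w) = \mathscr{S}(v \otimes w)$. Let $\Lambda \colon V \times V \to \mathbb{K}$ be a (jointly) continuous bilinear form which is even, i.e. $\Lambda(v,w) = 0$ for homogeneous $v, w$ of different parity. Let $P_\Lambda$ be the linear operator on $\mathrm{S}^\bullet(V) \otimes \mathrm{S}^\bullet(V)$ with $$P_\Lambda(v_1 \cdots v_n \otimes w_1 \cdots w_m) = \sum_{k=1}^n \sum_{\ell=1}^m (-1)^{v_k(v_{k+1} + \cdots + v_n) + w_\ell(w_1 + \cdots + w_{\ell-1})} \Lambda(v_k, w_\ell)\, v_1 \cdots \widehat{v_k} \cdots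 v_n \otimes w_1 \cdots \widehat{w_\ell} \cdots w_m$$ for homogeneous vectors (parities in the exponent are denoted by the vectors). For $z \in \mathbb{K}$ and $a, b \in \mathrm{S}^\bullet(V)$ put $a \star_{z\Lambda} b = \sum_{k=0}^\infty \frac{z^k}{k!} \mu(P_\Lambda^k(a \otimes b))$, which is a finite sum. For a seminorm $p$ on $V$ and $r \in \mathbb{R}$ let $p_r(v) = \sum_{n} p^n(v_n)\, n!^r$ on the tensor algebra, where $p^n = p \otimes \cdots \otimes p$ is the projective tensor power ($p^0 = |\cdot|$). Let $\mathcal{W}_R(V)$ be $\mathrm{S}^\bullet(V)$ with the locally convex topology of all seminorms $p_R$, $p$ a continuous seminorm on $V$, and let $\mathcal{W}_{R^-}(V)$ be $\mathrm{S}^\bullet(V)$ with the topology of all seminorms $p_{R - \epsilon}$ with $\epsilon > 0$ and $p$ a continuous seminorm on $V$. Let $\mathcal{W}$ be either $\mathcal{W}_R(V)$ with $R \ge \frac12$ or $\mathcal{W}_{R^-}(V)$ with $R > \frac12$, and let $\widehat{\mathcal{W}}$ be its completion. Then the following hold. 1. The bilinear maps $\mu$, $(a,b) \mapsto \mu(P_\Lambda^k(a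 \otimes b))$ for $k \ge 0$, and $\star_{z\Lambda}$ for $z \in \mathbb{K}$ extend to continuous maps $\widehat{\mathcal{W}} \times \widehat{\mathcal{W}} \to \widehat{\mathcal{W}}$, denoted by the same symbols. 2. For all $z \in \mathbb{K}$ and $a, b \in \widehat{\mathcal{W}}$ the series $$a \star_{z\Lambda} b = \sum_{k=0}^\infty \frac{z^k}{k!}\, \mu(P_\Lambda^k(a \otimes b))$$ converges absolutely in $\widehat{\mathcal{W}}$, i.e. it is absolutely summable in every continuous seminorm, and its sum is $a \star_{z\Lambda} b$. 3. For all $a, b \in \widehat{\mathcal{W}}$ the map $\mathbb{K} \ni z \mapsto a \star_{z\Lambda} b \in \widehat{\mathcal{W}}$ has derivatives of all orders, its Taylor series at every point $z_0 \in \mathbb{K}$ converges absolutely to it on all of $\mathbb{K}$, and its $k$-th derivative at $z = 0$ is $\mu(P_\Lambda^k(a \otimes b))$. Thus it is real-analytic if $\mathbb{K} = \mathbb{R}$ and holomorphic, even entire, if $\mathbb{K} = \mathbb{C}$, with Taylor expansion around $z = 0$ given by the series in 2. 4. The products $\star_{z\Lambda}$ form an entire (for $\mathbb{K} = \mathbb{R}$: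 real-analytic) deformation of the algebra $(\widehat{\mathcal{W}}, \mu)$: every $\star_{z\Lambda}$ is a bilinear associative product on $\widehat{\mathcal{W}}$ with unit $1 \in \mathrm{S}^0(V)$, the map $(z, a, b) \mapsto a \star_{z\Lambda} b$ is jointly continuous and depends on $z$ as in 3, and $\star_{z\Lambda}|_{z=0} = \mu$. -/

import Mathlib

open scoped TensorProduct DirectSum Topology Nat

noncomputable section

namespace GradedWeyl

section Algebra

variable {𝕂 : Type*} [RCLike 𝕂] {V : Type*} [AddCommGroup V] [Module 𝕂 V]

/-- The projection of a `ℤ/2`-graded vector space `V = 𝒱 0 ⊕ 𝒱 1` onto its part of parity `i`. -/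
def parityProj (𝒱 : ZMod 2 → Submodule 𝕂 V) [DirectSum.Decomposition 𝒱] (i : ZMod 2) :
    V →ₗ[𝕂] V :=
  (𝒱 i).subtype ∘ₗ DirectSum.component 𝕂 (ZMod 2) (fun j => 𝒱 j) i ∘ₗ
    (DirectSum.decomposeLinearEquiv 𝒱).toLinearMap

/-- The sign `(-1) ^ a` for `a ∈ ℤ/2`. -/
def paritySign (𝕂 : Type*) [RCLike 𝕂] (a : ZMod 2) : 𝕂 := (-1) ^ a.val

/-- The Koszul sign of `σ` acting on `n` homogeneous vectors of parities `f 0, …, f (n - 1)`: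
each pair which `σ` puts into the wrong order contributes `(-1)` to the product of its parities. -/
def koszulSign (𝕂 : Type*) [RCLike 𝕂] {n : ℕ} (f : Fin n → ZMod 2) (σ : Equiv.Perm (Fin n)) : 𝕂 :=
  ∏ i : Fin n, ∏ j : Fin n,
    if i < j ∧ σ j < σ i then paritySign 𝕂 (f (σ i) * f (σ j)) else 1

variable (𝒱 : ZMod 2 → Submodule 𝕂 V) [DirectSum.Decomposition 𝒱]

/-- The projection of `V^{⊗ n}` onto the tensors whose `i`-th factor has parity `f i`. -/
def parityComponent {n : ℕ} (f : Fin n → ZMod 2) : (⨂[𝕂]^n V) →ₗ[𝕂] (⨂[𝕂]^n V) :=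
  PiTensorProduct.map fun i => parityProj 𝒱 (f i)

/-- The right action of a permutation on `V^{⊗ n}`, given on homogeneous vectors by
`v₁ ⊗ ⋯ ⊗ vₙ ↦ sign(v₁, …, vₙ; σ) v_{σ(1)} ⊗ ⋯ ⊗ v_{σ(n)}`. -/
def permAction {n : ℕ} (σ : Equiv.Perm (Fin n)) : (⨂[𝕂]^n V) →ₗ[𝕂] (⨂[𝕂]^n V) :=
  ∑ f : Fin n → ZMod 2, koszulSign 𝕂 f σ •
    ((PiTensorProduct.reindex 𝕂 (fun _ : Fin n => V) σ.symm).toLinearMap ∘ₗ parityComponent 𝒱 f)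

/-- The graded symmetrization operator on `V^{⊗ n}`. -/
def symmetrizerPow (n : ℕ) : (⨂[𝕂]^n V) →ₗ[𝕂] (⨂[𝕂]^n V) :=
  ((n ! : 𝕂)⁻¹) • ∑ σ : Equiv.Perm (Fin n), permAction 𝒱 σ

/-- The tensor algebra `T(V) = ⨁ₙ V^{⊗ n}`; its ring structure is the tensor product. -/
abbrev TensorAlg (𝕂 V : Type*) [RCLike 𝕂] [AddCommGroup V] [Module 𝕂 V] : Type _ :=
  ⨁ n : ℕ, ⨂[𝕂]^n V

/-- The symmetrizer on the whole tensor algebra. -/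
def symmetrizer : TensorAlg 𝕂 V →ₗ[𝕂] TensorAlg 𝕂 V :=
  DirectSum.lmap fun n => symmetrizerPow 𝒱 n

/-- The (graded) symmetric algebra `S(V)`, as the image of the symmetrizer. -/
def symAlg : Submodule 𝕂 (TensorAlg 𝕂 V) := LinearMap.range (symmetrizer 𝒱)

/-- The symmetrizer as a map onto the symmetric algebra. -/
def toSym : TensorAlg 𝕂 V →ₗ[𝕂] symAlg 𝒱 := (symmetrizer 𝒱).rangeRestrict

/-- The symmetric tensor product `μ (v ⊗ w) = vw`, the symmetrization of `v ⊗ w`. -/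
def symMul : symAlg 𝒱 ⊗[𝕂] symAlg 𝒱 →ₗ[𝕂] symAlg 𝒱 :=
  toSym 𝒱 ∘ₗ LinearMap.mul' 𝕂 (TensorAlg 𝕂 V) ∘ₗ
    TensorProduct.map (symAlg 𝒱).subtype (symAlg 𝒱).subtype

/-- The unit of the symmetric algebra, `1 ∈ S⁰(V) = 𝕂`. -/
def symOne : symAlg 𝒱 := toSym 𝒱 1

/-- `v₀ ⊗ ⋯ ⊗ vₙ ↦ v_k ⊗ (v₀ ⊗ ⋯ ⊗ vₙ with the k-th factor omitted)`, without sign. -/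
def extractFactor {n : ℕ} (k : Fin (n + 1)) : (⨂[𝕂]^(n + 1) V) →ₗ[𝕂] V ⊗[𝕂] (⨂[𝕂]^n V) :=
  PiTensorProduct.lift <| LinearMap.uncurryMid (M := fun _ => V) k
    { toFun := fun v => (TensorProduct.mk 𝕂 V (⨂[𝕂]^n V) v).compMultilinearMap
        (PiTensorProduct.tprod 𝕂)
      map_add' := fun v w => by
        ext x
        simp
      map_smul' := fun c v => by
        ext x
        simp }

/-- On homogeneous vectors of positive tensor degree,
`v₁ ⊗ ⋯ ⊗ vₙ ↦ ∑ₖ (-1)^{v_k (v_{k+1} + ⋯ + v_n)} v_k ⊗ (v₁ ⊗ ⋯ (no v_k) ⋯ ⊗ vₙ)`;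
zero in tensor degree `0`. -/
def pullRight : TensorAlg 𝕂 V →ₗ[𝕂] V ⊗[𝕂] TensorAlg 𝕂 V :=
  DirectSum.toModule 𝕂 ℕ _ fun
    | 0 => 0
    | n + 1 => TensorProduct.map LinearMap.id (DirectSum.lof 𝕂 ℕ (fun n => ⨂[𝕂]^n V) n) ∘ₗ
        ∑ f : Fin (n + 1) → ZMod 2, ∑ k : Fin (n + 1),
          paritySign 𝕂 (f k * ∑ j ∈ Finset.Ioi k, f j) • (extractFactor k ∘ₗ parityComponent 𝒱 f)

/-- On homogeneous vectors of positive tensor degree,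
`w₁ ⊗ ⋯ ⊗ wₘ ↦ ∑ₗ (-1)^{w_l (w₁ + ⋯ + w_{l-1})} w_l ⊗ (w₁ ⊗ ⋯ (no w_l) ⋯ ⊗ wₘ)`;
zero in tensor degree `0`. -/
def pullLeft : TensorAlg 𝕂 V →ₗ[𝕂] V ⊗[𝕂] TensorAlg 𝕂 V :=
  DirectSum.toModule 𝕂 ℕ _ fun
    | 0 => 0
    | n + 1 => TensorProduct.map LinearMap.id (DirectSum.lof 𝕂 ℕ (fun n => ⨂[𝕂]^n V) n) ∘ₗ
        ∑ f : Fin (n + 1) → ZMod 2, ∑ l : Fin (n + 1),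
          paritySign 𝕂 (f l * ∑ j ∈ Finset.Iio l, f j) • (extractFactor l ∘ₗ parityComponent 𝒱 f)

/-- The operator on `T(V) ⊗ T(V)` that contracts with `Λ` one factor of the left tensor with one
factor of the right tensor: on homogeneous vectors `v₁ ⊗ ⋯ ⊗ vₙ ⊗ w₁ ⊗ ⋯ ⊗ wₘ` goes to
`∑ₖ ∑ₗ (-1)^{v_k (v_{k+1} + ⋯ + v_n) + w_l (w₁ + ⋯ + w_{l-1})} Λ(v_k, w_l)` times
`v₁ ⊗ ⋯ (no v_k) ⋯ ⊗ vₙ ⊗ w₁ ⊗ ⋯ (no w_l) ⋯ ⊗ wₘ`. -/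
def tensorContraction (Λ : V →ₗ[𝕂] V →ₗ[𝕂] 𝕂) :
    TensorAlg 𝕂 V ⊗[𝕂] TensorAlg 𝕂 V →ₗ[𝕂] TensorAlg 𝕂 V ⊗[𝕂] TensorAlg 𝕂 V :=
  (TensorProduct.lid 𝕂 _).toLinearMap ∘ₗ
    TensorProduct.map (TensorProduct.lift Λ) LinearMap.id ∘ₗ
    (TensorProduct.tensorTensorTensorComm 𝕂 V (TensorAlg 𝕂 V) V (TensorAlg 𝕂 V)).toLinearMap ∘ₗ
    TensorProduct.map (pullRight 𝒱) (pullLeft 𝒱)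

/-- The operator `P_Λ` on `S(V) ⊗ S(V)`: on homogeneous vectors, the product
`v₁ ⋯ vₙ ⊗ w₁ ⋯ wₘ` goes to
`∑ₖ ∑ₗ (-1)^{v_k (v_{k+1} + ⋯ + v_n) + w_l (w₁ + ⋯ + w_{l-1})} Λ(v_k, w_l)` times
`v₁ ⋯ (no v_k) ⋯ vₙ ⊗ w₁ ⋯ (no w_l) ⋯ wₘ`.
The products are symmetrized tensors, and after symmetrization `tensorContraction` takes the same
value on a tensor and on its symmetrization. -/
def contraction (Λ : V →ₗ[𝕂] V →ₗ[𝕂] 𝕂) : Module.End 𝕂 (symAlg 𝒱 ⊗[𝕂] symAlg 𝒱) :=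
  TensorProduct.map (toSym 𝒱) (toSym 𝒱) ∘ₗ tensorContraction 𝒱 Λ ∘ₗ
    TensorProduct.map (symAlg 𝒱).subtype (symAlg 𝒱).subtype

/-- The bilinear map `(a, b) ↦ μ (P_Λ ^ k (a ⊗ b))` on `S(V)`. -/
def starTerm (Λ : V →ₗ[𝕂] V →ₗ[𝕂] 𝕂) (k : ℕ) (a b : symAlg 𝒱) : symAlg 𝒱 :=
  symMul 𝒱 ((contraction 𝒱 Λ ^ k) (a ⊗ₜ[𝕂] b))

/-- The star product `a ⋆_{zΛ} b = ∑ₖ z^k / k! μ (P_Λ ^ k (a ⊗ b))` on `S(V)`; only finitely many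
terms are nonzero because `P_Λ` lowers both tensor degrees by one. -/
def symStar (Λ : V →ₗ[𝕂] V →ₗ[𝕂] 𝕂) (z : 𝕂) (a b : symAlg 𝒱) : symAlg 𝒱 :=
  ∑ᶠ k : ℕ, (z ^ k / (k ! : 𝕂)) • starTerm 𝒱 Λ k a b

end Algebra

section Seminorms

variable {𝕂 : Type*} [RCLike 𝕂] {V : Type*} [AddCommGroup V] [Module 𝕂 V]

/-- The cost `∑ᵢ |cᵢ| p(vᵢ⁽¹⁾) ⋯ p(vᵢ⁽ⁿ⁾)` of a formal sum `∑ᵢ cᵢ vᵢ⁽¹⁾ ⊗ ⋯ ⊗ vᵢ⁽ⁿ⁾`. -/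
def projCost (p : Seminorm 𝕂 V) (n : ℕ) (l : FreeAddMonoid (𝕂 × (Fin n → V))) : ℝ :=
  (l.toList.map fun x => ‖x.1‖ * ∏ i, p (x.2 i)).sum

theorem projCost_nonneg (p : Seminorm 𝕂 V) (n : ℕ) (l : FreeAddMonoid (𝕂 × (Fin n → V))) :
    0 ≤ projCost p n l := by
  refine List.sum_nonneg fun a ha => ?_
  obtain ⟨x, -, rfl⟩ := List.mem_map.1 ha
  exact mul_nonneg (norm_nonneg _) (Finset.prod_nonneg fun i _ => apply_nonneg p _)

/-- The projective tensor power `pⁿ = p ⊗ ⋯ ⊗ p` of a seminorm: the infimum of the costs of all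
formal sums that represent the given tensor (`PiTensorProduct.lifts`). For `n = 0` it is the
absolute value on `V^{⊗ 0} = 𝕂`. -/
def projSeminorm (p : Seminorm 𝕂 V) (n : ℕ) : Seminorm 𝕂 (⨂[𝕂]^n V) :=
  Seminorm.ofSMulLE (fun t => ⨅ l : PiTensorProduct.lifts t, projCost p n l.1)
    (le_antisymm
      (ciInf_le_of_le ⟨0, by rintro _ ⟨l, rfl⟩; exact projCost_nonneg p n l.1⟩
        ⟨0, PiTensorProduct.lifts_zero⟩ (by simp [projCost]))
      (Real.iInf_nonneg fun l => projCost_nonneg p n l.1))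
    (fun s t => by
      have := (PiTensorProduct.nonempty_lifts s).to_subtype
      have := (PiTensorProduct.nonempty_lifts t).to_subtype
      refine le_ciInf_add_ciInf fun l m => ?_
      refine ciInf_le_of_le ⟨0, by rintro _ ⟨l, rfl⟩; exact projCost_nonneg p n l.1⟩
        ⟨l.1 + m.1, PiTensorProduct.lifts_add l.2 m.2⟩ ?_
      simp [projCost])
    (fun c t => by
      have := (PiTensorProduct.nonempty_lifts t).to_subtype
      rw [Real.mul_iInf_of_nonneg (norm_nonneg c)]
      refine le_ciInf fun l => ?_
      refine ciInf_le_of_le ⟨0, by rintro _ ⟨l, rfl⟩; exact projCost_nonneg p n l.1⟩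
        ⟨_, PiTensorProduct.lifts_smul l.2 c⟩ ?_
      simp [projCost, Function.comp_def, mul_assoc, List.sum_map_mul_left])

theorem tensorSeminorm_summable (p : Seminorm 𝕂 V) (r : ℝ) (v : TensorAlg 𝕂 V) :
    Summable fun n : ℕ => projSeminorm p n (v n) * (n ! : ℝ) ^ r := by
  refine summable_of_hasFiniteSupport ((DFinsupp.finite_support v).subset fun n hn => ?_)
  intro h
  exact hn (by simp [h])

/-- The seminorm `p_r (v) = ∑ₙ pⁿ(vₙ) (n!)^r` on the tensor algebra (a finite sum). -/
def tensorSeminorm (p : Seminorm 𝕂 V) (r : ℝ) : Seminorm 𝕂 (TensorAlg 𝕂 V) :=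
  Seminorm.ofSMulLE (fun v => ∑' n : ℕ, projSeminorm p n (v n) * (n ! : ℝ) ^ r)
    (by simp)
    (fun v w => by
      rw [← (tensorSeminorm_summable p r v).tsum_add (tensorSeminorm_summable p r w)]
      refine (tensorSeminorm_summable p r (v + w)).tsum_le_tsum (fun n => ?_)
        ((tensorSeminorm_summable p r v).add (tensorSeminorm_summable p r w))
      rw [← add_mul]
      exact mul_le_mul_of_nonneg_right (map_add_le_add _ _ _) (by positivity))
    (fun c v => by
      rw [← tsum_mul_left]
      refine le_of_eq (tsum_congr fun n => ?_)
      rw [DirectSum.smul_apply, map_smul_eq_mul, mul_assoc])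

end Seminorms

section Weyl

variable {𝕂 : Type*} [RCLike 𝕂] {V : Type*} [AddCommGroup V] [Module 𝕂 V] [TopologicalSpace V]

/-- The vector space `S(V)`, to be equipped with the locally convex topology of all seminorms `p_r`,
where `p` is a continuous seminorm on `V` and `r ∈ E`. For `E = {R}` this is the space of the Weyl
algebra `W_R(V)`, for `E = {r | r < R}` that of the projective version `W_{R⁻}(V)`. -/
def Weyl (𝒱 : ZMod 2 → Submodule 𝕂 V) [DirectSum.Decomposition 𝒱] (_E : Set ℝ) : Type _ :=
  symAlg 𝒱

variable (𝒱 : ZMod 2 → Submodule 𝕂 V) [DirectSum.Decomposition 𝒱] (E : Set ℝ)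

instance : AddCommGroup (Weyl 𝒱 E) := inferInstanceAs (AddCommGroup (symAlg 𝒱))

instance : Module 𝕂 (Weyl 𝒱 E) := inferInstanceAs (Module 𝕂 (symAlg 𝒱))

/-- The defining seminorms `p_r` of the topology on the Weyl algebra. -/
def weylSeminorms : SeminormFamily 𝕂 (Weyl 𝒱 E) ({p : Seminorm 𝕂 V // Continuous p} × E) :=
  fun i => (tensorSeminorm i.1.1 i.2.1).comp (symAlg 𝒱).subtype

instance : TopologicalSpace (Weyl 𝒱 E) := (weylSeminorms 𝒱 E).moduleFilterBasis.topology

theorem weyl_withSeminorms : WithSeminorms (weylSeminorms 𝒱 E) := ⟨rfl⟩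

instance : IsTopologicalAddGroup (Weyl 𝒱 E) := (weyl_withSeminorms 𝒱 E).topologicalAddGroup

instance : ContinuousSMul 𝕂 (Weyl 𝒱 E) := (weyl_withSeminorms 𝒱 E).continuousSMul

instance : UniformSpace (Weyl 𝒱 E) := IsTopologicalAddGroup.rightUniformSpace (Weyl 𝒱 E)

instance : IsUniformAddGroup (Weyl 𝒱 E) := isUniformAddGroup_of_addCommGroup

instance : UniformContinuousConstSMul 𝕂 (Weyl 𝒱 E) :=
  uniformContinuousConstSMul_of_continuousConstSMul 𝕂 (Weyl 𝒱 E)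

/-- The (Hausdorff) completion of the Weyl algebra. -/
abbrev CWeyl : Type _ := UniformSpace.Completion (Weyl 𝒱 E)

variable {𝒱 E} in
/-- The extension by continuity of a binary operation to the completion. -/
def extend₂ (f : Weyl 𝒱 E → Weyl 𝒱 E → Weyl 𝒱 E) : CWeyl 𝒱 E → CWeyl 𝒱 E → CWeyl 𝒱 E :=
  Function.curry <|
    (UniformSpace.Completion.isDenseInducing_coe.prodMap
      UniformSpace.Completion.isDenseInducing_coe).extend
        fun x : Weyl 𝒱 E × Weyl 𝒱 E => (f x.1 x.2 : CWeyl 𝒱 E)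

/-- The symmetric tensor product on the Weyl algebra. -/
def weylMul (a b : Weyl 𝒱 E) : Weyl 𝒱 E := symMul 𝒱 (a ⊗ₜ[𝕂] b)

/-- The unit of the Weyl algebra. -/
def weylOne : Weyl 𝒱 E := symOne 𝒱

/-- `(a, b) ↦ μ (P_Λ ^ k (a ⊗ b))` on the Weyl algebra. -/
def weylTerm (Λ : V →ₗ[𝕂] V →ₗ[𝕂] 𝕂) (k : ℕ) (a b : Weyl 𝒱 E) : Weyl 𝒱 E := starTerm 𝒱 Λ k a b

/-- The star product `⋆_{zΛ}` on the Weyl algebra. -/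
def weylStar (Λ : V →ₗ[𝕂] V →ₗ[𝕂] 𝕂) (z : 𝕂) (a b : Weyl 𝒱 E) : Weyl 𝒱 E := symStar 𝒱 Λ z a b

/-- The symmetric tensor product on the completed Weyl algebra. -/
def cMul : CWeyl 𝒱 E → CWeyl 𝒱 E → CWeyl 𝒱 E := extend₂ (weylMul 𝒱 E)

/-- `(a, b) ↦ μ (P_Λ ^ k (a ⊗ b))` on the completed Weyl algebra. -/
def cTerm (Λ : V →ₗ[𝕂] V →ₗ[𝕂] 𝕂) (k : ℕ) : CWeyl 𝒱 E → CWeyl 𝒱 E → CWeyl 𝒱 E :=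
  extend₂ (weylTerm 𝒱 E Λ k)

/-- The star product `⋆_{zΛ}` on the completed Weyl algebra. -/
def cStar (Λ : V →ₗ[𝕂] V →ₗ[𝕂] 𝕂) (z : 𝕂) : CWeyl 𝒱 E → CWeyl 𝒱 E → CWeyl 𝒱 E :=
  extend₂ (weylStar 𝒱 E Λ z)

end Weyl

section Analysis

variable {𝕂 : Type*} [RCLike 𝕂] {F : Type*} [AddCommGroup F] [Module 𝕂 F] [TopologicalSpace F]

/-- The series `∑ₖ u k` converges absolutely to `s`: it is summable in every continuous seminorm
and its sum is `s`. -/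
def HasAbsSum (𝕂 : Type*) [RCLike 𝕂] {F : Type*} [AddCommGroup F] [Module 𝕂 F]
    [TopologicalSpace F] (u : ℕ → F) (s : F) : Prop :=
  (∀ q : Seminorm 𝕂 F, Continuous q → Summable fun k => q (u k)) ∧ HasSum u s

/-- `D 0, D 1, D 2, …` are the derivatives of all orders of `D 0 : 𝕂 → F`, and at every point the
Taylor series of `D 0` converges absolutely to `D 0` on all of `𝕂`. So `D 0` is real-analytic with
infinite radii of convergence if `𝕂 = ℝ`, and entire if `𝕂 = ℂ`. -/
def IsEntireWithDerivs (D : ℕ → 𝕂 → F) : Prop :=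
  (∀ k z, Filter.Tendsto (fun h : 𝕂 => h⁻¹ • (D k (z + h) - D k z)) (𝓝[≠] 0) (𝓝 (D (k + 1) z))) ∧
  ∀ z₀ z, HasAbsSum 𝕂 (fun k => ((z - z₀) ^ k / (k ! : 𝕂)) • D k z₀) (D 0 z)

end Analysis

end GradedWeyl

end

open GradedWeyl

noncomputable section

/-! Algebra. The kernel of the symmetrizer is exactly the ideal of T(V) generated by the graded
commutators of vectors (`symmetrizer_eq_zero`, `sub_symmetrizer_mem`), so S(V) is a quotient of
T(V). Since Λ is even, the contraction C on T(V) ⊗ T(V) descends to P_Λ (`contraction_map_toSym`),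
as the tensor product descends to μ (`symMul_toSym`). All identities may therefore be checked in
T(V). For homogeneous u let ι_u be the graded derivation of T(V) extending Λ(u, ·). The commutator
of C with left multiplication by u on the first factor is R_u = (parity sign) ⊗ ι_u, and R_u
commutes with C. Hence exp(zC) turns multiplication by u into multiplication by u plus z R_u.
Combined with the Leibniz rule this shows that L_u = u· + z ι_u satisfies L_u(x) ⋆ y = L_u(x ⋆ y)
(`vector_tensorStar`). Up to terms of lower degree every tensor arises from 1 by operators L_u, so ⋆
is associative already on T(V) (`tensorStar_assoc`).

Analysis. Contracting k times tensors of degrees n and m and multiplying costs at most n!/(n-k)! ·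
m!/(m-k)! · ((n+m-2k)!)^r. For r ≥ 1/2 each side contributes at most √(k!) c^n (n!)^r, so together
they give k!, which the 1/k! of the exponential cancels. The powers c^n are absorbed by rescaling p.
As k ≤ n, rescaling p by a further 1/θ gains θ^k with θ as small as desired, so the series converges
for all z (`contractionWeight_le`, `tensorSeminorm_starTerm_le`). For W_{R⁻} the exponent can be
raised to at least 1/2 inside the index set.

The rest is general. In a complete locally convex space, bilinear maps u_k with q(u_k(a, b)) ≤ k!
θ^k q'(a) q'(b) for all θ have an entire, jointly continuous exponential series (`BilinearGrowth`,
`EntireGrowth.isEntireWithDerivs`, `BilinearGrowth.continuous`). The estimate and the algebraic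
identities pass from W to its completion by density. -/

namespace GradedWeyl

/-! ### The tensor algebra: recursion over left multiplication by a homogeneous vector -/

section TensorAlgebraRecursion

variable {𝕂 : Type*} [RCLike 𝕂] {V : Type*} [AddCommGroup V] [Module 𝕂 V]

/-- The monomial `v₁ ⊗ ⋯ ⊗ vₙ` in the tensor algebra. -/
def monomial (𝕂 : Type*) [RCLike 𝕂] {V : Type*} [AddCommGroup V] [Module 𝕂 V] {n : ℕ}
    (v : Fin n → V) : TensorAlg 𝕂 V :=
  DirectSum.lof 𝕂 ℕ (fun n => ⨂[𝕂]^n V) n (PiTensorProduct.tprod 𝕂 v)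

/-- The embedding of `V` in tensor degree one. -/
def iota (𝕂 V : Type*) [RCLike 𝕂] [AddCommGroup V] [Module 𝕂 V] : V →ₗ[𝕂] TensorAlg 𝕂 V :=
  DirectSum.lof 𝕂 ℕ (fun n => ⨂[𝕂]^n V) 1 ∘ₗ
    (PiTensorProduct.subsingletonEquiv (0 : Fin 1) : _ ≃ₗ[𝕂] V).symm.toLinearMap

theorem monomial_eq_prod {n : ℕ} (v : Fin n → V) :
    monomial 𝕂 v = (List.ofFn fun i => iota 𝕂 V (v i)).prod := by
  have h := TensorAlgebra.toDirectSum_tensorPower_tprod (R := 𝕂) v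
  rw [TensorAlgebra.tprod_apply, map_list_prod, List.map_ofFn] at h
  rw [monomial, DirectSum.lof_eq_of, ← h]
  congr 2
  funext i
  simp [iota, TensorAlgebra.toDirectSum, TensorAlgebra.lift_ι_apply]

theorem monomial_cons {n : ℕ} (u : V) (v : Fin n → V) :
    monomial 𝕂 (Fin.cons u v : Fin (n + 1) → V) = iota 𝕂 V u * monomial 𝕂 v := by
  simp [monomial_eq_prod, List.ofFn_succ]

theorem monomial_zero (v : Fin 0 → V) : monomial 𝕂 v = 1 := by
  simp [monomial_eq_prod]

theorem monomial_append {n m : ℕ} (v : Fin n → V) (w : Fin m → V) :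
    monomial 𝕂 (Fin.append v w) = monomial 𝕂 v * monomial 𝕂 w := by
  simp only [monomial_eq_prod]
  rw [← List.prod_append, ← List.ofFn_fin_append]
  congr 2
  funext i
  refine Fin.addCases (fun i => ?_) (fun i => ?_) i <;> simp

variable (𝒱 : ZMod 2 → Submodule 𝕂 V) [DirectSum.Decomposition 𝒱]

theorem parityProj_mem (i : ZMod 2) (v : V) : parityProj 𝒱 i v ∈ 𝒱 i := by
  simp [parityProj]

theorem parityProj_of_mem {i : ZMod 2} {v : V} (hv : v ∈ 𝒱 i) (j : ZMod 2) :
    parityProj 𝒱 j v = if j = i then v else 0 := by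
  have : parityProj 𝒱 j v = (DirectSum.decompose 𝒱 v j : V) := rfl
  rw [this]
  split_ifs with h
  · subst h; exact DirectSum.decompose_of_mem_same 𝒱 hv
  · exact DirectSum.decompose_of_mem_ne 𝒱 hv (Ne.symm h)

theorem sum_parityProj (v : V) : ∑ i, parityProj 𝒱 i v = v := by
  classical
  have : ∀ i, parityProj 𝒱 i v = (DirectSum.decompose 𝒱 v i : V) := fun _ => rfl
  simp only [this]
  conv_rhs => rw [← DirectSum.sum_support_decompose 𝒱 v]
  symm
  refine Finset.sum_subset (Finset.subset_univ _) fun i _ hi => ?_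
  simpa using hi

theorem parityComponent_tprod {n : ℕ} {f : Fin n → ZMod 2} {v : Fin n → V}
    (hv : ∀ i, v i ∈ 𝒱 (f i)) (g : Fin n → ZMod 2) :
    parityComponent 𝒱 g (PiTensorProduct.tprod 𝕂 v) =
      if g = f then PiTensorProduct.tprod 𝕂 v else 0 := by
  rw [parityComponent, PiTensorProduct.map_tprod]
  split_ifs with h
  · subst h
    congr 1
    funext i
    rw [parityProj_of_mem 𝒱 (hv i), if_pos rfl]
  · obtain ⟨i, hi⟩ := Function.ne_iff.1 h
    exact (PiTensorProduct.tprod 𝕂).map_coord_zero i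
      (by rw [parityProj_of_mem 𝒱 (hv i), if_neg hi])

theorem tprod_eq_sum_parityProj {n : ℕ} (v : Fin n → V) :
    PiTensorProduct.tprod 𝕂 v =
      ∑ f : Fin n → ZMod 2, PiTensorProduct.tprod 𝕂 fun i => parityProj 𝒱 (f i) (v i) := by
  classical
  conv_lhs => rw [show v = fun i => ∑ j, parityProj 𝒱 j (v i) from
    funext fun i => (sum_parityProj 𝒱 (v i)).symm]
  rw [MultilinearMap.map_sum]

theorem span_homogeneous (n : ℕ) :
    Submodule.span 𝕂 {t : ⨂[𝕂]^n V | ∃ (f : Fin n → ZMod 2) (v : Fin n → V),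
      (∀ i, v i ∈ 𝒱 (f i)) ∧ PiTensorProduct.tprod 𝕂 v = t} = ⊤ := by
  rw [eq_top_iff, ← PiTensorProduct.span_tprod_eq_top, Submodule.span_le]
  rintro _ ⟨v, rfl⟩
  rw [tprod_eq_sum_parityProj 𝒱 v]
  exact sum_mem fun f _ => Submodule.subset_span ⟨f, _, fun i => parityProj_mem 𝒱 _ _, rfl⟩

/-- Signs are explicit only on homogeneous vectors. Splitting every entry into its even and odd part
shows that monomials with homogeneous entries span, so identities may be tested on them. -/
theorem tensorAlg_eq_top {S : Submodule 𝕂 (TensorAlg 𝕂 V)}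
    (h : ∀ (n : ℕ) (f : Fin n → ZMod 2) (v : Fin n → V), (∀ i, v i ∈ 𝒱 (f i)) →
      monomial 𝕂 v ∈ S) (x : TensorAlg 𝕂 V) : x ∈ S := by
  induction x using DirectSum.induction_on with
  | zero => exact S.zero_mem
  | add x y hx hy => exact S.add_mem hx hy
  | of n t =>
    have ht : t ∈ S.comap (DirectSum.lof 𝕂 ℕ (fun n => ⨂[𝕂]^n V) n) := by
      have : (⊤ : Submodule 𝕂 (⨂[𝕂]^n V)) ≤
          S.comap (DirectSum.lof 𝕂 ℕ (fun n => ⨂[𝕂]^n V) n) := by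
        rw [← span_homogeneous 𝒱 n, Submodule.span_le]
        rintro _ ⟨f, v, hv, rfl⟩
        exact h n f v hv
      exact this trivial
    simpa [DirectSum.lof_eq_of] using ht

/-- The induction principle behind most algebraic identities: T(V) is generated from 1 by left
multiplication with homogeneous vectors. -/
theorem tensorAlg_induction {S : Submodule 𝕂 (TensorAlg 𝕂 V)} (h1 : 1 ∈ S)
    (hmul : ∀ (i : ZMod 2), ∀ v ∈ 𝒱 i, ∀ x ∈ S, iota 𝕂 V v * x ∈ S)
    (x : TensorAlg 𝕂 V) : x ∈ S := by
  refine tensorAlg_eq_top 𝒱 (fun n f v hv => ?_) x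
  induction n with
  | zero => rw [monomial_zero]; exact h1
  | succ n ih =>
    rw [← Fin.cons_self_tail v, monomial_cons]
    exact hmul (f 0) _ (hv 0) _ (ih (Fin.tail f) (Fin.tail v) fun i => hv i.succ)

theorem linearMap_ext_induction {F : Type*} [AddCommMonoid F] [Module 𝕂 F]
    {A B : TensorAlg 𝕂 V →ₗ[𝕂] F} (h1 : A 1 = B 1)
    (hmul : ∀ (i : ZMod 2), ∀ v ∈ 𝒱 i, ∀ x, A x = B x → A (iota 𝕂 V v * x) = B (iota 𝕂 V v * x))
    (x : TensorAlg 𝕂 V) : A x = B x :=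
  tensorAlg_induction 𝒱 (S := LinearMap.eqLocus A B) h1 hmul x

theorem paritySign_add (a b : ZMod 2) :
    paritySign 𝕂 (a + b) = paritySign 𝕂 a * paritySign 𝕂 b := by
  have h : ∀ a b : ZMod 2, (a + b).val % 2 = (a.val + b.val) % 2 := by decide
  rw [paritySign, paritySign, paritySign, ← pow_add, neg_one_pow_eq_pow_mod_two, h,
    ← neg_one_pow_eq_pow_mod_two]

theorem paritySign_zero : paritySign 𝕂 0 = 1 := by simp [paritySign]

theorem paritySign_mul_self (a : ZMod 2) : paritySign 𝕂 a * paritySign 𝕂 a = 1 := by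
  rw [← paritySign_add, CharTwo.add_self_eq_zero, paritySign_zero]

theorem norm_paritySign (a : ZMod 2) : ‖paritySign 𝕂 a‖ = 1 := by
  simp [paritySign]

/-- The parity operator `w ↦ (-1) ^ (i |w|) w` on `V`. -/
def paritySgn (i : ZMod 2) : V →ₗ[𝕂] V := ∑ j, paritySign 𝕂 (i * j) • parityProj 𝒱 j

theorem paritySgn_of_mem (i : ZMod 2) {j : ZMod 2} {v : V} (hv : v ∈ 𝒱 j) :
    paritySgn 𝒱 i v = paritySign 𝕂 (i * j) • v := by
  simp [paritySgn, parityProj_of_mem 𝒱 hv]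

/-- The parity operator `x ↦ (-1) ^ (i |x|) x` on the tensor algebra. -/
def tensorSgn (i : ZMod 2) : TensorAlg 𝕂 V →ₗ[𝕂] TensorAlg 𝕂 V :=
  DirectSum.lmap fun _ => PiTensorProduct.map fun _ => paritySgn 𝒱 i

theorem tensorSgn_monomial (i : ZMod 2) {n : ℕ} (v : Fin n → V) :
    tensorSgn 𝒱 i (monomial 𝕂 v) = monomial 𝕂 fun k => paritySgn 𝒱 i (v k) := by
  simp [tensorSgn, monomial, DirectSum.lmap_lof, PiTensorProduct.map_tprod]

theorem tensorSgn_monomial_of_mem (i : ZMod 2) {n : ℕ} {f : Fin n → ZMod 2} {v : Fin n → V}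
    (hv : ∀ k, v k ∈ 𝒱 (f k)) :
    tensorSgn 𝒱 i (monomial 𝕂 v) = paritySign 𝕂 (i * ∑ k, f k) • monomial 𝕂 v := by
  rw [tensorSgn_monomial, monomial, monomial]
  have : (fun k => paritySgn 𝒱 i (v k)) = fun k => paritySign 𝕂 (i * f k) • v k :=
    funext fun k => paritySgn_of_mem 𝒱 i (hv k)
  rw [this, MultilinearMap.map_smul_univ, map_smul, Finset.mul_sum]
  congr 1
  have : ∀ s : Finset (Fin n), ∏ k ∈ s, paritySign 𝕂 (i * f k) =
      paritySign 𝕂 (∑ k ∈ s, i * f k) := by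
    intro s
    induction s using Finset.cons_induction with
    | empty => simp [paritySign_zero]
    | cons a s ha ih => rw [Finset.prod_cons, Finset.sum_cons, paritySign_add, ih]
  exact this _

theorem tensorSgn_one (i : ZMod 2) : tensorSgn 𝒱 i 1 = 1 := by
  rw [← monomial_zero (𝕂 := 𝕂) (Fin.elim0 : Fin 0 → V), tensorSgn_monomial, monomial_zero,
    monomial_zero]

theorem tensorSgn_iota_mul (i : ZMod 2) {j : ZMod 2} {v : V} (hv : v ∈ 𝒱 j)
    (x : TensorAlg 𝕂 V) :
    tensorSgn 𝒱 i (iota 𝕂 V v * x) = paritySign 𝕂 (i * j) • (iota 𝕂 V v * tensorSgn 𝒱 i x) := by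
  let A : TensorAlg 𝕂 V →ₗ[𝕂] TensorAlg 𝕂 V :=
    tensorSgn 𝒱 i ∘ₗ LinearMap.mulLeft 𝕂 (iota 𝕂 V v)
  let B : TensorAlg 𝕂 V →ₗ[𝕂] TensorAlg 𝕂 V :=
    paritySign 𝕂 (i * j) • (LinearMap.mulLeft 𝕂 (iota 𝕂 V v) ∘ₗ tensorSgn 𝒱 i)
  change x ∈ LinearMap.eqLocus A B
  refine tensorAlg_eq_top 𝒱 (fun n f w _ => ?_) x
  change tensorSgn 𝒱 i (iota 𝕂 V v * monomial 𝕂 w) =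
    paritySign 𝕂 (i * j) • (iota 𝕂 V v * tensorSgn 𝒱 i (monomial 𝕂 w))
  rw [← monomial_cons, tensorSgn_monomial, tensorSgn_monomial, ← smul_mul_assoc, ← map_smul,
    ← paritySgn_of_mem 𝒱 i hv, ← monomial_cons]
  congr 1
  funext k
  refine Fin.cases ?_ (fun k => ?_) k <;> simp

theorem extractFactor_tprod {n : ℕ} (k : Fin (n + 1)) (v : Fin (n + 1) → V) :
    extractFactor k (PiTensorProduct.tprod 𝕂 v) =
      v k ⊗ₜ[𝕂] PiTensorProduct.tprod 𝕂 (k.removeNth v) := by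
  simp [extractFactor, LinearMap.uncurryMid]

theorem pullRight_monomial {n : ℕ} {f : Fin (n + 1) → ZMod 2} {v : Fin (n + 1) → V}
    (hv : ∀ i, v i ∈ 𝒱 (f i)) :
    pullRight 𝒱 (monomial 𝕂 v) = ∑ k, paritySign 𝕂 (f k * ∑ j ∈ Finset.Ioi k, f j) •
      (v k ⊗ₜ[𝕂] monomial 𝕂 (k.removeNth v)) := by
  rw [pullRight, monomial, DirectSum.toModule_lof]
  simp only [LinearMap.comp_apply, LinearMap.sum_apply, LinearMap.smul_apply,
    parityComponent_tprod 𝒱 hv]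
  rw [Finset.sum_eq_single f (fun g _ hg => by simp [hg]) (by simp)]
  simp [extractFactor_tprod, monomial]

theorem pullLeft_monomial {n : ℕ} {f : Fin (n + 1) → ZMod 2} {v : Fin (n + 1) → V}
    (hv : ∀ i, v i ∈ 𝒱 (f i)) :
    pullLeft 𝒱 (monomial 𝕂 v) = ∑ k, paritySign 𝕂 (f k * ∑ j ∈ Finset.Iio k, f j) •
      (v k ⊗ₜ[𝕂] monomial 𝕂 (k.removeNth v)) := by
  rw [pullLeft, monomial, DirectSum.toModule_lof]
  simp only [LinearMap.comp_apply, LinearMap.sum_apply, LinearMap.smul_apply,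
    parityComponent_tprod 𝒱 hv]
  rw [Finset.sum_eq_single f (fun g _ hg => by simp [hg]) (by simp)]
  simp [extractFactor_tprod, monomial]

theorem pullRight_one : pullRight 𝒱 1 = 0 := by
  rw [← monomial_zero (𝕂 := 𝕂) (Fin.elim0 : Fin 0 → V), pullRight, monomial,
    DirectSum.toModule_lof]
  rfl

theorem pullLeft_one : pullLeft 𝒱 1 = 0 := by
  rw [← monomial_zero (𝕂 := 𝕂) (Fin.elim0 : Fin 0 → V), pullLeft, monomial,
    DirectSum.toModule_lof]
  rfl

/-- Extracting u itself moves it past all of x, hence `tensorSgn`. When another factor is extracted,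
u contributes no sign, because only factors to the right of the extracted one count. -/
theorem pullRight_iota_mul {i : ZMod 2} {u : V} (hu : u ∈ 𝒱 i) (x : TensorAlg 𝕂 V) :
    pullRight 𝒱 (iota 𝕂 V u * x) = u ⊗ₜ[𝕂] tensorSgn 𝒱 i x +
      TensorProduct.map LinearMap.id (LinearMap.mulLeft 𝕂 (iota 𝕂 V u)) (pullRight 𝒱 x) := by
  let A : TensorAlg 𝕂 V →ₗ[𝕂] V ⊗[𝕂] TensorAlg 𝕂 V :=
    pullRight 𝒱 ∘ₗ LinearMap.mulLeft 𝕂 (iota 𝕂 V u)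
  let B : TensorAlg 𝕂 V →ₗ[𝕂] V ⊗[𝕂] TensorAlg 𝕂 V :=
    TensorProduct.mk 𝕂 V _ u ∘ₗ tensorSgn 𝒱 i +
      TensorProduct.map LinearMap.id (LinearMap.mulLeft 𝕂 (iota 𝕂 V u)) ∘ₗ pullRight 𝒱
  change x ∈ LinearMap.eqLocus A B
  refine tensorAlg_eq_top 𝒱 (fun n f w hw => ?_) x
  change pullRight 𝒱 (iota 𝕂 V u * monomial 𝕂 w) = u ⊗ₜ[𝕂] tensorSgn 𝒱 i (monomial 𝕂 w) +
    TensorProduct.map LinearMap.id (LinearMap.mulLeft 𝕂 (iota 𝕂 V u)) (pullRight 𝒱 (monomial 𝕂 w))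
  have hc : ∀ k, (Fin.cons u w : Fin (n + 1) → V) k ∈ 𝒱 ((Fin.cons i f : Fin (n + 1) → _) k) :=
    fun k => Fin.cases (by simpa using hu) (fun k => by simpa using hw k) k
  rw [← monomial_cons, pullRight_monomial 𝒱 hc, Fin.sum_univ_succ]
  congr 1
  · rw [tensorSgn_monomial_of_mem 𝒱 i hw]
    simp [Fin.Ioi_zero_eq_map]
  · cases n with
    | zero => simp [monomial_zero, pullRight_one]
    | succ n =>
      rw [pullRight_monomial 𝒱 hw, map_sum]
      refine Finset.sum_congr rfl fun k _ => ?_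
      have : (k.succ.removeNth (Fin.cons u w : Fin (n + 2) → V)) =
          Fin.cons u (k.removeNth w) := by
        funext j
        refine Fin.cases ?_ (fun j => ?_) j <;> simp [Fin.removeNth]
      rw [this, map_smul, TensorProduct.map_tmul, LinearMap.mulLeft_apply, ← monomial_cons]
      simp [← Fin.map_succEmb_Ioi]

/-- Mirror image of `pullRight_iota_mul`: u is extracted without sign, whereas every other factor
has to pass u, and this sign is `paritySgn` of the extracted vector. -/
theorem pullLeft_iota_mul {i : ZMod 2} {u : V} (hu : u ∈ 𝒱 i) (x : TensorAlg 𝕂 V) :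
    pullLeft 𝒱 (iota 𝕂 V u * x) = u ⊗ₜ[𝕂] x +
      TensorProduct.map (paritySgn 𝒱 i) (LinearMap.mulLeft 𝕂 (iota 𝕂 V u)) (pullLeft 𝒱 x) := by
  let A : TensorAlg 𝕂 V →ₗ[𝕂] V ⊗[𝕂] TensorAlg 𝕂 V :=
    pullLeft 𝒱 ∘ₗ LinearMap.mulLeft 𝕂 (iota 𝕂 V u)
  let B : TensorAlg 𝕂 V →ₗ[𝕂] V ⊗[𝕂] TensorAlg 𝕂 V :=
    TensorProduct.mk 𝕂 V _ u +
      TensorProduct.map (paritySgn 𝒱 i) (LinearMap.mulLeft 𝕂 (iota 𝕂 V u)) ∘ₗ pullLeft 𝒱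
  change x ∈ LinearMap.eqLocus A B
  refine tensorAlg_eq_top 𝒱 (fun n f w hw => ?_) x
  change pullLeft 𝒱 (iota 𝕂 V u * monomial 𝕂 w) = u ⊗ₜ[𝕂] (monomial 𝕂 w) +
    TensorProduct.map (paritySgn 𝒱 i) (LinearMap.mulLeft 𝕂 (iota 𝕂 V u)) (pullLeft 𝒱 (monomial 𝕂 w))
  have hc : ∀ k, (Fin.cons u w : Fin (n + 1) → V) k ∈ 𝒱 ((Fin.cons i f : Fin (n + 1) → _) k) :=
    fun k => Fin.cases (by simpa using hu) (fun k => by simpa using hw k) k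
  rw [← monomial_cons, pullLeft_monomial 𝒱 hc, Fin.sum_univ_succ]
  congr 1
  · have : Finset.Iio (0 : Fin (n + 1)) = ∅ := Finset.Iio_eq_empty.2 isMin_bot
    simp [this, paritySign_zero]
  · cases n with
    | zero => simp [monomial_zero, pullLeft_one]
    | succ n =>
      rw [pullLeft_monomial 𝒱 hw, map_sum]
      refine Finset.sum_congr rfl fun k _ => ?_
      have : (k.succ.removeNth (Fin.cons u w : Fin (n + 2) → V)) =
          Fin.cons u (k.removeNth w) := by
        funext j
        refine Fin.cases ?_ (fun j => ?_) j <;> simp [Fin.removeNth]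
      rw [this, map_smul, TensorProduct.map_tmul, LinearMap.mulLeft_apply, ← monomial_cons,
        paritySgn_of_mem 𝒱 i (hw k), ← TensorProduct.smul_tmul', smul_smul, ← paritySign_add]
      congr 2
      -- Position 0, occupied by u, is the only new factor to the left of the extracted one, and it
      -- accounts for the extra sign.
      have : Finset.Iio k.succ = insert 0 ((Finset.Iio k).map (Fin.succEmb _)) := by
        ext j
        refine Fin.cases ?_ (fun j => ?_) j <;> simp
      rw [this, Finset.sum_insert (by simp), Finset.sum_map]
      simp only [Fin.cons_zero, Fin.cons_succ, Fin.coe_succEmb]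
      ring_nf

/-- The contraction `(v ⊗ x) ⊗ (w ⊗ y) ↦ Λ(v, w) x ⊗ y`. -/
def pairing (Λ : V →ₗ[𝕂] V →ₗ[𝕂] 𝕂) :
    (V ⊗[𝕂] TensorAlg 𝕂 V) ⊗[𝕂] (V ⊗[𝕂] TensorAlg 𝕂 V) →ₗ[𝕂]
      TensorAlg 𝕂 V ⊗[𝕂] TensorAlg 𝕂 V :=
  (TensorProduct.lid 𝕂 _).toLinearMap ∘ₗ
    TensorProduct.map (TensorProduct.lift Λ) LinearMap.id ∘ₗ
    (TensorProduct.tensorTensorTensorComm 𝕂 V (TensorAlg 𝕂 V) V (TensorAlg 𝕂 V)).toLinearMap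

theorem tensorContraction_tmul (Λ : V →ₗ[𝕂] V →ₗ[𝕂] 𝕂) (x y : TensorAlg 𝕂 V) :
    tensorContraction 𝒱 Λ (x ⊗ₜ[𝕂] y) = pairing Λ (pullRight 𝒱 x ⊗ₜ[𝕂] pullLeft 𝒱 y) := rfl

theorem pairing_tmul (Λ : V →ₗ[𝕂] V →ₗ[𝕂] 𝕂) (v w : V) (x y : TensorAlg 𝕂 V) :
    pairing Λ ((v ⊗ₜ[𝕂] x) ⊗ₜ[𝕂] (w ⊗ₜ[𝕂] y)) = Λ v w • (x ⊗ₜ[𝕂] y) := by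
  simp [pairing]

/-- The graded derivation of the tensor algebra that extends `w ↦ Λ(u, w)`. -/
def insertion (Λ : V →ₗ[𝕂] V →ₗ[𝕂] 𝕂) (u : V) : TensorAlg 𝕂 V →ₗ[𝕂] TensorAlg 𝕂 V :=
  (TensorProduct.lid 𝕂 _).toLinearMap ∘ₗ TensorProduct.map (Λ u) LinearMap.id ∘ₗ pullLeft 𝒱

theorem insertion_one (Λ : V →ₗ[𝕂] V →ₗ[𝕂] 𝕂) (u : V) : insertion 𝒱 Λ u 1 = 0 := by
  simp [insertion, pullLeft_one]

/-- The bilinear form is even: it vanishes on vectors of different parity. -/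
def IsEvenForm (Λ : V →ₗ[𝕂] V →ₗ[𝕂] 𝕂) : Prop :=
  ∀ i j, i ≠ j → ∀ v ∈ 𝒱 i, ∀ w ∈ 𝒱 j, Λ v w = 0

/-- Only the component of w with the parity of u contributes, so the parity operator acts as the
scalar belonging to u. -/
theorem IsEvenForm.apply_paritySgn {Λ : V →ₗ[𝕂] V →ₗ[𝕂] 𝕂} (hΛ : IsEvenForm 𝒱 Λ)
    {i : ZMod 2} {u : V} (hu : u ∈ 𝒱 i) (j : ZMod 2) (w : V) :
    Λ u (paritySgn 𝒱 j w) = paritySign 𝕂 (j * i) * Λ u w := by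
  conv_rhs => rw [← sum_parityProj 𝒱 w, map_sum, Finset.mul_sum]
  simp only [paritySgn, LinearMap.sum_apply, LinearMap.smul_apply, map_sum, map_smul, smul_eq_mul]
  refine Finset.sum_congr rfl fun k _ => ?_
  by_cases h : i = k
  · rw [h]
  · rw [hΛ i k h u hu _ (parityProj_mem 𝒱 k w)]; simp

/-- The Leibniz rule for a vector as left factor. `pullLeft_iota_mul` puts the sign on the extracted
vector, and evenness of Λ transfers it to u. -/
theorem insertion_iota_mul {Λ : V →ₗ[𝕂] V →ₗ[𝕂] 𝕂} (hΛ : IsEvenForm 𝒱 Λ)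
    {i j : ZMod 2} {u w : V} (hu : u ∈ 𝒱 i) (hw : w ∈ 𝒱 j) (x : TensorAlg 𝕂 V) :
    insertion 𝒱 Λ u (iota 𝕂 V w * x) =
      Λ u w • x + paritySign 𝕂 (j * i) • (iota 𝕂 V w * insertion 𝒱 Λ u x) := by
  simp only [insertion, LinearMap.comp_apply, pullLeft_iota_mul 𝒱 hw, map_add]
  generalize pullLeft 𝒱 x = t
  congr 1
  induction t with
  | zero => simp
  | add s t hs ht => simp only [map_add, hs, ht, mul_add, smul_add]
  | tmul v y => simp [hΛ.apply_paritySgn 𝒱 hu, smul_smul]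

theorem tensorContraction_one (Λ : V →ₗ[𝕂] V →ₗ[𝕂] 𝕂) (y : TensorAlg 𝕂 V) :
    tensorContraction 𝒱 Λ (1 ⊗ₜ[𝕂] y) = 0 := by
  simp [tensorContraction_tmul, pullRight_one]

/-- The commutator of the contraction with left multiplication by u is the term in which u itself is
contracted. All later algebra rests on this relation. -/
theorem tensorContraction_iota_mul (Λ : V →ₗ[𝕂] V →ₗ[𝕂] 𝕂) {i : ZMod 2} {u : V} (hu : u ∈ 𝒱 i)
    (x y : TensorAlg 𝕂 V) :
    tensorContraction 𝒱 Λ ((iota 𝕂 V u * x) ⊗ₜ[𝕂] y) =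
      (LinearMap.mulLeft 𝕂 (iota 𝕂 V u)).rTensor _ (tensorContraction 𝒱 Λ (x ⊗ₜ[𝕂] y)) +
        tensorSgn 𝒱 i x ⊗ₜ[𝕂] insertion 𝒱 Λ u y := by
  rw [tensorContraction_tmul, tensorContraction_tmul, pullRight_iota_mul 𝒱 hu,
    TensorProduct.add_tmul, map_add, add_comm, insertion]
  simp only [LinearMap.comp_apply]
  generalize pullLeft 𝒱 y = t
  congr 1
  · generalize pullRight 𝒱 x = s
    induction s with
    | zero => simp
    | add s s' hs hs' => simp only [map_add, TensorProduct.add_tmul, hs, hs']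
    | tmul v x =>
      induction t with
      | zero => simp
      | add t t' ht ht' => simp only [map_add, TensorProduct.tmul_add, ht, ht']
      | tmul w y => simp [pairing_tmul]
  · induction t with
    | zero => simp
    | add t t' ht ht' => simp only [map_add, TensorProduct.tmul_add, ht, ht']
    | tmul w y => simp [pairing_tmul]

/-- The explicit double sum serves the estimates, where the number of terms matters; the algebra
uses the recursion. -/
theorem tensorContraction_monomial (Λ : V →ₗ[𝕂] V →ₗ[𝕂] 𝕂) {n m : ℕ}
    {f : Fin (n + 1) → ZMod 2} {v : Fin (n + 1) → V} (hv : ∀ i, v i ∈ 𝒱 (f i))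
    {g : Fin (m + 1) → ZMod 2} {w : Fin (m + 1) → V} (hw : ∀ i, w i ∈ 𝒱 (g i)) :
    tensorContraction 𝒱 Λ (monomial 𝕂 v ⊗ₜ[𝕂] monomial 𝕂 w) =
      ∑ k, ∑ l, (paritySign 𝕂 (f k * ∑ j ∈ Finset.Ioi k, f j) *
        paritySign 𝕂 (g l * ∑ j ∈ Finset.Iio l, g j) * Λ (v k) (w l)) •
          (monomial 𝕂 (k.removeNth v) ⊗ₜ[𝕂] monomial 𝕂 (l.removeNth w)) := by
  rw [tensorContraction_tmul, pullRight_monomial 𝒱 hv, pullLeft_monomial 𝒱 hw,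
    TensorProduct.sum_tmul, map_sum]
  refine Finset.sum_congr rfl fun k _ => ?_
  rw [TensorProduct.tmul_sum, map_sum]
  refine Finset.sum_congr rfl fun l _ => ?_
  rw [TensorProduct.smul_tmul_smul, map_smul, pairing_tmul, smul_smul]

end TensorAlgebraRecursion

end GradedWeyl

end

noncomputable section

namespace GradedWeyl

/-! ### The ideal of graded commutators as kernel of the symmetrizer, and descent of the contraction
-/

section Symmetrization

variable {𝕂 : Type*} [RCLike 𝕂] {V : Type*} [AddCommGroup V] [Module 𝕂 V]

/-- Rewrites the sign over the pairs with second entry below the first, for which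
`Equiv.Perm.signBijAux` supplies the reindexing needed in `koszulSign_mul`. -/
theorem koszulSign_eq_prod_pairs {n : ℕ} (f : Fin n → ZMod 2) (σ : Equiv.Perm (Fin n)) :
    koszulSign 𝕂 f σ = ∏ x ∈ Equiv.Perm.finPairsLT n,
      if σ x.1 < σ x.2 then paritySign 𝕂 (f (σ x.1) * f (σ x.2)) else 1 := by
  rw [koszulSign, Finset.prod_comm, Finset.prod_sigma']
  symm
  refine (Finset.prod_congr rfl fun x hx => ?_).trans
    (Finset.prod_subset (Finset.subset_univ _) fun x _ hx => ?_)
  · rw [Equiv.Perm.mem_finPairsLT] at hx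
    simp [hx, mul_comm]
  · rw [Equiv.Perm.mem_finPairsLT] at hx
    simp [hx]

/-- The cocycle identity. Reindexed along τ, each pair is compared under τ and then under σ:
inverted once, it contributes its sign once; inverted twice, the two equal signs cancel. -/
theorem koszulSign_mul {n : ℕ} (f : Fin n → ZMod 2) (σ τ : Equiv.Perm (Fin n)) :
    koszulSign 𝕂 f (σ * τ) = koszulSign 𝕂 f σ * koszulSign 𝕂 (f ∘ σ) τ := by
  have key : ∏ x ∈ Equiv.Perm.finPairsLT n,
      (if σ x.1 < σ x.2 then paritySign 𝕂 (f (σ x.1) * f (σ x.2)) else 1) =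
      ∏ x ∈ Equiv.Perm.finPairsLT n,
        if σ (Equiv.Perm.signBijAux τ x).1 < σ (Equiv.Perm.signBijAux τ x).2 then
          paritySign 𝕂 (f (σ (Equiv.Perm.signBijAux τ x).1) *
            f (σ (Equiv.Perm.signBijAux τ x).2)) else 1 :=
    (Finset.prod_nbij (Equiv.Perm.signBijAux τ) Equiv.Perm.signBijAux_mem
      Equiv.Perm.signBijAux_injOn Equiv.Perm.signBijAux_surj fun _ _ => rfl).symm
  rw [koszulSign_eq_prod_pairs, koszulSign_eq_prod_pairs f σ, koszulSign_eq_prod_pairs _ τ, key,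
    ← Finset.prod_mul_distrib]
  refine Finset.prod_congr rfl fun x hx => ?_
  obtain ⟨a, b⟩ := x
  rw [Equiv.Perm.mem_finPairsLT] at hx
  have hτ : τ a ≠ τ b := τ.injective.ne (ne_of_gt hx)
  have hσ : σ (τ a) ≠ σ (τ b) := σ.injective.ne hτ
  change (if σ (τ a) < σ (τ b) then paritySign 𝕂 (f (σ (τ a)) * f (σ (τ b))) else 1) =
    (if σ (Equiv.Perm.signBijAux τ ⟨a, b⟩).1 < σ (Equiv.Perm.signBijAux τ ⟨a, b⟩).2 then
      paritySign 𝕂 (f (σ (Equiv.Perm.signBijAux τ ⟨a, b⟩).1) *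
        f (σ (Equiv.Perm.signBijAux τ ⟨a, b⟩).2)) else 1) *
      (if τ a < τ b then paritySign 𝕂 (f (σ (τ a)) * f (σ (τ b))) else 1)
  by_cases h : τ b < τ a
  · rw [show Equiv.Perm.signBijAux τ ⟨a, b⟩ = ⟨τ a, τ b⟩ from dif_pos h,
      if_neg (not_lt_of_gt h), mul_one]
  · have h' : τ a < τ b := lt_of_le_of_ne (not_lt.1 h) hτ
    rw [show Equiv.Perm.signBijAux τ ⟨a, b⟩ = ⟨τ b, τ a⟩ from dif_neg h, if_pos h']
    by_cases h2 : σ (τ a) < σ (τ b)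
    · rw [if_pos h2, if_neg (not_lt_of_gt h2), one_mul]
    · have h2' : σ (τ b) < σ (τ a) := lt_of_le_of_ne (not_lt.1 h2) hσ.symm
      rw [if_neg h2, if_pos h2', mul_comm (f (σ (τ b))), paritySign_mul_self]

/-- An adjacent transposition inverts just one pair. -/
theorem koszulSign_swap {n : ℕ} (f : Fin n → ZMod 2) {p q : Fin n} (h : p.val + 1 = q.val) :
    koszulSign 𝕂 f (Equiv.swap p q) = paritySign 𝕂 (f p * f q) := by
  have hpq : p < q := Fin.lt_def.2 (by omega)
  rw [koszulSign_eq_prod_pairs, Finset.prod_eq_single ⟨q, p⟩]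
  · simp [hpq]
  · rintro ⟨a, b⟩ hab hne
    rw [Equiv.Perm.mem_finPairsLT] at hab
    refine if_neg ?_
    dsimp only at hab ⊢
    simp only [Fin.lt_def, Equiv.swap_apply_def] at hab ⊢
    have hne' : ¬ (a = q ∧ b = p) := by
      rintro ⟨rfl, rfl⟩; exact hne rfl
    simp only [Fin.ext_iff] at hne' ⊢
    split_ifs <;> omega
  · intro hx
    exact absurd (Equiv.Perm.mem_finPairsLT.2 hpq) hx

variable (𝒱 : ZMod 2 → Submodule 𝕂 V) [DirectSum.Decomposition 𝒱]

theorem permAction_tprod {n : ℕ} {f : Fin n → ZMod 2} {v : Fin n → V}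
    (hv : ∀ i, v i ∈ 𝒱 (f i)) (σ : Equiv.Perm (Fin n)) :
    permAction 𝒱 σ (PiTensorProduct.tprod 𝕂 v) =
      koszulSign 𝕂 f σ • PiTensorProduct.tprod 𝕂 (v ∘ σ) := by
  simp only [permAction, LinearMap.sum_apply, LinearMap.smul_apply, LinearMap.comp_apply,
    parityComponent_tprod 𝒱 hv]
  rw [Finset.sum_eq_single f (fun g _ hg => by simp [hg]) (by simp), if_pos rfl]
  refine congrArg (koszulSign 𝕂 f σ • ·) ?_
  exact PiTensorProduct.reindex_tprod (R := 𝕂) (s := fun _ : Fin n => V) σ.symm v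

theorem symmetrizer_monomial {n : ℕ} {f : Fin n → ZMod 2} {v : Fin n → V}
    (hv : ∀ i, v i ∈ 𝒱 (f i)) :
    symmetrizer 𝒱 (monomial 𝕂 v) = (n ! : 𝕂)⁻¹ •
      ∑ σ : Equiv.Perm (Fin n), koszulSign 𝕂 f σ • monomial 𝕂 (v ∘ σ) := by
  simp [symmetrizer, monomial, DirectSum.lmap_lof, symmetrizerPow, permAction_tprod 𝒱 hv]

/-- Substituting τσ for σ in the sum over the symmetric group and using the cocycle identity pulls
out the sign of τ. -/
theorem symmetrizer_monomial_comp {n : ℕ} {f : Fin n → ZMod 2} {v : Fin n → V}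
    (hv : ∀ i, v i ∈ 𝒱 (f i)) (τ : Equiv.Perm (Fin n)) :
    symmetrizer 𝒱 (monomial 𝕂 v) = koszulSign 𝕂 f τ • symmetrizer 𝒱 (monomial 𝕂 (v ∘ τ)) := by
  rw [symmetrizer_monomial 𝒱 hv,
    symmetrizer_monomial 𝒱 (f := f ∘ τ) (v := v ∘ τ) (fun i => hv (τ i)), smul_comm]
  refine congrArg (fun t : TensorAlg 𝕂 V => (n ! : 𝕂)⁻¹ • t) ?_
  rw [Finset.smul_sum, ← Equiv.sum_comp (Equiv.mulLeft τ) fun σ => koszulSign 𝕂 f σ • monomial 𝕂 (v ∘ σ)]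
  refine Finset.sum_congr rfl fun σ _ => ?_
  rw [Equiv.coe_mulLeft, koszulSign_mul, smul_smul]
  rfl

/-- The graded commutator `v ⊗ w - (-1) ^ (ij) w ⊗ v` of vectors of parities `i` and `j`. -/
def koszulBracket (i j : ZMod 2) (v w : V) : TensorAlg 𝕂 V :=
  iota 𝕂 V v * iota 𝕂 V w - paritySign 𝕂 (i * j) • (iota 𝕂 V w * iota 𝕂 V v)

/-- The two-sided ideal of the tensor algebra generated by the graded commutators of vectors. -/
def koszulIdeal : Submodule 𝕂 (TensorAlg 𝕂 V) :=
  Submodule.span 𝕂 {t | ∃ (i j : ZMod 2) (v w : V) (x y : TensorAlg 𝕂 V),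
    v ∈ 𝒱 i ∧ w ∈ 𝒱 j ∧ x * (koszulBracket i j v w * y) = t}

omit [DirectSum.Decomposition 𝒱] in
theorem mul_mem_koszulIdeal (x : TensorAlg 𝕂 V) {t : TensorAlg 𝕂 V} (ht : t ∈ koszulIdeal 𝒱) :
    x * t ∈ koszulIdeal 𝒱 := by
  suffices h : koszulIdeal 𝒱 ≤ (koszulIdeal 𝒱).comap (LinearMap.mulLeft 𝕂 x) from h ht
  refine Submodule.span_le.2 ?_
  rintro _ ⟨i, j, v, w, a, b, hv, hw, rfl⟩
  exact Submodule.subset_span ⟨i, j, v, w, x * a, b, hv, hw, mul_assoc _ _ _⟩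

omit [DirectSum.Decomposition 𝒱] in
theorem koszulIdeal_mul_mem (x : TensorAlg 𝕂 V) {t : TensorAlg 𝕂 V} (ht : t ∈ koszulIdeal 𝒱) :
    t * x ∈ koszulIdeal 𝒱 := by
  suffices h : koszulIdeal 𝒱 ≤ (koszulIdeal 𝒱).comap (LinearMap.mulRight 𝕂 x) from h ht
  refine Submodule.span_le.2 ?_
  rintro _ ⟨i, j, v, w, a, b, hv, hw, rfl⟩
  exact Submodule.subset_span ⟨i, j, v, w, a, b * x, hv, hw, by
    rw [LinearMap.mulRight_apply, mul_assoc, mul_assoc]⟩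

omit [DirectSum.Decomposition 𝒱] in
variable {𝒱} in
theorem koszulBracket_mul_mem {i j : ZMod 2} {v w : V} (hv : v ∈ 𝒱 i) (hw : w ∈ 𝒱 j)
    (y : TensorAlg 𝕂 V) : koszulBracket i j v w * y ∈ koszulIdeal 𝒱 :=
  Submodule.subset_span ⟨i, j, v, w, 1, y, hv, hw, one_mul _⟩

/-- Induction on the left factor of a generator. Membership in the ideal is carried along because
the Leibniz-type rules, applied to u·t, also produce a term in which t survives without u. -/
theorem koszulIdeal_le {S : Submodule 𝕂 (TensorAlg 𝕂 V)}
    (hgen : ∀ (i j : ZMod 2), ∀ v ∈ 𝒱 i, ∀ w ∈ 𝒱 j, ∀ y, koszulBracket i j v w * y ∈ S)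
    (hmul : ∀ (k : ZMod 2), ∀ u ∈ 𝒱 k, ∀ t ∈ koszulIdeal 𝒱, t ∈ S → iota 𝕂 V u * t ∈ S) :
    koszulIdeal 𝒱 ≤ S := by
  refine Submodule.span_le.2 ?_
  rintro _ ⟨i, j, v, w, x, y, hv, hw, rfl⟩
  have h : x ∈ (S ⊓ koszulIdeal 𝒱).comap
      (LinearMap.mulRight 𝕂 (koszulBracket i j v w * y : TensorAlg 𝕂 V)) := by
    refine tensorAlg_induction 𝒱 ?_ (fun k u hu x hx => ?_) x
    · simpa using ⟨hgen i j v hv w hw y, koszulBracket_mul_mem hv hw y⟩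
    · simp only [Submodule.mem_comap, LinearMap.mulRight_apply] at hx ⊢
      rw [mul_assoc]
      exact ⟨hmul k u hu _ hx.2 hx.1, mul_mem_koszulIdeal 𝒱 _ hx.2⟩
  exact h.1

/-- With monomials a and b around it, a graded commutator becomes a monomial minus the Koszul sign
times its adjacent swap, and the symmetrizer identifies the two. -/
theorem symmetrizer_eq_zero {t : TensorAlg 𝕂 V} (ht : t ∈ koszulIdeal 𝒱) :
    symmetrizer 𝒱 t = 0 := by
  suffices h : koszulIdeal 𝒱 ≤ LinearMap.ker (symmetrizer 𝒱) from h ht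
  refine Submodule.span_le.2 ?_
  rintro _ ⟨i, j, v, w, x, y, hv, hw, rfl⟩
  have hx : x ∈ (LinearMap.ker (symmetrizer 𝒱)).comap
      (LinearMap.mulRight 𝕂 (koszulBracket i j v w * y : TensorAlg 𝕂 V)) := by
    refine tensorAlg_eq_top 𝒱 (fun n f a ha => ?_) x
    have hy : y ∈ (LinearMap.ker (symmetrizer 𝒱)).comap
        (LinearMap.mulLeft 𝕂 (monomial 𝕂 a) ∘ₗ
          LinearMap.mulLeft 𝕂 (koszulBracket i j v w : TensorAlg 𝕂 V)) := by
      refine tensorAlg_eq_top 𝒱 (fun m g b hb => ?_) y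
      simp only [Submodule.mem_comap, LinearMap.comp_apply, LinearMap.mulLeft_apply,
        LinearMap.mem_ker]
      let F : Fin (n + (m + 2)) → ZMod 2 := Fin.append f (Fin.cons i (Fin.cons j g))
      let U : Fin (n + (m + 2)) → V := Fin.append a (Fin.cons v (Fin.cons w b))
      -- The n entries of a come first, so v and w occupy the positions n and n + 1.
      let τ : Equiv.Perm (Fin (n + (m + 2))) := Equiv.swap (Fin.natAdd n 0) (Fin.natAdd n 1)
      have hU : ∀ k, U k ∈ 𝒱 (F k) := by
        refine Fin.addCases (fun k => ?_) (fun k => ?_)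
        · simpa [U, F] using ha k
        · refine Fin.cases ?_ (Fin.cases ?_ fun k => ?_) k
          · simpa [U, F] using hv
          · simpa [U, F] using hw
          · simpa [U, F] using hb k
      have hτ : U ∘ τ = Fin.append a (Fin.cons w (Fin.cons v b)) := by
        funext k
        refine Fin.addCases (fun k => ?_) (fun k => ?_) k
        · have h1 : Fin.castAdd (m + 2) k ≠ Fin.natAdd n 0 := by
            simp [Fin.ext_iff]; omega
          have h2 : Fin.castAdd (m + 2) k ≠ Fin.natAdd n 1 := by
            simp [Fin.ext_iff]; omega
          simp only [Function.comp_apply, τ, Equiv.swap_apply_of_ne_of_ne h1 h2]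
          simp [U]
        · refine Fin.cases ?_ (Fin.cases ?_ fun k => ?_) k
          · simp only [Function.comp_apply, τ, Equiv.swap_apply_left]
            simp [U]
          · have : (Fin.succ 0 : Fin (m + 2)) = 1 := rfl
            simp only [Function.comp_apply, τ, this, Equiv.swap_apply_right]
            simp [U]
          · have h1 : Fin.natAdd n k.succ.succ ≠ Fin.natAdd n 0 := by
              simp [Fin.ext_iff]
            have h2 : Fin.natAdd n k.succ.succ ≠ Fin.natAdd n 1 := by
              simp [Fin.ext_iff]
            simp only [Function.comp_apply, τ, Equiv.swap_apply_of_ne_of_ne h1 h2]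
            simp [U]
      have hk := symmetrizer_monomial_comp 𝒱 hU τ
      rw [koszulSign_swap F (by simp), hτ] at hk
      have hF0 : F (Fin.natAdd n 0) = i := by simp [F]
      have hF1 : F (Fin.natAdd n 1) = j := by
        simp only [F, Fin.append_right]; rfl
      rw [hF0, hF1] at hk
      simp only [U, monomial_append, monomial_cons] at hk
      rw [koszulBracket, sub_mul, mul_sub, map_sub, sub_eq_zero, mul_assoc, hk, smul_mul_assoc,
        mul_smul_comm, map_smul, mul_assoc]
    simpa [mul_assoc] using hy
  simpa [mul_assoc] using hx

-- Left factors are peeled off until the transposed entries are the first two, where the difference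
-- is a generator of the ideal.
omit [DirectSum.Decomposition 𝒱] in
theorem monomial_sub_swap_mem (n : ℕ) (i : Fin n) (f : Fin (n + 1) → ZMod 2)
    (v : Fin (n + 1) → V) (hv : ∀ k, v k ∈ 𝒱 (f k)) :
    monomial 𝕂 v - paritySign 𝕂 (f i.castSucc * f i.succ) •
      monomial 𝕂 (v ∘ Equiv.swap i.castSucc i.succ) ∈ koszulIdeal 𝒱 := by
  induction n with
  | zero => exact i.elim0
  | succ n ih =>
    refine Fin.cases ?_ (fun i => ?_) i
    · have h1 : v = Fin.cons (v 0) (Fin.cons (v 1) fun k => v k.succ.succ) := by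
        funext k
        refine Fin.cases rfl (Fin.cases rfl fun k => ?_) k
        simp
      have h2 : v ∘ Equiv.swap (Fin.castSucc 0) (Fin.succ 0) =
          Fin.cons (v 1) (Fin.cons (v 0) fun k => v k.succ.succ) := by
        funext k
        refine Fin.cases ?_ (Fin.cases ?_ fun k => ?_) k
        · simp
        · simp
        · have h1 : k.succ.succ ≠ (Fin.castSucc 0 : Fin (n + 2)) := by simp [Fin.ext_iff]
          have h2 : k.succ.succ ≠ (Fin.succ 0 : Fin (n + 2)) := by simp [Fin.ext_iff]
          simp only [Function.comp_apply, Equiv.swap_apply_of_ne_of_ne h1 h2, Fin.cons_succ]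
      rw [h2, monomial_cons, monomial_cons]
      conv in monomial 𝕂 v => rw [h1, monomial_cons, monomial_cons]
      have := koszulBracket_mul_mem (𝒱 := 𝒱) (hv 0) (hv 1) (monomial 𝕂 fun k => v k.succ.succ)
      rwa [koszulBracket, sub_mul, mul_assoc, smul_mul_assoc, mul_assoc] at this
    · have h2 : v ∘ Equiv.swap (Fin.castSucc i.succ) (Fin.succ i.succ) =
          Fin.cons (v 0) (Fin.tail v ∘ Equiv.swap i.castSucc i.succ) := by
        funext k
        refine Fin.cases ?_ (fun k => ?_) k
        · have h1 : (0 : Fin (n + 2)) ≠ i.succ.castSucc := by simp [Fin.ext_iff]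
          have h2 : (0 : Fin (n + 2)) ≠ i.succ.succ := by simp [Fin.ext_iff]
          simp only [Function.comp_apply, Equiv.swap_apply_of_ne_of_ne h1 h2, Fin.cons_zero]
        · simp only [Function.comp_apply, Fin.cons_succ, Fin.tail, ← Fin.succ_castSucc]
          rw [(Fin.succ_injective _).swap_apply]
      rw [h2, monomial_cons]
      conv in monomial 𝕂 v => rw [← Fin.cons_self_tail v, monomial_cons]
      rw [← mul_smul_comm, ← mul_sub]
      exact mul_mem_koszulIdeal 𝒱 _ (ih i (Fin.tail f) (Fin.tail v) fun k => hv k.succ)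

-- Adjacent transpositions generate the symmetric group as a monoid, and the differences telescope
-- by the cocycle identity.
omit [DirectSum.Decomposition 𝒱] in
theorem monomial_sub_perm_mem {n : ℕ} (σ : Equiv.Perm (Fin n)) (f : Fin n → ZMod 2)
    (v : Fin n → V) (hv : ∀ k, v k ∈ 𝒱 (f k)) :
    monomial 𝕂 v - koszulSign 𝕂 f σ • monomial 𝕂 (v ∘ σ) ∈ koszulIdeal 𝒱 := by
  cases n with
  | zero => simp [monomial_zero, koszulSign]
  | succ n =>
    have hσ : σ ∈ Submonoid.closure
        (Set.range fun i : Fin n => Equiv.swap i.castSucc i.succ) := by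
      rw [Equiv.Perm.mclosure_swap_castSucc_succ]; trivial
    induction hσ using Submonoid.closure_induction generalizing f v with
    | mem σ h =>
      obtain ⟨i, rfl⟩ := h
      rw [koszulSign_swap f (by simp)]
      exact monomial_sub_swap_mem 𝒱 n i f v hv
    | one =>
      have : koszulSign 𝕂 f 1 = 1 := by
        rw [koszulSign]
        refine Finset.prod_eq_one fun i _ => Finset.prod_eq_one fun j _ => if_neg ?_
        rintro ⟨h1, h2⟩
        exact lt_asymm h1 h2
      simp [this]
    | mul σ τ _ _ hσ hτ =>
      have h1 := hσ f v hv
      have h2 := (koszulIdeal 𝒱).smul_mem (koszulSign 𝕂 f σ)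
        (hτ (f ∘ σ) (v ∘ σ) fun k => hv (σ k))
      rw [smul_sub, smul_smul, ← koszulSign_mul] at h2
      simpa [Function.comp_assoc] using add_mem h1 h2

/-- The average over all permutations of the differences in `monomial_sub_perm_mem`. With
`symmetrizer_eq_zero` it identifies the kernel of the symmetrizer with the ideal and makes the
symmetrizer a projection. -/
theorem sub_symmetrizer_mem (x : TensorAlg 𝕂 V) : x - symmetrizer 𝒱 x ∈ koszulIdeal 𝒱 := by
  change x ∈ (koszulIdeal 𝒱).comap (LinearMap.id - symmetrizer 𝒱)
  refine tensorAlg_eq_top 𝒱 (fun n f v hv => ?_) x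
  change monomial 𝕂 v - symmetrizer 𝒱 (monomial 𝕂 v) ∈ koszulIdeal 𝒱
  have : monomial 𝕂 v - symmetrizer 𝒱 (monomial 𝕂 v) = (n ! : 𝕂)⁻¹ •
      ∑ σ : Equiv.Perm (Fin n), (monomial 𝕂 v - koszulSign 𝕂 f σ • monomial 𝕂 (v ∘ σ)) := by
    rw [symmetrizer_monomial 𝒱 hv, Finset.sum_sub_distrib, smul_sub]
    congr 1
    rw [Finset.sum_const, Finset.card_univ, Fintype.card_perm, Fintype.card_fin,
      ← Nat.cast_smul_eq_nsmul 𝕂, smul_smul, inv_mul_cancel₀ (Nat.cast_ne_zero.2 n.factorial_ne_zero), one_smul]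
  rw [this]
  exact Submodule.smul_mem _ _ (sum_mem fun σ _ => monomial_sub_perm_mem 𝒱 σ f v hv)

theorem symmetrizer_symmetrizer (x : TensorAlg 𝕂 V) :
    symmetrizer 𝒱 (symmetrizer 𝒱 x) = symmetrizer 𝒱 x := by
  have := symmetrizer_eq_zero 𝒱 (sub_symmetrizer_mem 𝒱 x)
  rw [map_sub, sub_eq_zero] at this
  exact this.symm

theorem toSym_coe (a : symAlg 𝒱) : toSym 𝒱 a = a := by
  obtain ⟨_, x, rfl⟩ := a
  exact Subtype.ext (symmetrizer_symmetrizer 𝒱 x)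

theorem toSym_eq_zero {t : TensorAlg 𝕂 V} (ht : t ∈ koszulIdeal 𝒱) : toSym 𝒱 t = 0 :=
  Subtype.ext (symmetrizer_eq_zero 𝒱 ht)

theorem toSym_eq_of_sub_mem {x y : TensorAlg 𝕂 V} (h : x - y ∈ koszulIdeal 𝒱) :
    toSym 𝒱 x = toSym 𝒱 y := by
  have := symmetrizer_eq_zero 𝒱 h
  rw [map_sub, sub_eq_zero] at this
  exact Subtype.ext this

theorem sub_toSym_mem (x : TensorAlg 𝕂 V) : x - toSym 𝒱 x ∈ koszulIdeal 𝒱 :=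
  sub_symmetrizer_mem 𝒱 x

/-- Replacing both factors by their symmetrizations changes the product only by an element of the
two-sided ideal. -/
theorem symMul_toSym (x y : TensorAlg 𝕂 V) :
    symMul 𝒱 (toSym 𝒱 x ⊗ₜ[𝕂] toSym 𝒱 y) = toSym 𝒱 (x * y) := by
  change toSym 𝒱 ((toSym 𝒱 x : TensorAlg 𝕂 V) * toSym 𝒱 y) = toSym 𝒱 (x * y)
  refine (toSym_eq_of_sub_mem 𝒱 ?_).symm
  have : x * y - (toSym 𝒱 x : TensorAlg 𝕂 V) * toSym 𝒱 y =
      (x - toSym 𝒱 x) * y + (toSym 𝒱 x : TensorAlg 𝕂 V) * (y - toSym 𝒱 y) := by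
    rw [sub_mul, mul_sub]; abel
  rw [this]
  exact add_mem (koszulIdeal_mul_mem 𝒱 _ (sub_toSym_mem 𝒱 x))
    (mul_mem_koszulIdeal 𝒱 _ (sub_toSym_mem 𝒱 y))

theorem tensorSgn_mem_koszulIdeal (k : ZMod 2) {t : TensorAlg 𝕂 V} (ht : t ∈ koszulIdeal 𝒱) :
    tensorSgn 𝒱 k t ∈ koszulIdeal 𝒱 := by
  suffices h : koszulIdeal 𝒱 ≤ (koszulIdeal 𝒱).comap (tensorSgn 𝒱 k) from h ht
  refine koszulIdeal_le 𝒱 (fun i j v hv w hw y => ?_) fun l u hu t _ ht => ?_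
  · have : tensorSgn 𝒱 k (koszulBracket i j v w * y) =
        (paritySign 𝕂 (k * i) * paritySign 𝕂 (k * j)) •
          (koszulBracket i j v w * tensorSgn 𝒱 k y) := by
      simp only [koszulBracket, sub_mul, smul_mul_assoc, map_sub, map_smul, mul_assoc,
        tensorSgn_iota_mul 𝒱 k hv, tensorSgn_iota_mul 𝒱 k hw, mul_smul_comm, smul_sub, smul_smul]
      ring_nf
    rw [Submodule.mem_comap, this]
    exact Submodule.smul_mem _ _ (koszulBracket_mul_mem hv hw _)
  · rw [Submodule.mem_comap, tensorSgn_iota_mul 𝒱 k hu]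
    exact Submodule.smul_mem _ _ (mul_mem_koszulIdeal 𝒱 _ ht)

variable {Λ : V →ₗ[𝕂] V →ₗ[𝕂] 𝕂} (hΛ : IsEvenForm 𝒱 Λ)
include hΛ

/-- On a graded commutator of v and w the terms with Λ(u, v) and Λ(u, w) cancel, so ι_u passes
through it up to a sign. -/
theorem insertion_mem_koszulIdeal {k : ZMod 2} {u : V} (hu : u ∈ 𝒱 k) {t : TensorAlg 𝕂 V}
    (ht : t ∈ koszulIdeal 𝒱) : insertion 𝒱 Λ u t ∈ koszulIdeal 𝒱 := by
  suffices h : koszulIdeal 𝒱 ≤ (koszulIdeal 𝒱).comap (insertion 𝒱 Λ u) from h ht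
  refine koszulIdeal_le 𝒱 (fun i j v hv w hw y => ?_) fun l u' hu' t ht' ht => ?_
  · have h1 : paritySign 𝕂 (i * k) * Λ u w = paritySign 𝕂 (i * j) * Λ u w := by
      by_cases h : k = j
      · rw [h]
      · rw [hΛ k j h u hu w hw, mul_zero, mul_zero]
    have h2 : paritySign 𝕂 (i * j) * (paritySign 𝕂 (j * k) * Λ u v) = Λ u v := by
      by_cases h : k = i
      · rw [h, mul_comm j i, ← mul_assoc, paritySign_mul_self, one_mul]
      · rw [hΛ k i h u hu v hv, mul_zero, mul_zero]
    have : insertion 𝒱 Λ u (koszulBracket i j v w * y) =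
        (paritySign 𝕂 (i * k) * paritySign 𝕂 (j * k)) •
          (koszulBracket i j v w * insertion 𝒱 Λ u y) := by
      simp only [koszulBracket, sub_mul, smul_mul_assoc, map_sub, map_smul, mul_assoc,
        insertion_iota_mul 𝒱 hΛ hu hv, insertion_iota_mul 𝒱 hΛ hu hw, mul_smul_comm, smul_sub,
        smul_smul, smul_add, mul_add, h1, h2]
      rw [show paritySign 𝕂 (i * j) * (paritySign 𝕂 (j * k) * paritySign 𝕂 (i * k)) =
        paritySign 𝕂 (i * k) * (paritySign 𝕂 (j * k) * paritySign 𝕂 (i * j)) by ring]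
      abel
    rw [Submodule.mem_comap, this]
    exact Submodule.smul_mem _ _ (koszulBracket_mul_mem hv hw _)
  · rw [Submodule.mem_comap, insertion_iota_mul 𝒱 hΛ hu hu']
    exact add_mem (Submodule.smul_mem _ _ ht')
      (Submodule.smul_mem _ _ (mul_mem_koszulIdeal 𝒱 _ ht))

omit hΛ in
/-- Multiplication from the left descends to the symmetric algebra. -/
theorem map_toSym_rTensor_mulLeft (x : TensorAlg 𝕂 V) (t : TensorAlg 𝕂 V ⊗[𝕂] TensorAlg 𝕂 V) :
    TensorProduct.map (toSym 𝒱) (toSym 𝒱) ((LinearMap.mulLeft 𝕂 x).rTensor _ t) =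
      (toSym 𝒱 ∘ₗ LinearMap.mulLeft 𝕂 x ∘ₗ (symAlg 𝒱).subtype).rTensor _
        (TensorProduct.map (toSym 𝒱) (toSym 𝒱) t) := by
  induction t with
  | zero => simp
  | add s t hs ht => simp only [map_add, hs, ht]
  | tmul a b =>
    simp only [LinearMap.rTensor_tmul, TensorProduct.map_tmul, LinearMap.mulLeft_apply,
      LinearMap.comp_apply, Submodule.subtype_apply]
    congr 1
    refine toSym_eq_of_sub_mem 𝒱 ?_
    rw [← mul_sub]
    exact mul_mem_koszulIdeal 𝒱 _ (sub_toSym_mem 𝒱 a)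

/-- Induction on x: the commutator with left multiplication inserts u into t, and insertions
preserve the ideal. -/
theorem map_toSym_tensorContraction_right (x : TensorAlg 𝕂 V) {t : TensorAlg 𝕂 V}
    (ht : t ∈ koszulIdeal 𝒱) :
    TensorProduct.map (toSym 𝒱) (toSym 𝒱) (tensorContraction 𝒱 Λ (x ⊗ₜ[𝕂] t)) = 0 := by
  let A : TensorAlg 𝕂 V →ₗ[𝕂] symAlg 𝒱 ⊗[𝕂] symAlg 𝒱 :=
    TensorProduct.map (toSym 𝒱) (toSym 𝒱) ∘ₗ tensorContraction 𝒱 Λ ∘ₗ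
      (TensorProduct.mk 𝕂 _ _).flip t
  refine linearMap_ext_induction 𝒱 (A := A) (B := 0) ?_ (fun i u hu x hx => ?_) x
  · simp [A, tensorContraction_one]
  · simp only [A, LinearMap.comp_apply, LinearMap.flip_apply, TensorProduct.mk_apply,
      LinearMap.zero_apply] at hx ⊢
    rw [tensorContraction_iota_mul 𝒱 Λ hu, map_add, map_toSym_rTensor_mulLeft, hx, map_zero,
      TensorProduct.map_tmul, toSym_eq_zero 𝒱 (insertion_mem_koszulIdeal 𝒱 hΛ hu ht),
      TensorProduct.tmul_zero, add_zero]

omit hΛ in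
theorem map_toSym_tensorContraction_left (y : TensorAlg 𝕂 V) {t : TensorAlg 𝕂 V}
    (ht : t ∈ koszulIdeal 𝒱) :
    TensorProduct.map (toSym 𝒱) (toSym 𝒱) (tensorContraction 𝒱 Λ (t ⊗ₜ[𝕂] y)) = 0 := by
  let A : TensorAlg 𝕂 V →ₗ[𝕂] symAlg 𝒱 ⊗[𝕂] symAlg 𝒱 :=
    TensorProduct.map (toSym 𝒱) (toSym 𝒱) ∘ₗ tensorContraction 𝒱 Λ ∘ₗ
      (TensorProduct.mk 𝕂 _ _).flip y
  suffices h : koszulIdeal 𝒱 ≤ LinearMap.ker A from h ht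
  refine koszulIdeal_le 𝒱 (fun i j v hv w hw x => ?_) fun l u hu t ht' ht => ?_
  · simp only [A, LinearMap.mem_ker, LinearMap.comp_apply, LinearMap.flip_apply,
      TensorProduct.mk_apply]
    -- The insertion terms of v and of w each occur twice, with opposite signs, so the contraction
    -- commutes with multiplication by a graded commutator.
    have : tensorContraction 𝒱 Λ ((koszulBracket i j v w * x) ⊗ₜ[𝕂] y) =
        (LinearMap.mulLeft 𝕂 (koszulBracket i j v w)).rTensor _
          (tensorContraction 𝒱 Λ (x ⊗ₜ[𝕂] y)) := by
      simp only [koszulBracket, sub_mul, smul_mul_assoc, mul_assoc, TensorProduct.sub_tmul,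
        ← TensorProduct.smul_tmul', map_sub, map_smul, tensorContraction_iota_mul 𝒱 Λ hv,
        tensorContraction_iota_mul 𝒱 Λ hw, map_add, LinearMap.rTensor_tmul,
        LinearMap.mulLeft_apply, tensorSgn_iota_mul 𝒱 i hw, tensorSgn_iota_mul 𝒱 j hv,
        smul_add, smul_smul]
      rw [mul_comm j i, paritySign_mul_self, one_smul]
      generalize tensorContraction 𝒱 Λ (x ⊗ₜ[𝕂] y) = s
      have hs : (LinearMap.mulLeft 𝕂 (iota 𝕂 V v * iota 𝕂 V w -
          paritySign 𝕂 (i * j) • (iota 𝕂 V w * iota 𝕂 V v))).rTensor (TensorAlg 𝕂 V) s =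
          (LinearMap.mulLeft 𝕂 (iota 𝕂 V v)).rTensor _
            ((LinearMap.mulLeft 𝕂 (iota 𝕂 V w)).rTensor _ s) -
          paritySign 𝕂 (i * j) • (LinearMap.mulLeft 𝕂 (iota 𝕂 V w)).rTensor _
            ((LinearMap.mulLeft 𝕂 (iota 𝕂 V v)).rTensor _ s) := by
        induction s with
        | zero => simp
        | add s t hs ht => simp only [map_add, hs, ht, smul_add]; abel
        | tmul a b =>
          simp [sub_mul, TensorProduct.sub_tmul, TensorProduct.smul_tmul', mul_assoc]
      rw [hs]
      abel
    rw [this, map_toSym_rTensor_mulLeft]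
    generalize TensorProduct.map (toSym 𝒱) (toSym 𝒱) _ = s
    induction s with
    | zero => simp
    | add s t hs ht => rw [map_add, hs, ht, add_zero]
    | tmul a b =>
      simp [toSym_eq_zero 𝒱 (koszulBracket_mul_mem hv hw (a : TensorAlg 𝕂 V))]
  · simp only [A, LinearMap.mem_ker, LinearMap.comp_apply, LinearMap.flip_apply,
      TensorProduct.mk_apply] at ht ⊢
    rw [tensorContraction_iota_mul 𝒱 Λ hu, map_add, map_toSym_rTensor_mulLeft, ht, map_zero,
      TensorProduct.map_tmul, toSym_eq_zero 𝒱 (tensorSgn_mem_koszulIdeal 𝒱 _ ht'),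
      TensorProduct.zero_tmul, add_zero]

/-- By the two vanishing statements for the ideal, the symmetrization built into `contraction` is
harmless. Powers of P_Λ can therefore be computed with unsymmetrized tensors and symmetrized once at
the end. -/
theorem contraction_map_toSym (t : TensorAlg 𝕂 V ⊗[𝕂] TensorAlg 𝕂 V) :
    contraction 𝒱 Λ (TensorProduct.map (toSym 𝒱) (toSym 𝒱) t) =
      TensorProduct.map (toSym 𝒱) (toSym 𝒱) (tensorContraction 𝒱 Λ t) := by
  induction t with
  | zero => simp
  | add s t hs ht => simp only [map_add, hs, ht]
  | tmul x y =>
    simp only [contraction, LinearMap.comp_apply, TensorProduct.map_tmul, Submodule.subtype_apply]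
    have : x ⊗ₜ[𝕂] y = (toSym 𝒱 x : TensorAlg 𝕂 V) ⊗ₜ[𝕂] (toSym 𝒱 y : TensorAlg 𝕂 V) +
        ((x - toSym 𝒱 x) ⊗ₜ[𝕂] y + (toSym 𝒱 x : TensorAlg 𝕂 V) ⊗ₜ[𝕂] (y - toSym 𝒱 y)) := by
      rw [TensorProduct.sub_tmul, TensorProduct.tmul_sub]; abel
    rw [this, map_add, map_add, map_add, map_add,
      map_toSym_tensorContraction_left 𝒱 y (sub_toSym_mem 𝒱 x),
      map_toSym_tensorContraction_right 𝒱 hΛ _ (sub_toSym_mem 𝒱 y), add_zero, add_zero]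

theorem contraction_pow_map_toSym (k : ℕ) (t : TensorAlg 𝕂 V ⊗[𝕂] TensorAlg 𝕂 V) :
    (contraction 𝒱 Λ ^ k) (TensorProduct.map (toSym 𝒱) (toSym 𝒱) t) =
      TensorProduct.map (toSym 𝒱) (toSym 𝒱) (((tensorContraction 𝒱 Λ : Module.End 𝕂 _) ^ k) t) := by
  induction k with
  | zero => simp
  | succ k ih => rw [pow_succ', pow_succ', Module.End.mul_apply, Module.End.mul_apply, ih,
      contraction_map_toSym 𝒱 hΛ]

end Symmetrization

end GradedWeyl

end

noncomputable section

namespace GradedWeyl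

/-! ### The star product on the tensor algebra and its associativity -/

section TensorStar

variable {𝕂 : Type*} [RCLike 𝕂] {V : Type*} [AddCommGroup V] [Module 𝕂 V]
variable (𝒱 : ZMod 2 → Submodule 𝕂 V) [DirectSum.Decomposition 𝒱]

theorem tensorSgn_comm (i j : ZMod 2) (x : TensorAlg 𝕂 V) :
    tensorSgn 𝒱 i (tensorSgn 𝒱 j x) = tensorSgn 𝒱 j (tensorSgn 𝒱 i x) := by
  refine linearMap_ext_induction 𝒱 (A := tensorSgn 𝒱 i ∘ₗ tensorSgn 𝒱 j)
    (B := tensorSgn 𝒱 j ∘ₗ tensorSgn 𝒱 i) ?_ (fun k v hv x hx => ?_) x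
  · simp [tensorSgn_one]
  · simp only [LinearMap.comp_apply] at hx ⊢
    simp only [tensorSgn_iota_mul 𝒱 _ hv, map_smul, hx, smul_smul, mul_comm]

theorem tensorContraction_one_right (Λ : V →ₗ[𝕂] V →ₗ[𝕂] 𝕂) (x : TensorAlg 𝕂 V) :
    tensorContraction 𝒱 Λ (x ⊗ₜ[𝕂] 1) = 0 := by
  simp [tensorContraction_tmul, pullLeft_one]

theorem insertion_monomial (Λ : V →ₗ[𝕂] V →ₗ[𝕂] 𝕂) (u : V) {n : ℕ}
    {f : Fin (n + 1) → ZMod 2} {v : Fin (n + 1) → V} (hv : ∀ i, v i ∈ 𝒱 (f i)) :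
    insertion 𝒱 Λ u (monomial 𝕂 v) = ∑ k, (paritySign 𝕂 (f k * ∑ j ∈ Finset.Iio k, f j) *
      Λ u (v k)) • monomial 𝕂 (k.removeNth v) := by
  simp [insertion, pullLeft_monomial 𝒱 hv, smul_smul]

section Even

variable {Λ : V →ₗ[𝕂] V →ₗ[𝕂] 𝕂} (hΛ : IsEvenForm 𝒱 Λ)
include hΛ

omit [DirectSum.Decomposition 𝒱] in
theorem IsEvenForm.sign_mul {i j : ZMod 2} {u w : V} (hu : u ∈ 𝒱 i) (hw : w ∈ 𝒱 j) (k : ZMod 2) :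
    paritySign 𝕂 (k * i) * paritySign 𝕂 (k * j) * Λ u w = Λ u w := by
  by_cases h : i = j
  · rw [h, paritySign_mul_self, one_mul]
  · rw [hΛ i j h u hu w hw, mul_zero]

theorem tensorSgn_insertion (k : ZMod 2) {i : ZMod 2} {u : V} (hu : u ∈ 𝒱 i)
    (x : TensorAlg 𝕂 V) :
    tensorSgn 𝒱 k (insertion 𝒱 Λ u x) =
      paritySign 𝕂 (k * i) • insertion 𝒱 Λ u (tensorSgn 𝒱 k x) := by
  refine linearMap_ext_induction 𝒱 (A := tensorSgn 𝒱 k ∘ₗ insertion 𝒱 Λ u)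
    (B := paritySign 𝕂 (k * i) • (insertion 𝒱 Λ u ∘ₗ tensorSgn 𝒱 k)) ?_
    (fun j w hw x hx => ?_) x
  · simp [tensorSgn_one, insertion_one]
  · simp only [LinearMap.comp_apply, LinearMap.smul_apply] at hx ⊢
    simp only [insertion_iota_mul 𝒱 hΛ hu hw, map_add, map_smul, tensorSgn_iota_mul 𝒱 k hw, hx,
      smul_add, smul_smul, mul_smul_comm]
    rw [← mul_assoc (paritySign 𝕂 (k * i)) _ (Λ u w), hΛ.sign_mul 𝒱 hu hw]
    ring_nf

/-- Insertions graded-commute because, after moving both past a vector, the terms with a single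
value of Λ match by evenness. -/
theorem insertion_insertion {i j : ZMod 2} {u v : V} (hu : u ∈ 𝒱 i) (hv : v ∈ 𝒱 j)
    (x : TensorAlg 𝕂 V) :
    insertion 𝒱 Λ u (insertion 𝒱 Λ v x) =
      paritySign 𝕂 (i * j) • insertion 𝒱 Λ v (insertion 𝒱 Λ u x) := by
  refine linearMap_ext_induction 𝒱 (A := insertion 𝒱 Λ u ∘ₗ insertion 𝒱 Λ v)
    (B := paritySign 𝕂 (i * j) • (insertion 𝒱 Λ v ∘ₗ insertion 𝒱 Λ u)) ?_
    (fun k w hw x hx => ?_) x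
  · simp [insertion_one]
  · simp only [LinearMap.comp_apply, LinearMap.smul_apply] at hx ⊢
    simp only [insertion_iota_mul 𝒱 hΛ hu hw, insertion_iota_mul 𝒱 hΛ hv hw, map_add, map_smul,
      hx, smul_add, smul_smul, mul_smul_comm]
    have h1 := hΛ.sign_mul 𝒱 hv hw i
    have h2 : paritySign 𝕂 (k * j) * Λ u w = paritySign 𝕂 (i * j) * Λ u w := by
      by_cases h : i = k
      · rw [h]
      · rw [hΛ i k h u hu w hw, mul_zero, mul_zero]
    rw [h2, mul_comm k i, ← mul_assoc (paritySign 𝕂 (i * j)) (paritySign 𝕂 (i * k)) (Λ v w), h1]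
    rw [show paritySign 𝕂 (k * j) * (paritySign 𝕂 (i * k) * paritySign 𝕂 (i * j)) =
      paritySign 𝕂 (i * j) * (paritySign 𝕂 (i * k) * paritySign 𝕂 (k * j)) by ring]
    abel

theorem insertion_mul {i : ZMod 2} {u : V} (hu : u ∈ 𝒱 i) (x y : TensorAlg 𝕂 V) :
    insertion 𝒱 Λ u (x * y) = insertion 𝒱 Λ u x * y + tensorSgn 𝒱 i x * insertion 𝒱 Λ u y := by
  refine linearMap_ext_induction 𝒱 (A := insertion 𝒱 Λ u ∘ₗ LinearMap.mulRight 𝕂 y)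
    (B := LinearMap.mulRight 𝕂 y ∘ₗ insertion 𝒱 Λ u +
      LinearMap.mulRight 𝕂 (insertion 𝒱 Λ u y) ∘ₗ tensorSgn 𝒱 i) ?_ (fun k w hw x hx => ?_) x
  · simp [insertion_one, tensorSgn_one]
  · simp only [LinearMap.comp_apply, LinearMap.add_apply, LinearMap.mulRight_apply] at hx ⊢
    rw [mul_assoc, insertion_iota_mul 𝒱 hΛ hu hw, insertion_iota_mul 𝒱 hΛ hu hw, hx,
      tensorSgn_iota_mul 𝒱 i hw, mul_comm k i]
    simp only [mul_add, add_mul, smul_add, smul_mul_assoc, mul_assoc, add_assoc]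

omit hΛ in
variable (Λ) in
/-- The operator `x ⊗ y ↦ (-1) ^ (i |x|) x ⊗ ι_u y`. -/
def insertRight (i : ZMod 2) (u : V) : Module.End 𝕂 (TensorAlg 𝕂 V ⊗[𝕂] TensorAlg 𝕂 V) :=
  TensorProduct.map (tensorSgn 𝒱 i) (insertion 𝒱 Λ u)

omit hΛ in
variable (Λ) in
/-- The operator `x ⊗ y ↦ ι_u x ⊗ y`. -/
def insertLeft (u : V) : Module.End 𝕂 (TensorAlg 𝕂 V ⊗[𝕂] TensorAlg 𝕂 V) :=
  (insertion 𝒱 Λ u).rTensor _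

omit hΛ in
variable (𝕂 V) in
/-- The operator `x ⊗ y ↦ (u ⊗ x) ⊗ y`. -/
def mulFirst (u : V) : Module.End 𝕂 (TensorAlg 𝕂 V ⊗[𝕂] TensorAlg 𝕂 V) :=
  (LinearMap.mulLeft 𝕂 (iota 𝕂 V u)).rTensor _

omit hΛ in
variable (Λ) in
/-- The operator `tensorContraction`, as an element of the endomorphism ring. -/
def contractionEnd : Module.End 𝕂 (TensorAlg 𝕂 V ⊗[𝕂] TensorAlg 𝕂 V) := tensorContraction 𝒱 Λ

omit hΛ in
theorem contractionEnd_mulFirst {i : ZMod 2} {u : V} (hu : u ∈ 𝒱 i)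
    (t : TensorAlg 𝕂 V ⊗[𝕂] TensorAlg 𝕂 V) :
    contractionEnd 𝒱 Λ (mulFirst 𝕂 V u t) =
      mulFirst 𝕂 V u (contractionEnd 𝒱 Λ t) + insertRight 𝒱 Λ i u t := by
  induction t with
  | zero => simp
  | add s t hs ht => simp only [map_add, hs, ht]; abel
  | tmul x y => exact tensorContraction_iota_mul 𝒱 Λ hu x y

omit hΛ in
theorem insertRight_mulFirst {i j : ZMod 2} (v : V) {u : V} (hu : u ∈ 𝒱 j)
    (t : TensorAlg 𝕂 V ⊗[𝕂] TensorAlg 𝕂 V) :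
    insertRight 𝒱 Λ i v (mulFirst 𝕂 V u t) =
      paritySign 𝕂 (i * j) • mulFirst 𝕂 V u (insertRight 𝒱 Λ i v t) := by
  induction t with
  | zero => simp
  | add s t hs ht => simp only [map_add, hs, ht, smul_add]
  | tmul x y => simp [insertRight, mulFirst, tensorSgn_iota_mul 𝒱 i hu, TensorProduct.smul_tmul']

theorem insertLeft_mulFirst {i j : ZMod 2} {u v : V} (hv : v ∈ 𝒱 i) (hu : u ∈ 𝒱 j)
    (t : TensorAlg 𝕂 V ⊗[𝕂] TensorAlg 𝕂 V) :
    insertLeft 𝒱 Λ v (mulFirst 𝕂 V u t) =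
      Λ v u • t + paritySign 𝕂 (j * i) • mulFirst 𝕂 V u (insertLeft 𝒱 Λ v t) := by
  induction t with
  | zero => simp
  | add s t hs ht => simp only [map_add, hs, ht, smul_add]; abel
  | tmul x y =>
    simp [insertLeft, mulFirst, insertion_iota_mul 𝒱 hΛ hv hu, TensorProduct.smul_tmul',
      TensorProduct.add_tmul]

/-- Induction on x: commuting past u produces another right insertion, and right insertions
graded-commute among themselves with the sign already produced by moving past u. -/
theorem contractionEnd_insertRight {i : ZMod 2} {v : V} (hv : v ∈ 𝒱 i)
    (t : TensorAlg 𝕂 V ⊗[𝕂] TensorAlg 𝕂 V) :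
    contractionEnd 𝒱 Λ (insertRight 𝒱 Λ i v t) = insertRight 𝒱 Λ i v (contractionEnd 𝒱 Λ t) := by
  induction t with
  | zero => simp
  | add s t hs ht => simp only [map_add, hs, ht]
  | tmul x y =>
    refine linearMap_ext_induction 𝒱
      (A := contractionEnd 𝒱 Λ ∘ₗ insertRight 𝒱 Λ i v ∘ₗ (TensorProduct.mk 𝕂 _ _).flip y)
      (B := insertRight 𝒱 Λ i v ∘ₗ contractionEnd 𝒱 Λ ∘ₗ (TensorProduct.mk 𝕂 _ _).flip y) ?_
      (fun j u hu x hx => ?_) x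
    · simp [insertRight, contractionEnd, tensorSgn_one, tensorContraction_one]
    · simp only [LinearMap.comp_apply, LinearMap.flip_apply, TensorProduct.mk_apply] at hx ⊢
      have h : (iota 𝕂 V u * x) ⊗ₜ[𝕂] y = mulFirst 𝕂 V u (x ⊗ₜ[𝕂] y) := rfl
      have h' : insertRight 𝒱 Λ i v (insertRight 𝒱 Λ j u (x ⊗ₜ[𝕂] y)) =
          paritySign 𝕂 (i * j) • insertRight 𝒱 Λ j u (insertRight 𝒱 Λ i v (x ⊗ₜ[𝕂] y)) := by
        simp only [insertRight, TensorProduct.map_tmul, tensorSgn_comm 𝒱 i j,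
          insertion_insertion 𝒱 hΛ hv hu y, TensorProduct.tmul_smul]
      rw [h, insertRight_mulFirst 𝒱 v hu, map_smul, contractionEnd_mulFirst 𝒱 hu,
        contractionEnd_mulFirst 𝒱 hu, map_add, insertRight_mulFirst 𝒱 v hu, hx, h', smul_add]

/-- Same induction as for right insertions. The term Λ(v, u) is a scalar, and the left and right
insertions commute up to the parity sign. -/
theorem contractionEnd_insertLeft {i : ZMod 2} {v : V} (hv : v ∈ 𝒱 i)
    (t : TensorAlg 𝕂 V ⊗[𝕂] TensorAlg 𝕂 V) :
    contractionEnd 𝒱 Λ (insertLeft 𝒱 Λ v t) = insertLeft 𝒱 Λ v (contractionEnd 𝒱 Λ t) := by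
  induction t with
  | zero => simp
  | add s t hs ht => simp only [map_add, hs, ht]
  | tmul x y =>
    refine linearMap_ext_induction 𝒱
      (A := contractionEnd 𝒱 Λ ∘ₗ insertLeft 𝒱 Λ v ∘ₗ (TensorProduct.mk 𝕂 _ _).flip y)
      (B := insertLeft 𝒱 Λ v ∘ₗ contractionEnd 𝒱 Λ ∘ₗ (TensorProduct.mk 𝕂 _ _).flip y) ?_
      (fun j u hu x hx => ?_) x
    · simp [insertLeft, contractionEnd, insertion_one, tensorContraction_one]
    · simp only [LinearMap.comp_apply, LinearMap.flip_apply, TensorProduct.mk_apply] at hx ⊢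
      have h : (iota 𝕂 V u * x) ⊗ₜ[𝕂] y = mulFirst 𝕂 V u (x ⊗ₜ[𝕂] y) := rfl
      have h' : paritySign 𝕂 (j * i) • insertRight 𝒱 Λ j u (insertLeft 𝒱 Λ v (x ⊗ₜ[𝕂] y)) =
          insertLeft 𝒱 Λ v (insertRight 𝒱 Λ j u (x ⊗ₜ[𝕂] y)) := by
        simp only [insertRight, insertLeft, LinearMap.rTensor_tmul, TensorProduct.map_tmul,
          tensorSgn_insertion 𝒱 hΛ j hv, TensorProduct.smul_tmul', smul_smul,
          paritySign_mul_self, one_smul]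
      rw [h, insertLeft_mulFirst 𝒱 hΛ hv hu, map_add, map_smul, map_smul,
        contractionEnd_mulFirst 𝒱 hu, contractionEnd_mulFirst 𝒱 hu, map_add,
        insertLeft_mulFirst 𝒱 hΛ hv hu, hx, ← h', smul_add, add_assoc]

theorem contractionEnd_pow_insertLeft {i : ZMod 2} {v : V} (hv : v ∈ 𝒱 i) (k : ℕ)
    (t : TensorAlg 𝕂 V ⊗[𝕂] TensorAlg 𝕂 V) :
    (contractionEnd 𝒱 Λ ^ k) (insertLeft 𝒱 Λ v t) =
      insertLeft 𝒱 Λ v ((contractionEnd 𝒱 Λ ^ k) t) := by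
  have h : Commute (contractionEnd 𝒱 Λ) (insertLeft 𝒱 Λ v) :=
    LinearMap.ext (contractionEnd_insertLeft 𝒱 hΛ hv)
  exact LinearMap.congr_fun (h.pow_left k).eq t

/-- The commutator of C with left multiplication by u commutes with C, so commuting with a power
acts like differentiating it. -/
theorem contractionEnd_pow_mulFirst {i : ZMod 2} {u : V} (hu : u ∈ 𝒱 i) (k : ℕ)
    (t : TensorAlg 𝕂 V ⊗[𝕂] TensorAlg 𝕂 V) :
    (contractionEnd 𝒱 Λ ^ (k + 1)) (mulFirst 𝕂 V u t) =
      mulFirst 𝕂 V u ((contractionEnd 𝒱 Λ ^ (k + 1)) t) +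
        (k + 1 : 𝕂) • insertRight 𝒱 Λ i u ((contractionEnd 𝒱 Λ ^ k) t) := by
  induction k with
  | zero => simp [contractionEnd_mulFirst 𝒱 hu]
  | succ k ih =>
    rw [pow_succ', Module.End.mul_apply, ih, map_add, contractionEnd_mulFirst 𝒱 hu, map_smul,
      contractionEnd_insertRight 𝒱 hΛ hu, ← Module.End.mul_apply (contractionEnd 𝒱 Λ), ← pow_succ',
      ← Module.End.mul_apply (contractionEnd 𝒱 Λ), ← pow_succ', add_assoc]
    congr 1
    push_cast
    module

/-- Each further left factor raises the order of nilpotency by at most one, starting from order one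
for 1 ⊗ y. -/
theorem exists_contractionEnd_pow_eq_zero (t : TensorAlg 𝕂 V ⊗[𝕂] TensorAlg 𝕂 V) :
    ∃ N, ∀ k ≥ N, (contractionEnd 𝒱 Λ ^ k) t = 0 := by
  induction t with
  | zero => exact ⟨0, fun k _ => map_zero _⟩
  | add s t hs ht =>
    obtain ⟨N, hN⟩ := hs
    obtain ⟨M, hM⟩ := ht
    exact ⟨max N M, fun k hk => by
      rw [map_add, hN k (le_of_max_le_left hk), hM k (le_of_max_le_right hk), add_zero]⟩
  | tmul x y =>
    let S : Submodule 𝕂 (TensorAlg 𝕂 V) :=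
      { carrier := {x | ∃ N, ∀ k ≥ N, (contractionEnd 𝒱 Λ ^ k) (x ⊗ₜ[𝕂] y) = 0}
        zero_mem' := ⟨0, fun k _ => by rw [TensorProduct.zero_tmul, map_zero]⟩
        add_mem' := by
          rintro a b ⟨N, hN⟩ ⟨M, hM⟩
          exact ⟨max N M, fun k hk => by
            rw [TensorProduct.add_tmul, map_add, hN k (le_of_max_le_left hk),
              hM k (le_of_max_le_right hk), add_zero]⟩
        smul_mem' := by
          rintro c a ⟨N, hN⟩
          exact ⟨N, fun k hk => by
            rw [← TensorProduct.smul_tmul', map_smul, hN k hk, smul_zero]⟩ }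
    refine tensorAlg_induction 𝒱 (S := S) ⟨1, fun k hk => ?_⟩ (fun i u hu x hx => ?_) x
    · obtain ⟨k, rfl⟩ := Nat.exists_eq_add_of_le' hk
      rw [pow_succ, Module.End.mul_apply, contractionEnd, tensorContraction_one, map_zero]
    · obtain ⟨N, hN⟩ := hx
      refine ⟨N + 1, fun k hk => ?_⟩
      obtain ⟨k, rfl⟩ := Nat.exists_eq_add_of_le' (Nat.le_of_add_left_le hk)
      have h : (iota 𝕂 V u * x) ⊗ₜ[𝕂] y = mulFirst 𝕂 V u (x ⊗ₜ[𝕂] y) := rfl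
      rw [h, contractionEnd_pow_mulFirst 𝒱 hΛ hu, hN _ (by omega), hN _ (by omega), map_zero,
        map_zero, smul_zero, add_zero]

omit hΛ in
variable (Λ) in
/-- The operator `exp(z C)` for the locally nilpotent operator `C = contractionEnd`. -/
def expContraction (z : 𝕂) (t : TensorAlg 𝕂 V ⊗[𝕂] TensorAlg 𝕂 V) :
    TensorAlg 𝕂 V ⊗[𝕂] TensorAlg 𝕂 V :=
  ∑ᶠ k : ℕ, (z ^ k / (k ! : 𝕂)) • (contractionEnd 𝒱 Λ ^ k) t

omit hΛ in
theorem expContraction_eq_sum (z : 𝕂) {t : TensorAlg 𝕂 V ⊗[𝕂] TensorAlg 𝕂 V} {N : ℕ}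
    (hN : ∀ k ≥ N, (contractionEnd 𝒱 Λ ^ k) t = 0) :
    expContraction 𝒱 Λ z t =
      ∑ k ∈ Finset.range N, (z ^ k / (k ! : 𝕂)) • (contractionEnd 𝒱 Λ ^ k) t := by
  refine finsum_eq_sum_of_support_subset _ fun k hk => ?_
  by_contra h
  refine hk ?_
  rw [Finset.coe_range, Set.mem_Iio, not_lt] at h
  simp only [hN k h, smul_zero]

theorem expContraction_add (z : 𝕂) (s t : TensorAlg 𝕂 V ⊗[𝕂] TensorAlg 𝕂 V) :
    expContraction 𝒱 Λ z (s + t) = expContraction 𝒱 Λ z s + expContraction 𝒱 Λ z t := by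
  obtain ⟨N, hN⟩ := exists_contractionEnd_pow_eq_zero 𝒱 hΛ s
  obtain ⟨M, hM⟩ := exists_contractionEnd_pow_eq_zero 𝒱 hΛ t
  have hN' : ∀ k ≥ max N M, (contractionEnd 𝒱 Λ ^ k) s = 0 := fun k hk =>
    hN k (le_of_max_le_left hk)
  have hM' : ∀ k ≥ max N M, (contractionEnd 𝒱 Λ ^ k) t = 0 := fun k hk =>
    hM k (le_of_max_le_right hk)
  rw [expContraction_eq_sum 𝒱 z hN', expContraction_eq_sum 𝒱 z hM',
    expContraction_eq_sum 𝒱 z (N := max N M)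
      (fun k hk => by rw [map_add, hN' k hk, hM' k hk, add_zero]), ← Finset.sum_add_distrib]
  simp only [map_add, smul_add]

theorem expContraction_smul (z c : 𝕂) (t : TensorAlg 𝕂 V ⊗[𝕂] TensorAlg 𝕂 V) :
    expContraction 𝒱 Λ z (c • t) = c • expContraction 𝒱 Λ z t := by
  obtain ⟨N, hN⟩ := exists_contractionEnd_pow_eq_zero 𝒱 hΛ t
  rw [expContraction_eq_sum 𝒱 z hN,
    expContraction_eq_sum 𝒱 z (N := N) (fun k hk => by rw [map_smul, hN k hk, smul_zero]),
    Finset.smul_sum]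
  simp only [map_smul, smul_comm c]

theorem expContraction_insertLeft (z : 𝕂) {i : ZMod 2} {v : V} (hv : v ∈ 𝒱 i)
    (t : TensorAlg 𝕂 V ⊗[𝕂] TensorAlg 𝕂 V) :
    expContraction 𝒱 Λ z (insertLeft 𝒱 Λ v t) = insertLeft 𝒱 Λ v (expContraction 𝒱 Λ z t) := by
  obtain ⟨N, hN⟩ := exists_contractionEnd_pow_eq_zero 𝒱 hΛ t
  rw [expContraction_eq_sum 𝒱 z hN, expContraction_eq_sum 𝒱 z (N := N) (fun k hk => by
    rw [contractionEnd_pow_insertLeft 𝒱 hΛ hv, hN k hk, map_zero]), map_sum]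
  simp only [map_smul, contractionEnd_pow_insertLeft 𝒱 hΛ hv]

/-- `contractionEnd_pow_mulFirst` summed over all powers: (k + 1)/(k + 1)! = 1/k! turns the
commutator terms into z times the exponential again. -/
theorem expContraction_mulFirst (z : 𝕂) {i : ZMod 2} {u : V} (hu : u ∈ 𝒱 i)
    (t : TensorAlg 𝕂 V ⊗[𝕂] TensorAlg 𝕂 V) :
    expContraction 𝒱 Λ z (mulFirst 𝕂 V u t) =
      mulFirst 𝕂 V u (expContraction 𝒱 Λ z t) +
        z • insertRight 𝒱 Λ i u (expContraction 𝒱 Λ z t) := by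
  obtain ⟨N, hN⟩ := exists_contractionEnd_pow_eq_zero 𝒱 hΛ t
  have h1 : expContraction 𝒱 Λ z (mulFirst 𝕂 V u t) = ∑ k ∈ Finset.range (N + 1),
      (z ^ k / (k ! : 𝕂)) • (contractionEnd 𝒱 Λ ^ k) (mulFirst 𝕂 V u t) := by
    refine expContraction_eq_sum 𝒱 z fun k hk => ?_
    obtain ⟨k, rfl⟩ := Nat.exists_eq_add_of_le' (Nat.le_of_add_left_le hk)
    rw [contractionEnd_pow_mulFirst 𝒱 hΛ hu, hN _ (by omega), hN _ (by omega), map_zero,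
      map_zero, smul_zero, add_zero]
  -- One summand more than necessary, so that splitting off the term of index 0 leaves sums over the
  -- same range as the commutator terms.
  have h2 := expContraction_eq_sum 𝒱 (Λ := Λ) z (N := N + 1) fun k hk => hN k (by omega)
  rw [h1]
  conv_rhs => enter [1]; rw [h2]
  rw [expContraction_eq_sum 𝒱 z hN, map_sum, map_sum, Finset.sum_range_succ',
    Finset.sum_range_succ' (n := N), Finset.smul_sum, add_right_comm, ← Finset.sum_add_distrib]
  congr 1
  · refine Finset.sum_congr rfl fun k _ => ?_
    rw [contractionEnd_pow_mulFirst 𝒱 hΛ hu, smul_add, map_smul, map_smul, smul_smul, smul_smul,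
      Nat.factorial_succ]
    congr 2
    have hk : (k ! : 𝕂) ≠ 0 := Nat.cast_ne_zero.2 k.factorial_ne_zero
    have hk' : (k + 1 : 𝕂) ≠ 0 := by exact_mod_cast k.succ_ne_zero
    push_cast
    field_simp
    ring
  · simp

omit hΛ in
theorem expContraction_one_tmul (z : 𝕂) (y : TensorAlg 𝕂 V) :
    expContraction 𝒱 Λ z (1 ⊗ₜ[𝕂] y) = 1 ⊗ₜ[𝕂] y := by
  rw [expContraction_eq_sum 𝒱 z (N := 1)]
  · simp
  · intro k hk
    obtain ⟨k, rfl⟩ := Nat.exists_eq_add_of_le' hk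
    rw [pow_succ, Module.End.mul_apply, contractionEnd, tensorContraction_one, map_zero]

omit hΛ in
theorem expContraction_tmul_one (z : 𝕂) (x : TensorAlg 𝕂 V) :
    expContraction 𝒱 Λ z (x ⊗ₜ[𝕂] 1) = x ⊗ₜ[𝕂] 1 := by
  rw [expContraction_eq_sum 𝒱 z (N := 1)]
  · simp
  · intro k hk
    obtain ⟨k, rfl⟩ := Nat.exists_eq_add_of_le' hk
    rw [pow_succ, Module.End.mul_apply, contractionEnd, tensorContraction_one_right, map_zero]

omit hΛ in
variable (Λ) in
/-- The star product on the tensor algebra. -/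
def tensorStar (z : 𝕂) (x y : TensorAlg 𝕂 V) : TensorAlg 𝕂 V :=
  LinearMap.mul' 𝕂 _ (expContraction 𝒱 Λ z (x ⊗ₜ[𝕂] y))

theorem tensorStar_add_left (z : 𝕂) (x x' y : TensorAlg 𝕂 V) :
    tensorStar 𝒱 Λ z (x + x') y = tensorStar 𝒱 Λ z x y + tensorStar 𝒱 Λ z x' y := by
  rw [tensorStar, TensorProduct.add_tmul, expContraction_add 𝒱 hΛ, map_add]; rfl

theorem tensorStar_smul_left (z c : 𝕂) (x y : TensorAlg 𝕂 V) :
    tensorStar 𝒱 Λ z (c • x) y = c • tensorStar 𝒱 Λ z x y := by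
  rw [tensorStar, ← TensorProduct.smul_tmul', expContraction_smul 𝒱 hΛ, map_smul]; rfl

omit hΛ in
theorem one_tensorStar (z : 𝕂) (y : TensorAlg 𝕂 V) : tensorStar 𝒱 Λ z 1 y = y := by
  simp [tensorStar, expContraction_one_tmul]

omit hΛ in
theorem tensorStar_one (z : 𝕂) (x : TensorAlg 𝕂 V) : tensorStar 𝒱 Λ z x 1 = x := by
  simp [tensorStar, expContraction_tmul_one]

/-- The Leibniz rule for ι_u, read as an identity of operators on T(V) ⊗ T(V). -/
theorem mul'_insert {i : ZMod 2} {u : V} (hu : u ∈ 𝒱 i)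
    (t : TensorAlg 𝕂 V ⊗[𝕂] TensorAlg 𝕂 V) :
    LinearMap.mul' 𝕂 _ (insertLeft 𝒱 Λ u t) + LinearMap.mul' 𝕂 _ (insertRight 𝒱 Λ i u t) =
      insertion 𝒱 Λ u (LinearMap.mul' 𝕂 _ t) := by
  induction t with
  | zero => simp
  | add s t hs ht => simp only [map_add, ← hs, ← ht]; abel
  | tmul x y => simp [insertLeft, insertRight, insertion_mul 𝒱 hΛ hu]

omit hΛ in
theorem mul'_mulFirst (u : V) (t : TensorAlg 𝕂 V ⊗[𝕂] TensorAlg 𝕂 V) :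
    LinearMap.mul' 𝕂 _ (mulFirst 𝕂 V u t) = iota 𝕂 V u * LinearMap.mul' 𝕂 _ t := by
  induction t with
  | zero => simp
  | add s t hs ht => simp only [map_add, hs, ht, mul_add]
  | tmul x y => simp [mulFirst, mul_assoc]

/-- Star multiplication from the left with a vector. -/
theorem vector_tensorStar (z : 𝕂) {i : ZMod 2} {u : V} (hu : u ∈ 𝒱 i) (x y : TensorAlg 𝕂 V) :
    tensorStar 𝒱 Λ z (iota 𝕂 V u * x + z • insertion 𝒱 Λ u x) y =
      iota 𝕂 V u * tensorStar 𝒱 Λ z x y + z • insertion 𝒱 Λ u (tensorStar 𝒱 Λ z x y) := by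
  have h1 : tensorStar 𝒱 Λ z (iota 𝕂 V u * x) y = LinearMap.mul' 𝕂 _
      (expContraction 𝒱 Λ z (mulFirst 𝕂 V u (x ⊗ₜ[𝕂] y))) := rfl
  have h2 : tensorStar 𝒱 Λ z (insertion 𝒱 Λ u x) y = LinearMap.mul' 𝕂 _
      (expContraction 𝒱 Λ z (insertLeft 𝒱 Λ u (x ⊗ₜ[𝕂] y))) := rfl
  -- The exponential supplies the right insertion and the summand z ι_u x the left one; by the
  -- Leibniz rule they add up to ι_u of the product.
  rw [tensorStar_add_left 𝒱 hΛ, tensorStar_smul_left 𝒱 hΛ, h1, h2,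
    expContraction_mulFirst 𝒱 hΛ z hu, expContraction_insertLeft 𝒱 hΛ z hu, tensorStar,
    ← mul'_insert 𝒱 hΛ hu, map_add, map_smul, mul'_mulFirst, smul_add]
  abel

/-- By `vector_tensorStar`, L_u = u· + z ι_u passes through star multiplication from the right, so
both sides transform alike when x is replaced by L_u x. As u·a = L_u a - z ι_u a and ι_u lowers the
degree, strong induction on the degree starting at 1 suffices. -/
theorem tensorStar_assoc (z : 𝕂) (x y w : TensorAlg 𝕂 V) :
    tensorStar 𝒱 Λ z (tensorStar 𝒱 Λ z x y) w = tensorStar 𝒱 Λ z x (tensorStar 𝒱 Λ z y w) := by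
  let S : Submodule 𝕂 (TensorAlg 𝕂 V) :=
    { carrier := {x | tensorStar 𝒱 Λ z (tensorStar 𝒱 Λ z x y) w =
        tensorStar 𝒱 Λ z x (tensorStar 𝒱 Λ z y w)}
      zero_mem' := by
        have h : ∀ b, tensorStar 𝒱 Λ z 0 b = 0 := fun b => by
          simpa using tensorStar_smul_left 𝒱 hΛ z 0 0 b
        simp only [Set.mem_ofPred_eq, h]
      add_mem' := fun {a b} ha hb => by
        simp only [Set.mem_ofPred_eq, tensorStar_add_left 𝒱 hΛ] at ha hb ⊢
        rw [ha, hb]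
      smul_mem' := fun c a ha => by
        simp only [Set.mem_ofPred_eq, tensorStar_smul_left 𝒱 hΛ] at ha ⊢
        rw [ha] }
  have hS : ∀ (i : ZMod 2), ∀ u ∈ 𝒱 i, ∀ a ∈ S, insertion 𝒱 Λ u a ∈ S → iota 𝕂 V u * a ∈ S := by
    intro i u hu a ha hD
    have h : iota 𝕂 V u * a + z • insertion 𝒱 Λ u a ∈ S := by
      change tensorStar 𝒱 Λ z (tensorStar 𝒱 Λ z _ y) w = _
      rw [vector_tensorStar 𝒱 hΛ z hu, vector_tensorStar 𝒱 hΛ z hu,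
        vector_tensorStar 𝒱 hΛ z hu, show tensorStar 𝒱 Λ z (tensorStar 𝒱 Λ z a y) w =
          tensorStar 𝒱 Λ z a (tensorStar 𝒱 Λ z y w) from ha]
    simpa using S.sub_mem h (S.smul_mem z hD)
  have hmono : ∀ (n : ℕ) (f : Fin n → ZMod 2) (v : Fin n → V), (∀ i, v i ∈ 𝒱 (f i)) →
      monomial 𝕂 v ∈ S := by
    intro n
    induction n using Nat.strong_induction_on with
    | _ n ih =>
      intro f v hv
      cases n with
      | zero =>
        rw [monomial_zero]
        change tensorStar 𝒱 Λ z (tensorStar 𝒱 Λ z 1 y) w = tensorStar 𝒱 Λ z 1 _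
        rw [one_tensorStar, one_tensorStar]
      | succ n =>
        rw [← Fin.cons_self_tail v, monomial_cons]
        refine hS (f 0) _ (hv 0) _ (ih n (by omega) (Fin.tail f) _ fun i => hv i.succ) ?_
        cases n with
        | zero => rw [monomial_zero, insertion_one]; exact S.zero_mem
        | succ n =>
          rw [insertion_monomial 𝒱 Λ _ (f := Fin.tail f) (v := Fin.tail v) fun i => hv i.succ]
          refine sum_mem fun k _ => S.smul_mem _ ?_
          exact ih n (by omega) (k.removeNth (Fin.tail f)) _ fun i => hv _
  exact tensorAlg_eq_top 𝒱 hmono x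

omit hΛ in
theorem symMul_map_toSym (t : TensorAlg 𝕂 V ⊗[𝕂] TensorAlg 𝕂 V) :
    symMul 𝒱 (TensorProduct.map (toSym 𝒱) (toSym 𝒱) t) = toSym 𝒱 (LinearMap.mul' 𝕂 _ t) := by
  induction t with
  | zero => simp
  | add s t hs ht => simp only [map_add, hs, ht]
  | tmul x y => exact symMul_toSym 𝒱 x y

theorem starTerm_toSym (k : ℕ) (x y : TensorAlg 𝕂 V) :
    starTerm 𝒱 Λ k (toSym 𝒱 x) (toSym 𝒱 y) =
      toSym 𝒱 (LinearMap.mul' 𝕂 _ ((contractionEnd 𝒱 Λ ^ k) (x ⊗ₜ[𝕂] y))) := by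
  rw [starTerm, ← TensorProduct.map_tmul, contraction_pow_map_toSym 𝒱 hΛ, symMul_map_toSym]
  rfl

theorem symStar_toSym (z : 𝕂) (x y : TensorAlg 𝕂 V) :
    symStar 𝒱 Λ z (toSym 𝒱 x) (toSym 𝒱 y) = toSym 𝒱 (tensorStar 𝒱 Λ z x y) := by
  obtain ⟨N, hN⟩ := exists_contractionEnd_pow_eq_zero 𝒱 hΛ (x ⊗ₜ[𝕂] y)
  rw [tensorStar, expContraction_eq_sum 𝒱 z hN, map_sum, map_sum, symStar]
  rw [finsum_eq_sum_of_support_subset (s := Finset.range N)]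
  · simp only [starTerm_toSym 𝒱 hΛ, map_smul]
  · intro k hk
    by_contra h
    refine hk ?_
    rw [Finset.coe_range, Set.mem_Iio, not_lt] at h
    simp only [starTerm_toSym 𝒱 hΛ, hN k h, map_zero, smul_zero]

theorem exists_contraction_pow_eq_zero (a b : symAlg 𝒱) :
    ∃ N, ∀ k ≥ N, (contraction 𝒱 Λ ^ k) (a ⊗ₜ[𝕂] b) = 0 := by
  obtain ⟨N, hN⟩ := exists_contractionEnd_pow_eq_zero 𝒱 hΛ
    ((a : TensorAlg 𝕂 V) ⊗ₜ[𝕂] (b : TensorAlg 𝕂 V))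
  refine ⟨N, fun k hk => ?_⟩
  conv_lhs => rw [← toSym_coe 𝒱 a, ← toSym_coe 𝒱 b]
  rw [← TensorProduct.map_tmul, contraction_pow_map_toSym 𝒱 hΛ]
  exact (congrArg _ (hN k hk)).trans (map_zero _)

theorem symStar_assoc (z : 𝕂) (a b c : symAlg 𝒱) :
    symStar 𝒱 Λ z (symStar 𝒱 Λ z a b) c = symStar 𝒱 Λ z a (symStar 𝒱 Λ z b c) := by
  rw [← toSym_coe 𝒱 a, ← toSym_coe 𝒱 b, ← toSym_coe 𝒱 c]
  simp only [symStar_toSym 𝒱 hΛ, tensorStar_assoc 𝒱 hΛ]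

theorem symOne_symStar (z : 𝕂) (a : symAlg 𝒱) : symStar 𝒱 Λ z (symOne 𝒱) a = a := by
  rw [← toSym_coe 𝒱 a, symOne, symStar_toSym 𝒱 hΛ, one_tensorStar]

theorem symStar_symOne (z : 𝕂) (a : symAlg 𝒱) : symStar 𝒱 Λ z a (symOne 𝒱) = a := by
  rw [← toSym_coe 𝒱 a, symOne, symStar_toSym 𝒱 hΛ, tensorStar_one]

end Even

end TensorStar

end GradedWeyl

end

noncomputable section

namespace GradedWeyl

/-! ### Estimates for contractions in the seminorms p_r -/

section Estimates

variable {𝕂 : Type*} [RCLike 𝕂] {V : Type*} [AddCommGroup V] [Module 𝕂 V]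

theorem seminorm_sum_le {F ι : Type*} [AddCommGroup F] [Module 𝕂 F] (q : Seminorm 𝕂 F)
    (s : Finset ι) (f : ι → F) : q (∑ i ∈ s, f i) ≤ ∑ i ∈ s, q (f i) :=
  Finset.le_sum_of_subadditive q (map_zero q).le (map_add_le_add q) s f

theorem projSeminorm_tprod_le (p : Seminorm 𝕂 V) {n : ℕ} (v : Fin n → V) :
    projSeminorm p n (PiTensorProduct.tprod 𝕂 v) ≤ ∏ i, p (v i) := by
  refine ciInf_le_of_le ⟨0, by rintro _ ⟨l, rfl⟩; exact projCost_nonneg p n l.1⟩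
    ⟨FreeAddMonoid.of (1, v), ?_⟩ ?_
  · rw [PiTensorProduct.mem_lifts_iff]
    simp
  · simp [projCost]

/-- The universal property of the projective tensor power: bounds need only be checked on elementary
tensors. -/
theorem le_mul_projSeminorm (p : Seminorm 𝕂 V) {n : ℕ} (q : Seminorm 𝕂 (⨂[𝕂]^n V)) {c : ℝ}
    (hc : 0 ≤ c) (h : ∀ v : Fin n → V, q (PiTensorProduct.tprod 𝕂 v) ≤ c * ∏ i, p (v i))
    (t : ⨂[𝕂]^n V) : q t ≤ c * projSeminorm p n t := by
  have := (PiTensorProduct.nonempty_lifts t).to_subtype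
  change q t ≤ c * ⨅ l : PiTensorProduct.lifts t, projCost p n l.1
  rw [Real.mul_iInf_of_nonneg hc]
  refine le_ciInf fun l => ?_
  obtain ⟨l, hl⟩ := l
  rw [PiTensorProduct.mem_lifts_iff] at hl
  change q t ≤ c * projCost p n l
  rw [← hl, projCost]
  generalize l.toList = L
  induction L with
  | nil => simp
  | cons x L ih =>
    simp only [List.map_cons, List.sum_cons, mul_add] at ih ⊢
    refine (map_add_le_add q _ _).trans (add_le_add ?_ ih)
    rw [map_smul_eq_mul]
    calc ‖x.1‖ * q (PiTensorProduct.tprod 𝕂 x.2) ≤ ‖x.1‖ * (c * ∏ i, p (x.2 i)) :=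
          mul_le_mul_of_nonneg_left (h x.2) (norm_nonneg _)
      _ = c * (‖x.1‖ * ∏ i, p (x.2 i)) := by ring

theorem tensorSeminorm_apply (p : Seminorm 𝕂 V) (r : ℝ) (x : TensorAlg 𝕂 V) :
    tensorSeminorm p r x = ∑' n : ℕ, projSeminorm p n (x n) * (n ! : ℝ) ^ r := rfl

theorem tensorSeminorm_monomial_le (p : Seminorm 𝕂 V) (r : ℝ) {n : ℕ} (v : Fin n → V) :
    tensorSeminorm p r (monomial 𝕂 v) ≤ (∏ i, p (v i)) * (n ! : ℝ) ^ r := by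
  rw [tensorSeminorm_apply, tsum_eq_single n]
  · rw [monomial, DirectSum.lof_apply]
    exact mul_le_mul_of_nonneg_right (projSeminorm_tprod_le p v) (by positivity)
  · intro m hm
    rw [monomial, DirectSum.lof_eq_of, DirectSum.of_eq_of_ne _ _ _ hm, map_zero, zero_mul]

theorem le_mul_tensorSeminorm (p : Seminorm 𝕂 V) (r : ℝ) (q : Seminorm 𝕂 (TensorAlg 𝕂 V)) {c : ℝ}
    (hc : 0 ≤ c)
    (h : ∀ (n : ℕ) (v : Fin n → V), q (monomial 𝕂 v) ≤ c * ((∏ i, p (v i)) * (n ! : ℝ) ^ r))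
    (x : TensorAlg 𝕂 V) : q x ≤ c * tensorSeminorm p r x := by
  classical
  have h1 : ∀ n, q (DirectSum.lof 𝕂 ℕ (fun n => ⨂[𝕂]^n V) n (x n)) ≤
      c * (projSeminorm p n (x n) * (n ! : ℝ) ^ r) := by
    intro n
    have := le_mul_projSeminorm p (q.comp (DirectSum.lof 𝕂 ℕ (fun n => ⨂[𝕂]^n V) n))
      (c := c * (n ! : ℝ) ^ r) (by positivity)
      (fun v => (h n v).trans_eq (by ring)) (x n)
    exact this.trans_eq (by ring)
  rw [tensorSeminorm_apply, ← tsum_mul_left,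
    tsum_eq_sum (s := DFinsupp.support x) (fun n hn => by
      rw [show x n = 0 by simpa using hn, map_zero, zero_mul, mul_zero])]
  conv_lhs => rw [← DirectSum.sum_support_of x]
  exact (seminorm_sum_le q _ _).trans (Finset.sum_le_sum fun n _ => h1 n)

theorem tensorSeminorm_mono {p p' : Seminorm 𝕂 V} (hp : p ≤ p') {r r' : ℝ} (hr : r ≤ r')
    (x : TensorAlg 𝕂 V) : tensorSeminorm p r x ≤ tensorSeminorm p' r' x := by
  rw [← one_mul (tensorSeminorm p' r' x)]
  refine le_mul_tensorSeminorm p' r' _ zero_le_one (fun n v => ?_) x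
  rw [one_mul]
  refine (tensorSeminorm_monomial_le p r v).trans ?_
  have h1 : (1 : ℝ) ≤ n ! := by exact_mod_cast n.factorial_pos
  exact mul_le_mul (Finset.prod_le_prod (fun _ _ => apply_nonneg p _) fun i _ => hp (v i))
    (Real.rpow_le_rpow_of_exponent_le h1 hr) (by positivity)
    (Finset.prod_nonneg fun _ _ => apply_nonneg p' _)

variable (𝒱 : ZMod 2 → Submodule 𝕂 V) [DirectSum.Decomposition 𝒱]

/-- The seminorm is the sum of its values on the homogeneous parts. -/
def IsGradedSeminorm (p : Seminorm 𝕂 V) : Prop := ∀ v, p v = ∑ i, p (parityProj 𝒱 i v)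

variable {𝒱}

theorem IsGradedSeminorm.smul {p : Seminorm 𝕂 V} (hp : IsGradedSeminorm 𝒱 p) (c : NNReal) :
    IsGradedSeminorm 𝒱 (c • p) := fun v => by
  simp only [smul_apply, ← Finset.smul_sum]
  rw [← hp]

/-- For a graded seminorm the product of the p(v i) expands over parity patterns exactly as the
tensor itself does. So testing on homogeneous monomials costs no factor 2^n. -/
theorem IsGradedSeminorm.le_mul_tensorSeminorm {p : Seminorm 𝕂 V} (hp : IsGradedSeminorm 𝒱 p)
    (r : ℝ) (q : Seminorm 𝕂 (TensorAlg 𝕂 V)) {c : ℝ} (hc : 0 ≤ c)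
    (h : ∀ (n : ℕ) (f : Fin n → ZMod 2) (v : Fin n → V), (∀ i, v i ∈ 𝒱 (f i)) →
      q (monomial 𝕂 v) ≤ c * ((∏ i, p (v i)) * (n ! : ℝ) ^ r))
    (x : TensorAlg 𝕂 V) : q x ≤ c * tensorSeminorm p r x := by
  refine GradedWeyl.le_mul_tensorSeminorm p r q hc (fun n v => ?_) x
  have h1 : monomial 𝕂 v = ∑ f : Fin n → ZMod 2, monomial 𝕂 fun i => parityProj 𝒱 (f i) (v i) := by
    rw [monomial, tprod_eq_sum_parityProj 𝒱 v, map_sum]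
    rfl
  have h2 : ∏ i, p (v i) = ∑ f : Fin n → ZMod 2, ∏ i, p (parityProj 𝒱 (f i) (v i)) := by
    rw [Finset.prod_congr rfl fun i _ => hp (v i), Finset.prod_univ_sum, Fintype.piFinset_univ]
  rw [h1, h2, Finset.sum_mul, Finset.mul_sum]
  exact (seminorm_sum_le q _ _).trans (Finset.sum_le_sum fun f _ =>
    h n f _ fun i => parityProj_mem 𝒱 _ _)

theorem norm_koszulSign {n : ℕ} (f : Fin n → ZMod 2) (σ : Equiv.Perm (Fin n)) :
    ‖koszulSign 𝕂 f σ‖ = 1 := by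
  rw [koszulSign, norm_prod]
  refine Finset.prod_eq_one fun i _ => ?_
  rw [norm_prod]
  refine Finset.prod_eq_one fun j _ => ?_
  split_ifs
  · exact norm_paritySign _
  · exact norm_one

/-- On a homogeneous monomial the symmetrizer averages rearrangements with signs of modulus one. -/
theorem IsGradedSeminorm.tensorSeminorm_symmetrizer_le {p : Seminorm 𝕂 V}
    (hp : IsGradedSeminorm 𝒱 p) (r : ℝ) (x : TensorAlg 𝕂 V) :
    tensorSeminorm p r (symmetrizer 𝒱 x) ≤ tensorSeminorm p r x := by
  have := hp.le_mul_tensorSeminorm r ((tensorSeminorm p r).comp (symmetrizer 𝒱)) zero_le_one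
    (fun n f v hv => ?_) x
  · rwa [one_mul] at this
  rw [Seminorm.comp_apply, symmetrizer_monomial 𝒱 hv, map_smul_eq_mul, one_mul]
  have h1 : tensorSeminorm p r (∑ σ : Equiv.Perm (Fin n), koszulSign 𝕂 f σ • monomial 𝕂 (v ∘ σ)) ≤
      ∑ _σ : Equiv.Perm (Fin n), (∏ i, p (v i)) * (n ! : ℝ) ^ r := by
    refine (seminorm_sum_le _ _ _).trans (Finset.sum_le_sum fun σ _ => ?_)
    rw [map_smul_eq_mul, norm_koszulSign, one_mul]
    refine (tensorSeminorm_monomial_le p r _).trans_eq ?_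
    rw [← Equiv.prod_comp σ fun i => p (v i)]
    rfl
  rw [Finset.sum_const, Finset.card_univ, Fintype.card_perm, Fintype.card_fin, nsmul_eq_mul] at h1
  have h0 : (n ! : ℝ) ≠ 0 := Nat.cast_ne_zero.2 n.factorial_ne_zero
  rw [norm_inv, RCLike.norm_natCast]
  calc (n ! : ℝ)⁻¹ * _ ≤ (n ! : ℝ)⁻¹ * ((n ! : ℝ) * ((∏ i, p (v i)) * (n ! : ℝ) ^ r)) :=
        mul_le_mul_of_nonneg_left h1 (by positivity)
    _ = _ := by rw [← mul_assoc, inv_mul_cancel₀ h0, one_mul]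

/-- The growth of `k` contractions followed by the product in tensor degree `n`. -/
def contractionWeight (r : ℝ) (k n : ℕ) : ℝ :=
  n.descFactorial k * ((2 : ℝ) ^ (n - k) * ((n - k)! : ℝ)) ^ r

theorem contractionWeight_nonneg (r : ℝ) (k n : ℕ) : 0 ≤ contractionWeight r k n := by
  rw [contractionWeight]; positivity

theorem contractionWeight_succ (r : ℝ) (k n : ℕ) :
    contractionWeight r (k + 1) (n + 1) = (n + 1) * contractionWeight r k n := by
  rw [contractionWeight, contractionWeight, Nat.succ_descFactorial_succ, Nat.add_sub_add_right]
  push_cast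
  ring

/-- Here 1/2 enters. The falling factorial is k! times a binomial coefficient, hence at most k! 2^n,
and ((n-k)!)^r ≤ (n!/k!)^r ≤ (n!)^r/√(k!) for r ≥ 1/2. What remains is √(k!), and the two tensor
factors together yield the k! that the exponential series can afford. -/
theorem contractionWeight_le {r : ℝ} (hr : 1 / 2 ≤ r) {θ : ℝ} (hθ : 0 < θ) (hθ1 : θ ≤ 1)
    (k n : ℕ) : contractionWeight r k n ≤
      √(k ! : ℝ) * θ ^ k * ((2 * 2 ^ r * θ⁻¹) ^ n * (n ! : ℝ) ^ r) := by
  have hr0 : 0 ≤ r := by linarith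
  by_cases hk : n < k
  · rw [contractionWeight, Nat.descFactorial_eq_zero_iff_lt.2 hk, Nat.cast_zero, zero_mul]
    positivity
  push Not at hk
  have hkf : (0 : ℝ) < k ! := by exact_mod_cast k.factorial_pos
  have hk1 : (1 : ℝ) ≤ k ! := by exact_mod_cast k.factorial_pos
  have h1 : (n.descFactorial k : ℝ) ≤ k ! * 2 ^ n := by
    rw [Nat.descFactorial_eq_factorial_mul_choose]
    exact_mod_cast Nat.mul_le_mul_left _ (Nat.choose_le_two_pow n k)
  have h2 : ((n - k)! : ℝ) ≤ n ! / k ! := by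
    rw [le_div_iff₀ hkf]
    exact_mod_cast Nat.le_of_dvd n.factorial_pos
      (by rw [mul_comm]; exact Nat.factorial_mul_factorial_dvd_factorial hk)
  have h3 : (2 : ℝ) ^ (n - k) * ((n - k)! : ℝ) ≤ 2 ^ n * (n ! / k !) :=
    mul_le_mul (pow_le_pow_right₀ one_le_two (Nat.sub_le n k)) h2 (by positivity) (by positivity)
  have h4 : ((2 : ℝ) ^ (n - k) * ((n - k)! : ℝ)) ^ r ≤ (2 ^ r) ^ n * (n ! : ℝ) ^ r / √(k ! : ℝ) := by
    refine (Real.rpow_le_rpow (by positivity) h3 hr0).trans ?_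
    rw [Real.mul_rpow (by positivity) (by positivity), Real.div_rpow (by positivity) hkf.le,
      ← Real.rpow_natCast, ← Real.rpow_mul two_pos.le, mul_comm (n : ℝ) r,
      Real.rpow_mul two_pos.le, Real.rpow_natCast, mul_div_assoc, Real.sqrt_eq_rpow]
    refine mul_le_mul_of_nonneg_left ?_ (by positivity)
    exact div_le_div_of_nonneg_left (by positivity) (by positivity)
      (Real.rpow_le_rpow_of_exponent_le hk1 hr)
  -- Since k ≤ n, decay in k is bought with an exponential factor in n, which a rescaling of p can
  -- absorb.
  have h5 : (1 : ℝ) ≤ θ ^ k * θ⁻¹ ^ n := by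
    rw [inv_pow, ← div_eq_mul_inv, one_le_div (by positivity)]
    exact pow_le_pow_of_le_one hθ.le hθ1 hk
  calc contractionWeight r k n
      ≤ (k ! * 2 ^ n) * ((2 ^ r) ^ n * (n ! : ℝ) ^ r / √(k ! : ℝ)) :=
        mul_le_mul h1 h4 (by positivity) (by positivity)
    _ = √(k ! : ℝ) * (2 ^ n * (2 ^ r) ^ n * (n ! : ℝ) ^ r) * 1 := by
        have : (k ! : ℝ) = √(k ! : ℝ) * √(k ! : ℝ) := (Real.mul_self_sqrt hkf.le).symm
        have hs : √(k ! : ℝ) ≠ 0 := (Real.sqrt_pos.2 hkf).ne'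
        field_simp
        rw [Real.sq_sqrt hkf.le]
    _ ≤ √(k ! : ℝ) * (2 ^ n * (2 ^ r) ^ n * (n ! : ℝ) ^ r) * (θ ^ k * θ⁻¹ ^ n) :=
        mul_le_mul_of_nonneg_left h5 (by positivity)
    _ = _ := by rw [mul_pow, mul_pow]; ring

variable {Λ : V →ₗ[𝕂] V →ₗ[𝕂] 𝕂} {p : Seminorm 𝕂 V}

/-- One contraction is a sum over all pairs of factors, each term bounded by the seminorms of the
removed vectors. The number of pairs is what `contractionWeight_succ` records on the two sides. -/
theorem tensorSeminorm_contraction_monomial_le (hp : IsGradedSeminorm 𝒱 p)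
    (hΛp : ∀ v w, ‖Λ v w‖ ≤ p v * p w) {r : ℝ} (hr : 0 ≤ r) (k : ℕ) {n m : ℕ}
    {f : Fin n → ZMod 2} {v : Fin n → V} (hv : ∀ i, v i ∈ 𝒱 (f i))
    {g : Fin m → ZMod 2} {w : Fin m → V} (hw : ∀ i, w i ∈ 𝒱 (g i)) :
    tensorSeminorm p r (symmetrizer 𝒱 (LinearMap.mul' 𝕂 _
      ((contractionEnd 𝒱 Λ ^ k) (monomial 𝕂 v ⊗ₜ[𝕂] monomial 𝕂 w)))) ≤
    (contractionWeight r k n * ∏ i, p (v i)) * (contractionWeight r k m * ∏ i, p (w i)) := by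
  have hP : ∀ {l : ℕ} (v : Fin l → V), 0 ≤ ∏ i, p (v i) := fun v =>
    Finset.prod_nonneg fun _ _ => apply_nonneg p _
  induction k generalizing n m with
  | zero =>
    rw [pow_zero, Module.End.one_apply, LinearMap.mul'_apply, ← monomial_append]
    refine (hp.tensorSeminorm_symmetrizer_le r _).trans
      ((tensorSeminorm_monomial_le p r _).trans ?_)
    simp only [Fin.prod_univ_add, Fin.append_left, Fin.append_right, contractionWeight,
      Nat.descFactorial_zero, Nat.cast_one, one_mul, Nat.sub_zero]
    -- The binomial coefficient is at most 2^(n+m), which is shared between the two weights.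
    have h1 : ((n + m)! : ℝ) ≤ (2 ^ n * n !) * (2 ^ m * m !) := by
      have h2 : (n + m)! ≤ (2 ^ n * n !) * (2 ^ m * m !) := by
        rw [← Nat.add_choose_mul_factorial_mul_factorial n m]
        calc (n + m).choose m * n ! * m ! ≤ 2 ^ (n + m) * n ! * m ! :=
              Nat.mul_le_mul_right _ (Nat.mul_le_mul_right _ (Nat.choose_le_two_pow _ _))
          _ = _ := by ring
      exact_mod_cast h2
    have h3 : ((n + m)! : ℝ) ^ r ≤ (2 ^ n * n ! : ℝ) ^ r * (2 ^ m * m ! : ℝ) ^ r := by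
      rw [← Real.mul_rpow (by positivity) (by positivity)]
      exact Real.rpow_le_rpow (by positivity) h1 hr
    calc _ ≤ (∏ i, p (v i)) * (∏ i, p (w i)) * ((2 ^ n * n ! : ℝ) ^ r * (2 ^ m * m ! : ℝ) ^ r) :=
          mul_le_mul_of_nonneg_left h3 (mul_nonneg (hP v) (hP w))
      _ = _ := by ring
  | succ k ih =>
    rw [pow_succ, Module.End.mul_apply]
    have hRHS : 0 ≤ (contractionWeight r (k + 1) n * ∏ i, p (v i)) *
        (contractionWeight r (k + 1) m * ∏ i, p (w i)) :=
      mul_nonneg (mul_nonneg (contractionWeight_nonneg _ _ _) (hP v))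
        (mul_nonneg (contractionWeight_nonneg _ _ _) (hP w))
    cases n with
    | zero =>
      rw [monomial_zero v, contractionEnd, tensorContraction_one]
      simpa using hRHS
    | succ n =>
    cases m with
    | zero =>
      rw [monomial_zero w, contractionEnd, tensorContraction_one_right]
      simpa using hRHS
    | succ m =>
    rw [show contractionEnd 𝒱 Λ (monomial 𝕂 v ⊗ₜ[𝕂] monomial 𝕂 w) = _ from
      tensorContraction_monomial 𝒱 Λ hv hw]
    simp only [map_sum]
    have key : ∀ (a : Fin (n + 1)) (b : Fin (m + 1)),
        tensorSeminorm p r (symmetrizer 𝒱 (LinearMap.mul' 𝕂 _ ((contractionEnd 𝒱 Λ ^ k)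
          ((paritySign 𝕂 (f a * ∑ j ∈ Finset.Ioi a, f j) *
            paritySign 𝕂 (g b * ∑ j ∈ Finset.Iio b, g j) * Λ (v a) (w b)) •
            (monomial 𝕂 (a.removeNth v) ⊗ₜ[𝕂] monomial 𝕂 (b.removeNth w)))))) ≤
        (contractionWeight r k n * ∏ i, p (v i)) * (contractionWeight r k m * ∏ i, p (w i)) := by
      intro a b
      rw [map_smul, map_smul, map_smul, map_smul_eq_mul, norm_mul, norm_mul, norm_paritySign,
        norm_paritySign, one_mul, one_mul]
      have h1 := ih (f := a.removeNth f) (v := a.removeNth v) (fun i => hv _)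
        (g := b.removeNth g) (w := b.removeNth w) (fun i => hw _)
      refine (mul_le_mul (hΛp (v a) (w b)) h1 (apply_nonneg _ _)
        (mul_nonneg (apply_nonneg p _) (apply_nonneg p _))).trans_eq ?_
      rw [Fin.prod_univ_succAbove (fun i => p (v i)) a,
        Fin.prod_univ_succAbove (fun i => p (w i)) b]
      simp only [Fin.removeNth]
      ring
    refine (seminorm_sum_le _ _ _).trans ((Finset.sum_le_sum fun a _ =>
      (seminorm_sum_le _ _ _).trans (Finset.sum_le_sum fun b _ => key a b)).trans_eq ?_)
    simp only [Finset.sum_const, Finset.card_univ, Fintype.card_fin, nsmul_eq_mul,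
      contractionWeight_succ]
    push_cast
    ring

theorem tensorSeminorm_starTerm_le (hΛ : IsEvenForm 𝒱 Λ) (hp : IsGradedSeminorm 𝒱 p)
    (hΛp : ∀ v w, ‖Λ v w‖ ≤ p v * p w) {r : ℝ} (hr : 1 / 2 ≤ r) {θ : NNReal} (hθ : 0 < θ)
    (hθ1 : θ ≤ 1) (k : ℕ) (a b : symAlg 𝒱) :
    tensorSeminorm p r (starTerm 𝒱 Λ k a b : TensorAlg 𝕂 V) ≤ k ! * (θ : ℝ) ^ k *
      tensorSeminorm ((2 * 2 ^ r * θ⁻¹ : NNReal) • p) r (a : TensorAlg 𝕂 V) *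
      tensorSeminorm ((2 * 2 ^ r * θ⁻¹ : NNReal) • p) r (b : TensorAlg 𝕂 V) := by
  -- The base of the exponential factor in `contractionWeight_le`; with q = c • p it is absorbed
  -- into the product of the q(v i).
  set c : NNReal := 2 * 2 ^ r * θ⁻¹ with hc
  set q : Seminorm 𝕂 V := c • p with hq
  have hqg : IsGradedSeminorm 𝒱 q := hp.smul c
  have hr0 : 0 ≤ r := by linarith
  have hθ0 : (0 : ℝ) < θ := hθ
  have hθ1' : (θ : ℝ) ≤ 1 := hθ1
  have hterm : (starTerm 𝒱 Λ k a b : TensorAlg 𝕂 V) = symmetrizer 𝒱 (LinearMap.mul' 𝕂 _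
      ((contractionEnd 𝒱 Λ ^ k) ((a : TensorAlg 𝕂 V) ⊗ₜ[𝕂] (b : TensorAlg 𝕂 V)))) := by
    conv_lhs => rw [← toSym_coe 𝒱 a, ← toSym_coe 𝒱 b]
    rw [starTerm_toSym 𝒱 hΛ]
    rfl
  have hprod : ∀ {n : ℕ} (v : Fin n → V), ∏ i, q (v i) = (c : ℝ) ^ n * ∏ i, p (v i) := by
    intro n v
    simp only [hq, smul_apply, NNReal.smul_def, smul_eq_mul, Finset.prod_mul_distrib,
      Finset.prod_const, Finset.card_univ, Fintype.card_fin]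
  have hcr : (c : ℝ) = 2 * 2 ^ r * (θ : ℝ)⁻¹ := by
    rw [hc]; push_cast; rfl
  have hw : ∀ {n : ℕ} (v : Fin n → V), contractionWeight r k n * ∏ i, p (v i) ≤
      √(k ! : ℝ) * (θ : ℝ) ^ k * ((∏ i, q (v i)) * (n ! : ℝ) ^ r) := by
    intro n v
    rw [hprod, hcr]
    exact (mul_le_mul_of_nonneg_right (contractionWeight_le hr hθ0 hθ1' k n)
      (Finset.prod_nonneg fun _ _ => apply_nonneg p _)).trans_eq (by ring)
  set C : ℝ := √(k ! : ℝ) * (θ : ℝ) ^ k with hC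
  have hC0 : 0 ≤ C := by positivity
  let A (y : TensorAlg 𝕂 V) : TensorAlg 𝕂 V →ₗ[𝕂] TensorAlg 𝕂 V :=
    symmetrizer 𝒱 ∘ₗ LinearMap.mul' 𝕂 _ ∘ₗ (contractionEnd 𝒱 Λ ^ k) ∘ₗ
      (TensorProduct.mk 𝕂 _ _).flip y
  let B (x : TensorAlg 𝕂 V) : TensorAlg 𝕂 V →ₗ[𝕂] TensorAlg 𝕂 V :=
    symmetrizer 𝒱 ∘ₗ LinearMap.mul' 𝕂 _ ∘ₗ (contractionEnd 𝒱 Λ ^ k) ∘ₗ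
      TensorProduct.mk 𝕂 _ _ x
  have hAB : ∀ x y, A y x = B x y := fun _ _ => rfl
  -- The bound on pairs of monomials is extended one argument at a time, with the other one fixed.
  have h1 : ∀ (m : ℕ) (g : Fin m → ZMod 2) (w : Fin m → V), (∀ i, w i ∈ 𝒱 (g i)) → ∀ x,
      tensorSeminorm p r (A (monomial 𝕂 w) x) ≤
        (C * (C * ((∏ i, q (w i)) * (m ! : ℝ) ^ r))) * tensorSeminorm q r x := by
    intro m g w hwg x
    have hQ : 0 ≤ (∏ i, q (w i)) * (m ! : ℝ) ^ r :=
      mul_nonneg (Finset.prod_nonneg fun _ _ => apply_nonneg q _) (by positivity)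
    refine hqg.le_mul_tensorSeminorm r ((tensorSeminorm p r).comp (A (monomial 𝕂 w)))
      (by positivity) (fun n f v hvf => ?_) x
    refine (tensorSeminorm_contraction_monomial_le hp hΛp hr0 k hvf hwg).trans
      ((mul_le_mul (hw v) (hw w) (mul_nonneg (contractionWeight_nonneg _ _ _)
        (Finset.prod_nonneg fun _ _ => apply_nonneg p _)) ?_).trans_eq (by ring))
    exact mul_nonneg hC0 (mul_nonneg (Finset.prod_nonneg fun _ _ => apply_nonneg q _)
      (by positivity))
  have h2 := hqg.le_mul_tensorSeminorm r ((tensorSeminorm p r).comp (B a))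
    (c := C * C * tensorSeminorm q r (a : TensorAlg 𝕂 V))
    (mul_nonneg (by positivity) (apply_nonneg _ _))
    (fun m g w hwg => (h1 m g w hwg a).trans_eq (by ring)) b
  rw [hterm]
  refine h2.trans ?_
  -- The product contains θ^(2k), of which one power θ^k is given away.
  have hCC : C * C ≤ k ! * (θ : ℝ) ^ k := by
    calc C * C = (√(k ! : ℝ) * √(k ! : ℝ)) * (θ : ℝ) ^ k * (θ : ℝ) ^ k := by rw [hC]; ring
      _ ≤ (√(k ! : ℝ) * √(k ! : ℝ)) * (θ : ℝ) ^ k * 1 :=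
          mul_le_mul_of_nonneg_left (pow_le_one₀ hθ0.le hθ1') (by positivity)
      _ = _ := by rw [Real.mul_self_sqrt (by positivity), mul_one]
  exact mul_le_mul_of_nonneg_right (mul_le_mul_of_nonneg_right hCC (apply_nonneg _ _))
    (apply_nonneg _ _)

variable [TopologicalSpace V]

/-- Continuity at the origin bounds Λ by 1 where a continuous seminorm t is below ε; homogeneity
then gives the bound with t/ε. -/
theorem exists_continuous_seminorm_bound [PolynormableSpace 𝕂 V]
    (hΛ : Continuous fun x : V × V => Λ x.1 x.2) :
    ∃ s : Seminorm 𝕂 V, Continuous s ∧ ∀ v w, ‖Λ v w‖ ≤ s v * s w := by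
  have hV := PolynormableSpace.withSeminorms 𝕂 V
  have h1 : (fun x : V × V => Λ x.1 x.2) ⁻¹' Metric.ball 0 1 ∈ 𝓝 ((0 : V), (0 : V)) :=
    hΛ.continuousAt.preimage_mem_nhds (by simpa using Metric.ball_mem_nhds (0 : 𝕂) one_pos)
  rw [nhds_prod_eq, Filter.mem_prod_same_iff] at h1
  obtain ⟨U, hU, hUU⟩ := h1
  obtain ⟨⟨I, ε⟩, hε, hIU⟩ := hV.hasBasis_zero_ball.mem_iff.1 hU
  dsimp only at hε hIU
  set t := I.sup fun q : {p : Seminorm 𝕂 V // Continuous p} => q.1 with ht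
  have htc : Continuous t := by
    have : ∀ J : Finset {p : Seminorm 𝕂 V // Continuous p},
        Continuous (J.sup fun q => q.1 : Seminorm 𝕂 V) := by
      intro J
      induction J using Finset.cons_induction with
      | empty => exact continuous_const
      | cons a J ha ih =>
        rw [Finset.sup_cons]
        exact a.2.sup ih
    exact this I
  have hb : ∀ v w, t v < ε → t w < ε → ‖Λ v w‖ < 1 := by
    intro v w hv hw
    have := hUU (Set.mk_mem_prod (hIU ((Seminorm.mem_ball_zero _).2 hv))
      (hIU ((Seminorm.mem_ball_zero _).2 hw)))
    simpa using this
  let c : NNReal := ⟨ε⁻¹, by positivity⟩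
  refine ⟨c • t, htc.const_smul c, fun v w => ?_⟩
  -- The shift by δ permits normalizing vectors on which t vanishes; it is removed by letting δ tend
  -- to 0.
  have hδ : ∀ δ : ℝ, 0 < δ → ‖Λ v w‖ ≤ (ε⁻¹ * (t v + δ)) * (ε⁻¹ * (t w + δ)) := by
    intro δ hδ
    have hv0 : 0 < ε⁻¹ * (t v + δ) := by
      have := apply_nonneg t v; positivity
    have hw0 : 0 < ε⁻¹ * (t w + δ) := by
      have := apply_nonneg t w; positivity
    have hn : ∀ (u : V), 0 < ε⁻¹ * (t u + δ) →
        t (((ε⁻¹ * (t u + δ) : ℝ) : 𝕂)⁻¹ • u) < ε := by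
      intro u hu
      rw [map_smul_eq_mul, norm_inv, RCLike.norm_ofReal, abs_of_pos hu, inv_mul_lt_iff₀ hu]
      have : ε⁻¹ * (t u + δ) * ε = t u + δ := by field_simp
      linarith
    have := hb _ _ (hn v hv0) (hn w hw0)
    rw [map_smul, map_smul, LinearMap.smul_apply, norm_smul, norm_smul, norm_inv, norm_inv,
      RCLike.norm_ofReal, RCLike.norm_ofReal, abs_of_pos hv0, abs_of_pos hw0,
      inv_mul_lt_iff₀ hw0, inv_mul_lt_iff₀ hv0] at this
    linarith
  have hlim : Filter.Tendsto (fun δ : ℝ => (ε⁻¹ * (t v + δ)) * (ε⁻¹ * (t w + δ))) (𝓝[>] 0)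
      (𝓝 ((ε⁻¹ * (t v + 0)) * (ε⁻¹ * (t w + 0)))) := by
    refine Filter.Tendsto.mono_left (Continuous.tendsto ?_ 0) nhdsWithin_le_nhds
    fun_prop
  have := ge_of_tendsto hlim (Filter.eventually_of_mem self_mem_nhdsWithin hδ)
  have hc : ∀ u, (c • t) u = ε⁻¹ * t u := fun _ => rfl
  rw [hc, hc]
  simpa using this

theorem sum_zmod_two {M : Type*} [AddCommMonoid M] (f : ZMod 2 → M) :
    ∑ i, f i = f 0 + f 1 := Fin.sum_univ_two f

/-- Adding the seminorm that controls Λ and then summing over the parity projections gives a graded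
seminorm. It is continuous because the projections are, and it dominates by the triangle inequality.
-/
theorem exists_graded_seminorm [PolynormableSpace 𝕂 V] (h𝒱 : ∀ i, Continuous (parityProj 𝒱 i))
    (hΛ : Continuous fun x : V × V => Λ x.1 x.2) {p₀ : Seminorm 𝕂 V} (hp₀ : Continuous p₀) :
    ∃ p : Seminorm 𝕂 V, Continuous p ∧ p₀ ≤ p ∧ IsGradedSeminorm 𝒱 p ∧
      ∀ v w, ‖Λ v w‖ ≤ p v * p w := by
  obtain ⟨s, hs, hsΛ⟩ := exists_continuous_seminorm_bound hΛ
  let p₁ : Seminorm 𝕂 V := p₀ + s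
  have hp₁ : Continuous p₁ := hp₀.add hs
  let p : Seminorm 𝕂 V := p₁.comp (parityProj 𝒱 0) + p₁.comp (parityProj 𝒱 1)
  have hp : ∀ v, p v = p₁ (parityProj 𝒱 0 v) + p₁ (parityProj 𝒱 1 v) := fun _ => rfl
  have hle : ∀ v, p₁ v ≤ p v := by
    intro v
    conv_lhs => rw [← sum_parityProj 𝒱 v, sum_zmod_two]
    exact map_add_le_add _ _ _
  refine ⟨p, (hp₁.comp (h𝒱 0)).add (hp₁.comp (h𝒱 1)), fun v => ?_, fun v => ?_, fun v w => ?_⟩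
  · exact (le_add_of_nonneg_right (apply_nonneg s v)).trans (hle v)
  · have h0 := fun j => parityProj_of_mem 𝒱 (parityProj_mem 𝒱 0 v) j
    have h1 := fun j => parityProj_of_mem 𝒱 (parityProj_mem 𝒱 1 v) j
    rw [sum_zmod_two]
    simp [hp, h0, h1]
  · have h : ∀ v, s v ≤ p v := fun v =>
      (le_add_of_nonneg_left (apply_nonneg p₀ v)).trans (hle v)
    exact (hsΛ v w).trans (mul_le_mul (h v) (h w) (apply_nonneg _ _) (apply_nonneg _ _))

/-- The fundamental estimate for the terms of the star product. -/
theorem exists_weylSeminorm_starTerm_le [PolynormableSpace 𝕂 V]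
    (h𝒱 : ∀ i, Continuous (parityProj 𝒱 i)) (hΛe : IsEvenForm 𝒱 Λ)
    (hΛ : Continuous fun x : V × V => Λ x.1 x.2) {E : Set ℝ}
    (hE : ∀ r ∈ E, ∃ r' ∈ E, r ≤ r' ∧ 1 / 2 ≤ r')
    (i : {p : Seminorm 𝕂 V // Continuous p} × E) {θ : NNReal} (hθ : 0 < θ) (hθ1 : θ ≤ 1) :
    ∃ j, ∀ (k : ℕ) (a b : Weyl 𝒱 E), weylSeminorms 𝒱 E i (weylTerm 𝒱 E Λ k a b) ≤
      k ! * (θ : ℝ) ^ k * weylSeminorms 𝒱 E j a * weylSeminorms 𝒱 E j b := by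
  obtain ⟨⟨p₀, hp₀⟩, ⟨r₀, hr₀⟩⟩ := i
  obtain ⟨p, hpc, hp0, hpg, hpΛ⟩ := exists_graded_seminorm h𝒱 hΛ hp₀
  -- The exponent is raised to at least 1/2 within E, which only enlarges the seminorm to be
  -- bounded.
  obtain ⟨r, hrE, hr0, hr⟩ := hE r₀ hr₀
  refine ⟨⟨⟨(2 * 2 ^ r * θ⁻¹ : NNReal) • p, hpc.const_smul _⟩, ⟨r, hrE⟩⟩, fun k a b => ?_⟩
  exact (tensorSeminorm_mono hp0 hr0 _).trans
    (tensorSeminorm_starTerm_le hΛe hpg hpΛ hr hθ hθ1 k a b)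

end Estimates

end GradedWeyl

end

noncomputable section

namespace GradedWeyl

/-! ### Exponential series with entire growth in complete locally convex spaces -/

section EntireSeries

variable {𝕂 : Type*} [RCLike 𝕂] {F : Type*} [AddCommGroup F] [Module 𝕂 F]

section Growth

variable [TopologicalSpace F]

/-- In every continuous seminorm the sequence grows at most like `k! θ ^ k`, for all `θ > 0`. -/
def EntireGrowth (𝕂 : Type*) [RCLike 𝕂] {F : Type*} [AddCommGroup F] [Module 𝕂 F]
    [TopologicalSpace F] (v : ℕ → F) : Prop :=
  ∀ q : Seminorm 𝕂 F, Continuous q → ∀ θ : ℝ, 0 < θ →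
    ∃ C, 0 ≤ C ∧ ∀ k j, q (v (k + j)) ≤ C * (k ! * θ ^ k) * (j ! * θ ^ j)

/-- The two-index form follows from (k+j)! ≤ 2^(k+j) k! j!, the power of 2 being absorbed by halving
θ. It is the form that survives shifts and rearrangements. -/
theorem EntireGrowth.of_le {v : ℕ → F} (h : ∀ q : Seminorm 𝕂 F, Continuous q → ∀ θ : ℝ, 0 < θ →
    θ ≤ 1 → ∃ C, 0 ≤ C ∧ ∀ k, q (v k) ≤ C * (k ! * θ ^ k)) : EntireGrowth 𝕂 v := by
  intro q hq θ hθ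
  obtain ⟨C, hC, hv⟩ := h q hq (min (θ / 2) 1) (by positivity) (min_le_right _ _)
  refine ⟨C, hC, fun k j => (hv _).trans ?_⟩
  have h1 : (min (θ / 2) 1) ^ (k + j) ≤ (θ / 2) ^ (k + j) :=
    pow_le_pow_left₀ (by positivity) (min_le_left _ _) _
  have h2 : ((k + j)! : ℝ) ≤ 2 ^ (k + j) * (k ! * j !) := by
    have : (k + j)! ≤ 2 ^ (k + j) * (k ! * j !) := by
      rw [← Nat.add_choose_mul_factorial_mul_factorial k j, mul_assoc]
      exact Nat.mul_le_mul_right _ (Nat.choose_le_two_pow _ _)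
    exact_mod_cast this
  calc C * (((k + j)! : ℝ) * (min (θ / 2) 1) ^ (k + j))
      ≤ C * ((2 ^ (k + j) * (k ! * j !)) * (θ / 2) ^ (k + j)) :=
        mul_le_mul_of_nonneg_left (mul_le_mul h2 h1 (by positivity) (by positivity)) hC
    _ = C * (k ! * θ ^ k) * (j ! * θ ^ j) := by
        rw [div_pow]
        field_simp
        ring

theorem EntireGrowth.shift {v : ℕ → F} (hv : EntireGrowth 𝕂 v) (n : ℕ) :
    EntireGrowth 𝕂 fun k => v (n + k) := by
  refine .of_le fun q hq θ hθ _ => ?_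
  obtain ⟨C, hC, h⟩ := hv q hq θ hθ
  exact ⟨C * (n ! * θ ^ n), by positivity, fun k => h n k⟩

theorem EntireGrowth.bound {v : ℕ → F} (hv : EntireGrowth 𝕂 v) {q : Seminorm 𝕂 F}
    (hq : Continuous q) {θ : ℝ} (hθ : 0 < θ) :
    ∃ C, 0 ≤ C ∧ ∀ (k : ℕ) (z : 𝕂), q ((z ^ k / (k ! : 𝕂)) • v k) ≤ C * (‖z‖ * θ) ^ k := by
  obtain ⟨C, hC, h⟩ := hv q hq θ hθ
  refine ⟨C, hC, fun k z => ?_⟩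
  have h0 := h 0 k
  have hk : (0 : ℝ) < k ! := by exact_mod_cast k.factorial_pos
  rw [zero_add, Nat.factorial_zero, pow_zero, Nat.cast_one, mul_one, mul_one] at h0
  rw [map_smul_eq_mul, norm_div, norm_pow, RCLike.norm_natCast, mul_pow]
  calc ‖z‖ ^ k / k ! * q (v k) ≤ ‖z‖ ^ k / k ! * (C * (k ! * θ ^ k)) :=
        mul_le_mul_of_nonneg_left h0 (by positivity)
    _ = C * (‖z‖ ^ k * θ ^ k) := by field_simp

theorem EntireGrowth.summable_seminorm {v : ℕ → F} (hv : EntireGrowth 𝕂 v) (z : 𝕂)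
    {q : Seminorm 𝕂 F} (hq : Continuous q) :
    Summable fun k => q ((z ^ k / (k ! : 𝕂)) • v k) := by
  have hz : (0 : ℝ) < 2 * (‖z‖ + 1) := by positivity
  -- This θ makes the ratio ‖z‖ θ of the dominating geometric series less than 1.
  obtain ⟨C, hC, h⟩ := hv.bound hq (θ := (2 * (‖z‖ + 1))⁻¹) (inv_pos.2 hz)
  refine Summable.of_nonneg_of_le (fun k => apply_nonneg q _) (fun k => h k z)
    ((summable_geometric_of_lt_one (by positivity) ?_).mul_left C)
  rw [← div_eq_mul_inv, div_lt_one hz]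
  linarith [norm_nonneg z]

theorem seminorm_le_of_hasSum {ι : Type*} {u : ι → F} {s : F} (h : HasSum u s) {q : Seminorm 𝕂 F}
    (hq : Continuous q) {b : ι → ℝ} {B : ℝ} (hb : HasSum b B) (hub : ∀ i, q (u i) ≤ b i) :
    q s ≤ B := by
  have h1 : Filter.Tendsto (fun t : Finset ι => q (∑ i ∈ t, u i)) Filter.atTop (𝓝 (q s)) :=
    (hq.tendsto s).comp h
  exact le_of_tendsto_of_tendsto' h1 hb fun t =>
    (seminorm_sum_le q t u).trans (Finset.sum_le_sum fun i _ => hub i)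

end Growth

theorem seminorm_finset_sum_apply {ι : Type*} (s : Finset ι) (p : ι → Seminorm 𝕂 F) (x : F) :
    (∑ i ∈ s, p i) x = ∑ i ∈ s, p i x := by
  induction s using Finset.cons_induction with
  | empty => rfl
  | cons a s ha ih => rw [Finset.sum_cons, Finset.sum_cons, ← ih]; rfl

theorem tendsto_of_seminorm [TopologicalSpace F] [PolynormableSpace 𝕂 F] {α : Type*}
    {u : α → F} {l : Filter α} {y : F}
    (h : ∀ q : Seminorm 𝕂 F, Continuous q → Filter.Tendsto (fun x => q (u x - y)) l (𝓝 0)) :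
    Filter.Tendsto u l (𝓝 y) := by
  rw [(PolynormableSpace.withSeminorms 𝕂 F).tendsto_nhds]
  exact fun q ε hε => (h q.1 q.2).eventually_lt_const hε

variable [UniformSpace F] [IsUniformAddGroup F] [PolynormableSpace 𝕂 F] [CompleteSpace F]

/-- Cauchy's criterion: a basic neighbourhood of zero involves finitely many seminorms, whose sum is
again summable along the family. -/
theorem summable_of_seminorm {ι : Type*} {u : ι → F}
    (h : ∀ q : Seminorm 𝕂 F, Continuous q → Summable fun k => q (u k)) : Summable u := by
  rw [summable_iff_vanishing]
  intro e he
  obtain ⟨⟨I, ε⟩, hε, hI⟩ :=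
    (PolynormableSpace.withSeminorms 𝕂 F).hasBasis_zero_ball.mem_iff.1 he
  have hs : Summable fun k => ∑ q ∈ I, q.1 (u k) := summable_sum fun q _ => h q.1 q.2
  obtain ⟨s, hs⟩ := summable_iff_vanishing.1 hs (Metric.ball 0 ε) (Metric.ball_mem_nhds 0 hε)
  refine ⟨s, fun t ht => hI ?_⟩
  have h1 := hs t ht
  rw [mem_ball_zero_iff, Real.norm_eq_abs] at h1
  rw [Seminorm.mem_ball_zero]
  refine lt_of_le_of_lt ?_ ((le_abs_self _).trans_lt h1)
  refine (seminorm_sum_le _ _ _).trans (Finset.sum_le_sum fun k _ => ?_)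
  have := Seminorm.finset_sup_le_sum
    (fun q : {p : Seminorm 𝕂 F // Continuous p} => q.1) I (u k)
  rwa [seminorm_finset_sum_apply] at this

/-- The sum of the power series `∑ⱼ z ^ j / j! v j`. -/
def expSeries (v : ℕ → F) (z : 𝕂) : F := ∑' j, (z ^ j / (j ! : 𝕂)) • v j

theorem EntireGrowth.hasSum {v : ℕ → F} (hv : EntireGrowth 𝕂 v) (z : 𝕂) :
    HasSum (fun j => (z ^ j / (j ! : 𝕂)) • v j) (expSeries v z) :=
  (summable_of_seminorm (𝕂 := 𝕂) fun _ hq => hv.summable_seminorm z hq).hasSum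

theorem EntireGrowth.hasAbsSum {v : ℕ → F} (hv : EntireGrowth 𝕂 v) (z : 𝕂) :
    HasAbsSum 𝕂 (fun j => (z ^ j / (j ! : 𝕂)) • v j) (expSeries v z) :=
  ⟨fun _ hq => hv.summable_seminorm z hq, hv.hasSum z⟩

/-- The prospective derivatives at z again grow entirely, so an arbitrary centre can be treated like
the centre 0. The parameter η is below θ to control growth in n and small enough that ‖z‖ η ≤ 1/2 to
sum over j. -/
theorem EntireGrowth.expSeries_shift {v : ℕ → F} (hv : EntireGrowth 𝕂 v) (z : 𝕂) :
    EntireGrowth 𝕂 fun n => expSeries (fun k => v (n + k)) z := by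
  refine .of_le fun q hq θ hθ _ => ?_
  set η := min θ (2 * (‖z‖ + 1))⁻¹ with hη
  have hz : (0 : ℝ) < 2 * (‖z‖ + 1) := by positivity
  have hη0 : 0 < η := lt_min hθ (inv_pos.2 hz)
  have hη1 : ‖z‖ * η ≤ 1 / 2 := by
    calc ‖z‖ * η ≤ (‖z‖ + 1) * (2 * (‖z‖ + 1))⁻¹ :=
          mul_le_mul (by linarith) (min_le_right _ _) hη0.le (by positivity)
      _ = 1 / 2 := by field_simp
  obtain ⟨C, hC, h⟩ := hv q hq η hη0
  refine ⟨C * 2, by positivity, fun n => ?_⟩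
  refine seminorm_le_of_hasSum ((hv.shift n).hasSum z) hq
    (b := fun j => C * (n ! * θ ^ n) * (1 / 2) ^ j) (B := C * 2 * (n ! * θ ^ n)) ?_ fun j => ?_
  · have := hasSum_geometric_two.mul_left (C * (n ! * θ ^ n))
    rwa [mul_right_comm] at this
  · have hj : (0 : ℝ) < j ! := by exact_mod_cast j.factorial_pos
    rw [map_smul_eq_mul, norm_div, norm_pow, RCLike.norm_natCast]
    calc ‖z‖ ^ j / j ! * q (v (n + j)) ≤ ‖z‖ ^ j / j ! * (C * (n ! * η ^ n) * (j ! * η ^ j)) :=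
          mul_le_mul_of_nonneg_left (h n j) (by positivity)
      _ = C * (n ! * η ^ n) * (‖z‖ * η) ^ j := by rw [mul_pow]; field_simp
      _ ≤ C * (n ! * θ ^ n) * (1 / 2) ^ j := by
          refine mul_le_mul (mul_le_mul_of_nonneg_left (mul_le_mul_of_nonneg_left
            (pow_le_pow_left₀ hη0.le (min_le_left _ _) _) (by positivity)) hC)
            (pow_le_pow_left₀ (by positivity) hη1 _) (by positivity) (by positivity)

/-- Taylor expansion of the sum of a power series at an arbitrary point. -/
theorem EntireGrowth.expSeries_add [T2Space F] {v : ℕ → F} (hv : EntireGrowth 𝕂 v) (z h : 𝕂) :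
    expSeries (fun n => expSeries (fun k => v (n + k)) z) h = expSeries v (z + h) := by
  have := (PolynormableSpace.withSeminorms 𝕂 F).continuousSMul
  -- The double family is absolutely summable. Its row sums give the expansion at z, and by the
  -- binomial theorem its antidiagonal sums give the series at z + h.
  let w : ℕ × ℕ → F := fun x => (h ^ x.1 / (x.1 ! : 𝕂)) • (z ^ x.2 / (x.2 ! : 𝕂)) • v (x.1 + x.2)
  have hw : Summable w := by
    refine summable_of_seminorm (𝕂 := 𝕂) fun q hq => ?_
    have hz : (0 : ℝ) < 2 * (‖z‖ + ‖h‖ + 1) := by positivity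
    obtain ⟨C, hC, hb⟩ := hv q hq (2 * (‖z‖ + ‖h‖ + 1))⁻¹ (inv_pos.2 hz)
    have hg : ∀ c : 𝕂, ‖c‖ ≤ ‖z‖ + ‖h‖ →
        Summable fun k : ℕ => (‖c‖ * (2 * (‖z‖ + ‖h‖ + 1))⁻¹) ^ k := by
      intro c hc
      refine summable_geometric_of_lt_one (by positivity) ?_
      rw [← div_eq_mul_inv, div_lt_one hz]
      linarith [norm_nonneg z, norm_nonneg h]
    have hs := ((hg h (by linarith [norm_nonneg z])).mul_of_nonneg
      (hg z (by linarith [norm_nonneg h])) (fun k => by positivity)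
      (fun k => by positivity)).mul_left C
    refine Summable.of_nonneg_of_le (fun x => apply_nonneg q _) (fun x => ?_) hs
    obtain ⟨k, j⟩ := x
    have hk : (0 : ℝ) < k ! := by exact_mod_cast k.factorial_pos
    have hj : (0 : ℝ) < j ! := by exact_mod_cast j.factorial_pos
    simp only [w, map_smul_eq_mul, norm_div, norm_pow, RCLike.norm_natCast]
    calc ‖h‖ ^ k / k ! * (‖z‖ ^ j / j ! * q (v (k + j)))
        ≤ ‖h‖ ^ k / k ! * (‖z‖ ^ j / j ! * (C * (k ! * (2 * (‖z‖ + ‖h‖ + 1))⁻¹ ^ k) *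
          (j ! * (2 * (‖z‖ + ‖h‖ + 1))⁻¹ ^ j))) := by
          gcongr
          exact hb k j
      _ = _ := by rw [mul_pow, mul_pow]; field_simp
  have h1 : HasSum (fun n => (h ^ n / (n ! : 𝕂)) • expSeries (fun k => v (n + k)) z)
      (∑' x, w x) :=
    hw.hasSum.prod_fiberwise fun n => ((hv.shift n).hasSum z).const_smul _
  have h2 : HasSum (fun n => ((z + h) ^ n / (n ! : 𝕂)) • v n) (∑' x, w x) := by
    have h3 := (Finset.HasAntidiagonal.sigmaAntidiagonalEquivProd (A := ℕ)).hasSum_iff.2 hw.hasSum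
    refine h3.sigma fun n => ?_
    have h4 := (Finset.HasAntidiagonal.antidiagonal n).hasSum w
    have h5 : ∑ x ∈ Finset.HasAntidiagonal.antidiagonal n, w x = ((z + h) ^ n / (n ! : 𝕂)) • v n := by
      rw [add_comm z h, (Commute.all h z).add_pow', Finset.sum_div, Finset.sum_smul]
      refine Finset.sum_congr rfl fun x hx => ?_
      obtain ⟨k, j⟩ := x
      rw [Finset.HasAntidiagonal.mem_antidiagonal] at hx
      dsimp only at hx
      subst hx
      simp only [w, smul_smul]
      congr 1
      have hk : (k ! : 𝕂) ≠ 0 := Nat.cast_ne_zero.2 k.factorial_ne_zero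
      have hj : (j ! : 𝕂) ≠ 0 := Nat.cast_ne_zero.2 j.factorial_ne_zero
      have hkj : ((k + j)! : 𝕂) ≠ 0 := Nat.cast_ne_zero.2 (k + j).factorial_ne_zero
      have hc : ((k + j).choose k : 𝕂) * k ! * j ! = (k + j)! := by
        have := Nat.choose_mul_factorial_mul_factorial (Nat.le_add_right k j)
        rw [Nat.add_sub_cancel_left] at this
        exact_mod_cast this
      rw [nsmul_eq_mul]
      field_simp
      rw [← hc]
      ring
    rw [h5] at h4
    exact h4
  exact ((hv.expSeries_shift z).hasSum h).unique h1 |>.trans (h2.unique (hv.hasSum (z + h)))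

/-- Tails of a geometric series with ratio at most 1/2. The first-order bound is for joint
continuity, the second-order bound for differentiability. -/
theorem EntireGrowth.seminorm_expSeries_sub_le {v : ℕ → F} (hv : EntireGrowth 𝕂 v)
    {q : Seminorm 𝕂 F} (hq : Continuous q) :
    ∃ C, 0 ≤ C ∧ ∀ h : 𝕂, ‖h‖ ≤ 1 → q (expSeries v h - v 0) ≤ C * ‖h‖ ∧
      q (expSeries v h - v 0 - h • v 1) ≤ C * ‖h‖ ^ 2 := by
  obtain ⟨C, hC, hb⟩ := hv.bound hq (θ := 1 / 2) (by norm_num)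
  have hg : ∀ (m : ℕ) (h : 𝕂), ‖h‖ ≤ 1 → ∀ k : ℕ,
      q ((h ^ (k + m) / ((k + m)! : 𝕂)) • v (k + m)) ≤ C * ‖h‖ ^ m * (1 / 2) ^ k := by
    intro m h hh k
    refine (hb (k + m) h).trans ?_
    rw [mul_pow, mul_assoc]
    refine mul_le_mul_of_nonneg_left ?_ hC
    refine mul_le_mul (pow_le_pow_of_le_one (norm_nonneg h) hh (Nat.le_add_left m k))
      (pow_le_pow_of_le_one (by norm_num) (by norm_num) (Nat.le_add_right k m))
      (by positivity) (by positivity)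
  have hs : ∀ (m : ℕ) (h : 𝕂), HasSum (fun k : ℕ => C * ‖h‖ ^ m * (1 / 2 : ℝ) ^ k)
      (C * 2 * ‖h‖ ^ m) := by
    intro m h
    have := hasSum_geometric_two.mul_left (C * ‖h‖ ^ m)
    rwa [mul_right_comm] at this
  refine ⟨C * 2, by positivity, fun h hh => ⟨?_, ?_⟩⟩
  · have h1 := (hasSum_nat_add_iff' 1).2 (hv.hasSum h)
    have h2 := seminorm_le_of_hasSum h1 hq (hs 1 h) (hg 1 h hh)
    simpa using h2
  · have h1 := (hasSum_nat_add_iff' 2).2 (hv.hasSum h)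
    have h2 := seminorm_le_of_hasSum h1 hq (hs 2 h) (hg 2 h hh)
    simpa [Finset.sum_range_succ, sub_sub] using h2

theorem EntireGrowth.tendsto_slope {v : ℕ → F} (hv : EntireGrowth 𝕂 v) :
    Filter.Tendsto (fun h : 𝕂 => h⁻¹ • (expSeries v h - v 0)) (𝓝[≠] 0) (𝓝 (v 1)) := by
  refine tendsto_of_seminorm (𝕂 := 𝕂) fun q hq => ?_
  obtain ⟨C, hC, hb⟩ := hv.seminorm_expSeries_sub_le hq
  have hlim : Filter.Tendsto (fun h : 𝕂 => C * ‖h‖) (𝓝[≠] 0) (𝓝 0) := by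
    have : Filter.Tendsto (fun h : 𝕂 => C * ‖h‖) (𝓝 0) (𝓝 (C * ‖(0 : 𝕂)‖)) :=
      Continuous.tendsto (by fun_prop) 0
    rw [norm_zero, mul_zero] at this
    exact this.mono_left nhdsWithin_le_nhds
  refine squeeze_zero' (Filter.Eventually.of_forall fun h => apply_nonneg q _) ?_ hlim
  have h1 : ∀ᶠ h : 𝕂 in 𝓝[≠] 0, ‖h‖ ≤ 1 :=
    nhdsWithin_le_nhds <| Filter.mem_of_superset (Metric.closedBall_mem_nhds (0 : 𝕂) one_pos)
      fun h hh => by simpa using hh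
  filter_upwards [self_mem_nhdsWithin, h1] with h hne hh
  have hne' : h ≠ 0 := hne
  have hn : 0 < ‖h‖ := norm_pos_iff.2 hne'
  have : h⁻¹ • (expSeries v h - v 0) - v 1 = h⁻¹ • (expSeries v h - v 0 - h • v 1) := by
    rw [smul_sub h⁻¹ (expSeries v h - v 0), smul_smul, inv_mul_cancel₀ hne', one_smul]
  rw [this, map_smul_eq_mul, norm_inv, inv_mul_le_iff₀ hn]
  exact ((hb h hh).2).trans_eq (by ring)

/-- The k-th derivative is the series of the sequence shifted by k. Re-expansion at z or z₀ reduces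
the difference quotient and the Taylor series to the centre 0. -/
theorem EntireGrowth.isEntireWithDerivs [T2Space F] {v : ℕ → F} (hv : EntireGrowth 𝕂 v) :
    IsEntireWithDerivs fun k (z : 𝕂) => expSeries (fun j => v (k + j)) z := by
  refine ⟨fun k z => ?_, fun z₀ z => ?_⟩
  · have h1 := ((hv.shift k).expSeries_shift z).tendsto_slope
    have h2 : ∀ h, expSeries (fun n => expSeries (fun j => v (k + (n + j))) z) h =
        expSeries (fun j => v (k + j)) (z + h) := (hv.shift k).expSeries_add z
    simpa only [h2, zero_add, add_assoc] using h1
  · have h1 := (hv.expSeries_shift z₀).hasAbsSum (z - z₀)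
    rw [hv.expSeries_add, add_sub_cancel] at h1
    simpa using h1

omit [IsUniformAddGroup F] [PolynormableSpace 𝕂 F] [CompleteSpace F] in
theorem expSeries_zero (v : ℕ → F) : expSeries v (0 : 𝕂) = v 0 := by
  rw [expSeries, tsum_eq_single 0]
  · simp
  · intro k hk
    simp [hk]

end EntireSeries

/-! ### Series of bilinear maps: bilinearity and joint continuity -/

section BilinearSeries

variable {𝕂 : Type*} [RCLike 𝕂] {F : Type*} [AddCommGroup F] [Module 𝕂 F]

/-- The bilinear maps `u k` satisfy, in every continuous seminorm, a common estimate with constant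
`k! θ ^ k`, for all `θ > 0`. -/
def BilinearGrowth [TopologicalSpace F] (u : ℕ → F →ₗ[𝕂] F →ₗ[𝕂] F) : Prop :=
  ∀ q : Seminorm 𝕂 F, Continuous q → ∀ θ : ℝ, 0 < θ → θ ≤ 1 →
    ∃ q' : Seminorm 𝕂 F, Continuous q' ∧
      ∀ k a b, q (u k a b) ≤ k ! * θ ^ k * q' a * q' b

variable {u : ℕ → F →ₗ[𝕂] F →ₗ[𝕂] F}

theorem BilinearGrowth.entireGrowth [TopologicalSpace F] (hu : BilinearGrowth u) (a b : F) :
    EntireGrowth 𝕂 fun k => u k a b := by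
  refine .of_le fun q hq θ hθ hθ1 => ?_
  obtain ⟨q', -, h⟩ := hu q hq θ hθ hθ1
  exact ⟨q' a * q' b, mul_nonneg (apply_nonneg _ _) (apply_nonneg _ _), fun k =>
    (h k a b).trans_eq (by ring)⟩

variable [UniformSpace F] [IsUniformAddGroup F] [PolynormableSpace 𝕂 F] [CompleteSpace F]
  [T2Space F]

/-- The sum `∑ₖ z ^ k / k! u k a b`. -/
def bilinearSeries (u : ℕ → F →ₗ[𝕂] F →ₗ[𝕂] F) (z : 𝕂) (a b : F) : F :=
  expSeries (fun k => u k a b) z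

theorem BilinearGrowth.add_left (hu : BilinearGrowth u) (z : 𝕂) (a a' b : F) :
    bilinearSeries u z (a + a') b = bilinearSeries u z a b + bilinearSeries u z a' b := by
  refine ((hu.entireGrowth (a + a') b).hasSum z).unique ?_
  simpa [bilinearSeries] using
    ((hu.entireGrowth a b).hasSum z).add ((hu.entireGrowth a' b).hasSum z)

theorem BilinearGrowth.add_right (hu : BilinearGrowth u) (z : 𝕂) (a b b' : F) :
    bilinearSeries u z a (b + b') = bilinearSeries u z a b + bilinearSeries u z a b' := by
  refine ((hu.entireGrowth a (b + b')).hasSum z).unique ?_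
  simpa [bilinearSeries] using
    ((hu.entireGrowth a b).hasSum z).add ((hu.entireGrowth a b').hasSum z)

theorem BilinearGrowth.smul_left (hu : BilinearGrowth u) (z s : 𝕂) (a b : F) :
    bilinearSeries u z (s • a) b = s • bilinearSeries u z a b := by
  have := (PolynormableSpace.withSeminorms 𝕂 F).continuousSMul
  refine ((hu.entireGrowth (s • a) b).hasSum z).unique ?_
  simpa [bilinearSeries, smul_comm s] using ((hu.entireGrowth a b).hasSum z).const_smul s

theorem BilinearGrowth.smul_right (hu : BilinearGrowth u) (z s : 𝕂) (a b : F) :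
    bilinearSeries u z a (s • b) = s • bilinearSeries u z a b := by
  have := (PolynormableSpace.withSeminorms 𝕂 F).continuousSMul
  refine ((hu.entireGrowth a (s • b)).hasSum z).unique ?_
  simpa [bilinearSeries, smul_comm s] using ((hu.entireGrowth a b).hasSum z).const_smul s

-- Choosing θ with Z θ ≤ 1/2 gives one seminorm for all z in the disc; the 2 is the sum of the
-- geometric series.
omit [T2Space F] in
theorem BilinearGrowth.seminorm_le (hu : BilinearGrowth u) {q : Seminorm 𝕂 F} (hq : Continuous q)
    (Z : ℝ) : ∃ q' : Seminorm 𝕂 F, Continuous q' ∧ ∀ z : 𝕂, ‖z‖ ≤ Z → ∀ a b,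
      q (bilinearSeries u z a b) ≤ 2 * q' a * q' b := by
  have hZ : (0 : ℝ) < 2 * (|Z| + 1) := by positivity
  obtain ⟨q', hq', h⟩ := hu q hq (2 * (|Z| + 1))⁻¹ (inv_pos.2 hZ)
    (inv_le_one_of_one_le₀ (by linarith [abs_nonneg Z]))
  refine ⟨q', hq', fun z hz a b => ?_⟩
  have h0 : 0 ≤ q' a * q' b := mul_nonneg (apply_nonneg _ _) (apply_nonneg _ _)
  refine seminorm_le_of_hasSum ((hu.entireGrowth a b).hasSum z) hq
    (b := fun k => q' a * q' b * (1 / 2) ^ k) ?_ fun k => ?_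
  · have := hasSum_geometric_two.mul_left (q' a * q' b)
    rwa [mul_comm _ (2 : ℝ), ← mul_assoc] at this
  · have hk : (0 : ℝ) < k ! := by exact_mod_cast k.factorial_pos
    have hz1 : ‖z‖ * (2 * (|Z| + 1))⁻¹ ≤ 1 / 2 := by
      rw [← div_eq_mul_inv, div_le_iff₀ hZ]
      linarith [le_abs_self Z]
    rw [map_smul_eq_mul, norm_div, norm_pow, RCLike.norm_natCast]
    calc ‖z‖ ^ k / k ! * q (u k a b)
        ≤ ‖z‖ ^ k / k ! * (k ! * (2 * (|Z| + 1))⁻¹ ^ k * q' a * q' b) :=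
          mul_le_mul_of_nonneg_left (h k a b) (by positivity)
      _ = q' a * q' b * (‖z‖ * (2 * (|Z| + 1))⁻¹) ^ k := by rw [mul_pow]; field_simp
      _ ≤ _ := mul_le_mul_of_nonneg_left (pow_le_pow_left₀ (by positivity) hz1 k) h0

theorem BilinearGrowth.continuous (hu : BilinearGrowth u) :
    Continuous fun x : 𝕂 × F × F => bilinearSeries u x.1 x.2.1 x.2.2 := by
  rw [continuous_iff_continuousAt]
  rintro ⟨z₀, a₀, b₀⟩
  refine tendsto_of_seminorm (𝕂 := 𝕂) fun q hq => ?_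
  obtain ⟨q', hq', hb⟩ := hu.seminorm_le hq (‖z₀‖ + 1)
  obtain ⟨C, hC, hz⟩ :=
    ((hu.entireGrowth a₀ b₀).expSeries_shift z₀).seminorm_expSeries_sub_le hq
  have hlim : Filter.Tendsto (fun x : 𝕂 × F × F =>
      2 * q' (x.2.1 - a₀) * q' x.2.2 + 2 * q' a₀ * q' (x.2.2 - b₀) + C * ‖x.1 - z₀‖)
      (𝓝 (z₀, a₀, b₀)) (𝓝 0) := by
    have hc : Continuous fun x : 𝕂 × F × F =>
        2 * q' (x.2.1 - a₀) * q' x.2.2 + 2 * q' a₀ * q' (x.2.2 - b₀) + C * ‖x.1 - z₀‖ := by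
      fun_prop
    simpa using hc.tendsto (z₀, a₀, b₀)
  refine squeeze_zero' (Filter.Eventually.of_forall fun h => apply_nonneg q _) ?_ hlim
  have hnear : ∀ᶠ x : 𝕂 × F × F in 𝓝 (z₀, a₀, b₀), ‖x.1 - z₀‖ ≤ 1 := by
    have : Continuous fun x : 𝕂 × F × F => ‖x.1 - z₀‖ := by fun_prop
    have h := this.tendsto (z₀, a₀, b₀)
    simp only [sub_self, norm_zero] at h
    exact h.eventually_le_const one_pos
  filter_upwards [hnear] with x hx
  obtain ⟨z, a, b⟩ := x
  dsimp only at hx ⊢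
  have hzn : ‖z‖ ≤ ‖z₀‖ + 1 := by
    calc ‖z‖ = ‖z₀ + (z - z₀)‖ := by rw [add_sub_cancel]
      _ ≤ ‖z₀‖ + ‖z - z₀‖ := norm_add_le _ _
      _ ≤ _ := by linarith
  -- The increments in a and b are controlled uniformly in z near z₀, and the increment in z at
  -- fixed a₀, b₀ by the Taylor expansion at z₀.
  have hsplit : bilinearSeries u z a b - bilinearSeries u z₀ a₀ b₀ =
      bilinearSeries u z (a - a₀) b + bilinearSeries u z a₀ (b - b₀) +
        (bilinearSeries u z a₀ b₀ - bilinearSeries u z₀ a₀ b₀) := by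
    have h1 := hu.add_left z (a - a₀) a₀ b
    have h2 := hu.add_right z a₀ (b - b₀) b₀
    rw [sub_add_cancel] at h1 h2
    rw [h1, h2]
    abel
  have hlast : q (bilinearSeries u z a₀ b₀ - bilinearSeries u z₀ a₀ b₀) ≤ C * ‖z - z₀‖ := by
    have := (hz (z - z₀) hx).1
    rw [(hu.entireGrowth a₀ b₀).expSeries_add, add_sub_cancel] at this
    simpa [bilinearSeries] using this
  rw [hsplit]
  exact (map_add_le_add q _ _).trans (add_le_add ((map_add_le_add q _ _).trans
    (add_le_add (hb z hzn _ _) (hb z hzn _ _))) hlast)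

theorem BilinearGrowth.continuous_bilinearSeries (hu : BilinearGrowth u) (z : 𝕂) :
    Continuous fun x : F × F => bilinearSeries u z x.1 x.2 :=
  hu.continuous.comp (Continuous.prodMk_right z)

end BilinearSeries

end GradedWeyl

end

noncomputable section

namespace GradedWeyl

/-! ### Seminorms and bilinear maps on completions -/

section Completion

open UniformSpace

variable {𝕂 : Type*} [RCLike 𝕂] {W : Type*} [AddCommGroup W] [Module 𝕂 W] [UniformSpace W]
  [IsUniformAddGroup W] [UniformContinuousConstSMul 𝕂 W]

omit [UniformContinuousConstSMul 𝕂 W] in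
theorem seminorm_uniformContinuous {q : Seminorm 𝕂 W} (hq : Continuous q) :
    UniformContinuous q :=
  Seminorm.uniformContinuous_of_continuousAt_zero hq.continuousAt

/-- The extension of a continuous seminorm to the completion. -/
def completionSeminorm (q : Seminorm 𝕂 W) (hq : Continuous q) : Seminorm 𝕂 (Completion W) :=
  Seminorm.of (Completion.extension q)
    (fun x y => by
      induction x, y using Completion.induction_on₂ with
      | hp =>
        exact isClosed_le (Completion.continuous_extension.comp continuous_add)
          ((Completion.continuous_extension.comp continuous_fst).add
            (Completion.continuous_extension.comp continuous_snd))
      | ih x y =>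
        rw [← Completion.coe_add]
        simp only [Completion.extension_coe (seminorm_uniformContinuous hq)]
        exact map_add_le_add q x y)
    (fun c x => by
      induction x using Completion.induction_on with
      | hp =>
        exact isClosed_eq (Completion.continuous_extension.comp (continuous_const_smul c))
          (continuous_const.mul Completion.continuous_extension)
      | ih x =>
        rw [← Completion.coe_smul]
        simp only [Completion.extension_coe (seminorm_uniformContinuous hq)]
        exact map_smul_eq_mul q c x)

theorem completionSeminorm_coe {q : Seminorm 𝕂 W} (hq : Continuous q) (x : W) :
    completionSeminorm q hq x = q x :=
  Completion.extension_coe (seminorm_uniformContinuous hq) x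

theorem continuous_completionSeminorm {q : Seminorm 𝕂 W} (hq : Continuous q) :
    Continuous (completionSeminorm q hq) :=
  Completion.continuous_extension

variable (𝕂 W) in
/-- The canonical map into the completion, as a linear map. -/
def completionMap : W →ₗ[𝕂] Completion W where
  toFun := (↑)
  map_add' := Completion.coe_add
  map_smul' := Completion.coe_smul

-- A continuous bilinear map need not be uniformly continuous, so the extension uses biadditivity
-- through `IsDenseInducing.extend_Z_bilin`.
omit [UniformContinuousConstSMul 𝕂 W] in
theorem continuous_extend_bilin (B : W →ₗ[𝕂] W →ₗ[𝕂] W)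
    (hB : Continuous fun x : W × W => B x.1 x.2) :
    Continuous ((Completion.isDenseInducing_coe.prodMap Completion.isDenseInducing_coe).extend
      fun x : W × W => (B x.1 x.2 : Completion W)) := by
  obtain ⟨C, hC⟩ : ∃ C : W →+ W →+ Completion W, ∀ a b, C a b = (B a b : Completion W) :=
    ⟨AddMonoidHom.mk' (fun a => Completion.toCompl.comp (B a).toAddMonoidHom) fun a b => by
      ext c
      change (B (a + b) c : Completion W) = (B a c : Completion W) + (B b c : Completion W)
      rw [← Completion.coe_add, map_add, LinearMap.add_apply], fun _ _ => rfl⟩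
  have hC' : Continuous fun x : W × W => C x.1 x.2 := by
    simp only [hC]
    exact (Completion.continuous_coe W).comp hB
  have := IsDenseInducing.extend_Z_bilin (Completion.isDenseInducing_toCompl W)
    (Completion.isDenseInducing_toCompl W) hC'
  simp only [← hC]
  exact this

omit [UniformContinuousConstSMul 𝕂 W] [Module 𝕂 W] [IsUniformAddGroup W] [AddCommGroup W] in
theorem extend_eq_of_continuous {f : W → W → Completion W}
    {g : Completion W → Completion W → Completion W}
    (hg : Continuous fun x : Completion W × Completion W => g x.1 x.2)
    (h : ∀ a b : W, g a b = f a b) (a b : Completion W) :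
    (Completion.isDenseInducing_coe.prodMap Completion.isDenseInducing_coe).extend
      (fun x : W × W => f x.1 x.2) (a, b) = g a b :=
  congrFun ((Completion.isDenseInducing_coe.prodMap Completion.isDenseInducing_coe).extend_unique
    (fun x : W × W => h x.1 x.2) hg) (a, b)

/-- A closed neighbourhood A of zero pulls back to one containing a seminorm ball of W. The open set
where the extended seminorm Q is below ε lies in the closure of its points from W, hence in A. -/
theorem completion_polynormableSpace [PolynormableSpace 𝕂 W] :
    PolynormableSpace 𝕂 (Completion W) where
  withSeminorms' := by
    rw [SeminormFamily.withSeminorms_iff_nhds_eq_iInf]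
    refine le_antisymm (le_iInf fun q => ?_) fun U hU => ?_
    · rw [← Filter.tendsto_iff_comap]
      simpa using q.2.tendsto 0
    · obtain ⟨A, hA, hAc, hAU⟩ := exists_mem_nhds_isClosed_subset hU
      have h1 : ((↑) : W → Completion W) ⁻¹' A ∈ 𝓝 (0 : W) :=
        (Completion.continuous_coe W).continuousAt.preimage_mem_nhds
          (by rwa [Completion.coe_zero])
      obtain ⟨⟨I, ε⟩, hε, hI⟩ :=
        (PolynormableSpace.withSeminorms 𝕂 W).hasBasis_zero_ball.mem_iff.1 h1
      dsimp only at hε hI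
      have hsup : Continuous (∑ q ∈ I, q.1 : Seminorm 𝕂 W) := by
        have : ⇑(∑ q ∈ I, q.1 : Seminorm 𝕂 W) = fun x => ∑ q ∈ I, q.1 x :=
          funext fun x => seminorm_finset_sum_apply I _ x
        rw [this]
        exact continuous_finsetSum I fun q _ => q.2
      let Q := completionSeminorm (∑ q ∈ I, q.1 : Seminorm 𝕂 W) hsup
      have hQ : Continuous Q := continuous_completionSeminorm hsup
      have hsub : {x | Q x < ε} ⊆ U := by
        refine fun x hx => hAU ?_
        have hopen : IsOpen {x | Q x < ε} := isOpen_lt hQ continuous_const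
        have h2 : {x | Q x < ε} ⊆ closure ({x | Q x < ε} ∩ Set.range ((↑) : W → Completion W)) :=
          Completion.denseRange_coe.open_subset_closure_inter hopen
        refine closure_minimal ?_ hAc (h2 hx)
        rintro _ ⟨hy, y, rfl⟩
        refine hI ?_
        rw [Seminorm.mem_ball_zero]
        refine lt_of_le_of_lt (Seminorm.finset_sup_le_sum _ I y) ?_
        have hy' : Q y < ε := hy
        rwa [completionSeminorm_coe] at hy'
      refine Filter.mem_of_superset ?_ hsub
      exact Filter.mem_iInf_of_mem
        (i := (⟨Q, hQ⟩ : {p : Seminorm 𝕂 (Completion W) // Continuous p}))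
        ⟨Set.Iio ε, Iio_mem_nhds hε, fun x hx => hx⟩

variable {F : Type*} [AddCommGroup F] [Module 𝕂 F]

theorem continuous_of_bilinear_seminorm_le [TopologicalSpace F] [PolynormableSpace 𝕂 F]
    {B : F →ₗ[𝕂] F →ₗ[𝕂] F}
    (hB : ∀ q : Seminorm 𝕂 F, Continuous q → ∃ q' : Seminorm 𝕂 F, Continuous q' ∧
      ∀ a b, q (B a b) ≤ q' a * q' b) :
    Continuous fun x : F × F => B x.1 x.2 := by
  have := (PolynormableSpace.withSeminorms 𝕂 F).topologicalAddGroup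
  rw [continuous_iff_continuousAt]
  rintro ⟨a₀, b₀⟩
  refine tendsto_of_seminorm (𝕂 := 𝕂) (F := F) fun q hq => ?_
  obtain ⟨q', hq', h⟩ := hB q hq
  have hc : Continuous fun x : F × F => q' (x.1 - a₀) * q' x.2 + q' a₀ * q' (x.2 - b₀) := by
    fun_prop
  have hlim := hc.tendsto (a₀, b₀)
  simp only [sub_self, map_zero, zero_mul, mul_zero, add_zero] at hlim
  refine squeeze_zero (fun _ => apply_nonneg q _) (fun x => ?_) hlim
  have : B x.1 x.2 - B a₀ b₀ = B (x.1 - a₀) x.2 + B a₀ (x.2 - b₀) := by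
    rw [map_sub, map_sub, LinearMap.sub_apply]; abel
  rw [this]
  exact (map_add_le_add q _ _).trans (add_le_add (h _ _) (h _ _))

theorem BilinearGrowth.continuous_apply [TopologicalSpace F] [PolynormableSpace 𝕂 F]
    {u : ℕ → F →ₗ[𝕂] F →ₗ[𝕂] F} (hu : BilinearGrowth u) (k : ℕ) :
    Continuous fun x : F × F => u k x.1 x.2 := by
  refine continuous_of_bilinear_seminorm_le fun q hq => ?_
  obtain ⟨q', hq', h⟩ := hu q hq 1 one_pos le_rfl
  have hk : (1 : ℝ) ≤ k ! := by exact_mod_cast k.factorial_pos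
  -- The factor is put on both arguments, which gives (k!)² ≥ k!.
  refine ⟨(k ! : NNReal) • q', hq'.const_smul _, fun a b => (h k a b).trans ?_⟩
  have hs : ∀ c, ((k ! : NNReal) • q') c = k ! * q' c := fun _ => rfl
  rw [hs, hs, one_pow, mul_one]
  have h0 : 0 ≤ k ! * q' a * q' b :=
    mul_nonneg (mul_nonneg (by positivity) (apply_nonneg _ _)) (apply_nonneg _ _)
  calc k ! * q' a * q' b ≤ k ! * (k ! * q' a * q' b) := le_mul_of_one_le_left h0 hk
    _ = _ := by ring

/-- It suffices to verify the growth condition on a family of seminorms that defines the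
topology. -/
theorem BilinearGrowth.of_withSeminorms [TopologicalSpace F] {ι : Type*} [Nonempty ι]
    {P : SeminormFamily 𝕂 F ι} (hP : WithSeminorms P) {u : ℕ → F →ₗ[𝕂] F →ₗ[𝕂] F}
    (h : ∀ i, ∀ θ : ℝ, 0 < θ → θ ≤ 1 → ∃ j, ∀ k a b,
      P i (u k a b) ≤ k ! * θ ^ k * P j a * P j b) : BilinearGrowth u := by
  intro q hq θ hθ hθ1
  obtain ⟨s, C, -, hC⟩ := Seminorm.bound_of_continuous hP q hq
  choose j hj using fun i => h i θ hθ hθ1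
  let S : Seminorm 𝕂 F := ∑ i ∈ s, P (j i)
  have hS : ∀ x, S x = ∑ i ∈ s, P (j i) x := fun x => seminorm_finset_sum_apply s _ x
  have hSc : Continuous S := by
    rw [show ⇑S = fun x => ∑ i ∈ s, P (j i) x from funext hS]
    exact continuous_finsetSum s fun i _ => hP.continuous_seminorm (j i)
  -- C + 1 rather than C, because the constant enters squared and C ≤ (C + 1)² always holds.
  refine ⟨(C + 1) • S, hSc.const_smul _, fun k a b => ?_⟩
  have hs : ∀ x, ((C + 1) • S) x = (C + 1) * S x := fun _ => rfl
  have h1 : q (u k a b) ≤ C * ∑ i ∈ s, P i (u k a b) := by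
    refine (hC _).trans ?_
    change (C : ℝ) * (s.sup P) (u k a b) ≤ _
    refine mul_le_mul_of_nonneg_left ?_ C.2
    rw [← seminorm_finset_sum_apply]
    exact Seminorm.finset_sup_le_sum P s _
  have h2 : ∑ i ∈ s, P i (u k a b) ≤ k ! * θ ^ k * S a * S b := by
    rw [hS b, Finset.mul_sum]
    refine Finset.sum_le_sum fun i hi => (hj i k a b).trans ?_
    refine mul_le_mul_of_nonneg_right (mul_le_mul_of_nonneg_left ?_ (by positivity))
      (apply_nonneg _ _)
    rw [hS]
    exact Finset.single_le_sum (f := fun i => P (j i) a) (fun i _ => apply_nonneg _ _) hi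
  have hX : 0 ≤ k ! * θ ^ k * S a * S b :=
    mul_nonneg (mul_nonneg (by positivity) (apply_nonneg _ _)) (apply_nonneg _ _)
  have hC0 : (0 : ℝ) ≤ C := C.2
  rw [hs, hs]
  calc q (u k a b) ≤ C * (k ! * θ ^ k * S a * S b) :=
        h1.trans (mul_le_mul_of_nonneg_left h2 C.2)
    _ ≤ ((C + 1) * (C + 1)) * (k ! * θ ^ k * S a * S b) :=
        mul_le_mul_of_nonneg_right (by nlinarith) hX
    _ = _ := by ring

end Completion

/-! ### The star product on the completed Weyl algebra -/

section WeylCompletion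

open UniformSpace

variable {𝕂 : Type*} [RCLike 𝕂] {V : Type*} [AddCommGroup V] [Module 𝕂 V] [TopologicalSpace V]
  {𝒱 : ZMod 2 → Submodule 𝕂 V} [DirectSum.Decomposition 𝒱] {E : Set ℝ}

instance : PolynormableSpace 𝕂 (Weyl 𝒱 E) := (weyl_withSeminorms 𝒱 E).toPolynormableSpace

instance : PolynormableSpace 𝕂 (CWeyl 𝒱 E) := completion_polynormableSpace

theorem extend₂_coe {f : Weyl 𝒱 E → Weyl 𝒱 E → Weyl 𝒱 E}
    (hf : Continuous fun x : Weyl 𝒱 E × Weyl 𝒱 E => f x.1 x.2) (a b : Weyl 𝒱 E) :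
    extend₂ f a b = (f a b : CWeyl 𝒱 E) :=
  (Completion.isDenseInducing_coe.prodMap Completion.isDenseInducing_coe).extend_eq
    (f := fun x : Weyl 𝒱 E × Weyl 𝒱 E => (f x.1 x.2 : CWeyl 𝒱 E))
    ((Completion.continuous_coe _).comp hf) (a, b)

theorem continuous_extend₂ {B : Weyl 𝒱 E →ₗ[𝕂] Weyl 𝒱 E →ₗ[𝕂] Weyl 𝒱 E}
    (hB : Continuous fun x : Weyl 𝒱 E × Weyl 𝒱 E => B x.1 x.2) :
    Continuous fun x : CWeyl 𝒱 E × CWeyl 𝒱 E => extend₂ (fun a b => B a b) x.1 x.2 :=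
  continuous_extend_bilin B hB

/-- The extension of a continuous bilinear map to the completion, as a bilinear map. -/
def extendBilin (B : Weyl 𝒱 E →ₗ[𝕂] Weyl 𝒱 E →ₗ[𝕂] Weyl 𝒱 E)
    (hB : Continuous fun x : Weyl 𝒱 E × Weyl 𝒱 E => B x.1 x.2) :
    CWeyl 𝒱 E →ₗ[𝕂] CWeyl 𝒱 E →ₗ[𝕂] CWeyl 𝒱 E :=
  have hc := continuous_extend₂ hB
  have hv : ∀ a b : Weyl 𝒱 E, extend₂ (fun a b => B a b) a b = (B a b : CWeyl 𝒱 E) :=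
    extend₂_coe (f := fun a b => B a b) hB
  have hco : ∀ {X : Type _} [TopologicalSpace X] {f g : X → CWeyl 𝒱 E}, Continuous f →
      Continuous g → Continuous fun x => extend₂ (fun a b => B a b) (f x) (g x) :=
    fun hf hg => hc.comp (hf.prodMk hg)
  LinearMap.mk₂ 𝕂 (extend₂ fun a b => B a b)
    (fun a a' b => by
      induction a, a', b using Completion.induction_on₃ with
      | hp =>
        exact isClosed_eq (hco (by fun_prop) (by fun_prop))
          ((hco (by fun_prop) (by fun_prop)).add (hco (by fun_prop) (by fun_prop)))
      | ih a a' b =>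
        rw [← Completion.coe_add, hv, hv, hv, map_add, LinearMap.add_apply, Completion.coe_add])
    (fun c a b => by
      induction a, b using Completion.induction_on₂ with
      | hp =>
        exact isClosed_eq (hco (continuous_fst.const_smul c) continuous_snd)
          ((hco continuous_fst continuous_snd).const_smul c)
      | ih a b =>
        rw [← Completion.coe_smul, hv, hv, map_smul, LinearMap.smul_apply, Completion.coe_smul])
    (fun a b b' => by
      induction a, b, b' using Completion.induction_on₃ with
      | hp =>
        exact isClosed_eq (hco (by fun_prop) (by fun_prop))
          ((hco (by fun_prop) (by fun_prop)).add (hco (by fun_prop) (by fun_prop)))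
      | ih a b b' =>
        rw [← Completion.coe_add, hv, hv, hv, map_add, Completion.coe_add])
    (fun c a b => by
      induction a, b using Completion.induction_on₂ with
      | hp =>
        exact isClosed_eq (hco continuous_fst (continuous_snd.const_smul c))
          ((hco continuous_fst continuous_snd).const_smul c)
      | ih a b =>
        rw [← Completion.coe_smul, hv, hv, map_smul, Completion.coe_smul])

/-- For each k both sides of the estimate are continuous in a and b, so it extends from the dense
image of W, with the extended seminorm and the same constants. -/
theorem BilinearGrowth.extendBilin {u : ℕ → Weyl 𝒱 E →ₗ[𝕂] Weyl 𝒱 E →ₗ[𝕂] Weyl 𝒱 E}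
    (hu : BilinearGrowth u) :
    BilinearGrowth fun k => GradedWeyl.extendBilin (u k) (hu.continuous_apply k) := by
  intro q hq θ hθ hθ1
  obtain ⟨q', hq', h⟩ := hu (q.comp (completionMap 𝕂 (Weyl 𝒱 E)) : Seminorm 𝕂 (Weyl 𝒱 E))
    (show Continuous fun x : Weyl 𝒱 E => q (x : CWeyl 𝒱 E) from
      hq.comp (Completion.continuous_coe _)) θ hθ hθ1
  have hQ := continuous_completionSeminorm hq'
  refine ⟨completionSeminorm q' hq', hQ, fun k a b => ?_⟩
  change q (extend₂ (fun a b => u k a b) a b) ≤ _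
  induction a, b using Completion.induction_on₂ with
  | hp =>
    refine isClosed_le (hq.comp (continuous_extend₂ (hu.continuous_apply k))) ?_
    fun_prop
  | ih a b =>
    rw [extend₂_coe (f := fun a b => u k a b) (hu.continuous_apply k), completionSeminorm_coe,
      completionSeminorm_coe]
    exact h k a b

variable (𝒱 E) in
/-- The terms of the star product as bilinear maps. -/
def weylTermBilin (Λ : V →ₗ[𝕂] V →ₗ[𝕂] 𝕂) (k : ℕ) :
    Weyl 𝒱 E →ₗ[𝕂] Weyl 𝒱 E →ₗ[𝕂] Weyl 𝒱 E :=
  LinearMap.compr₂ (TensorProduct.mk 𝕂 (symAlg 𝒱) (symAlg 𝒱))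
    (symMul 𝒱 ∘ₗ (contraction 𝒱 Λ ^ k : Module.End 𝕂 (symAlg 𝒱 ⊗[𝕂] symAlg 𝒱)))

variable {Λ : V →ₗ[𝕂] V →ₗ[𝕂] 𝕂}

theorem bilinearGrowth_weylTerm [PolynormableSpace 𝕂 V] [Nonempty E]
    (h𝒱 : ∀ i, Continuous (parityProj 𝒱 i)) (hΛe : IsEvenForm 𝒱 Λ)
    (hΛ : Continuous fun x : V × V => Λ x.1 x.2)
    (hE : ∀ r ∈ E, ∃ r' ∈ E, r ≤ r' ∧ 1 / 2 ≤ r') : BilinearGrowth (weylTermBilin 𝒱 E Λ) := by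
  have : Nonempty {p : Seminorm 𝕂 V // Continuous p} := ⟨⟨0, continuous_const⟩⟩
  refine .of_withSeminorms (weyl_withSeminorms 𝒱 E) fun i θ hθ hθ1 => ?_
  exact exists_weylSeminorm_starTerm_le h𝒱 hΛe hΛ hE i (θ := ⟨θ, hθ.le⟩) hθ hθ1

/-- On the uncompleted algebra the series is a finite sum, P_Λ being locally nilpotent. -/
theorem hasSum_weylStar (hΛe : IsEvenForm 𝒱 Λ) (z : 𝕂) (a b : Weyl 𝒱 E) :
    HasSum (fun k => (z ^ k / (k ! : 𝕂)) • (weylTerm 𝒱 E Λ k a b : CWeyl 𝒱 E))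
      (weylStar 𝒱 E Λ z a b : CWeyl 𝒱 E) := by
  obtain ⟨N, hN⟩ := exists_contraction_pow_eq_zero 𝒱 hΛe a b
  have h0 : ∀ k ≥ N, weylTerm 𝒱 E Λ k a b = 0 := fun k hk =>
    (congrArg (symMul 𝒱) (hN k hk)).trans (map_zero _)
  have h1 : weylStar 𝒱 E Λ z a b =
      ∑ k ∈ Finset.range N, (z ^ k / (k ! : 𝕂)) • weylTerm 𝒱 E Λ k a b := by
    refine finsum_eq_sum_of_support_subset _ fun k hk => ?_
    by_contra h
    refine hk ?_
    rw [Finset.coe_range, Set.mem_Iio, not_lt] at h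
    exact (congrArg _ (h0 k h)).trans (smul_zero _)
  have h2 : (weylStar 𝒱 E Λ z a b : CWeyl 𝒱 E) =
      ∑ k ∈ Finset.range N, (z ^ k / (k ! : 𝕂)) • (weylTerm 𝒱 E Λ k a b : CWeyl 𝒱 E) := by
    rw [h1]
    exact (map_sum (completionMap 𝕂 (Weyl 𝒱 E)) _ _).trans
      (Finset.sum_congr rfl fun k _ => map_smul (completionMap 𝕂 (Weyl 𝒱 E)) _ _)
  rw [h2]
  refine hasSum_sum_of_ne_finset_zero fun k hk => ?_
  rw [h0 k (by simpa using hk), Completion.coe_zero, smul_zero]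

theorem bilinearSeries_coe (hΛe : IsEvenForm 𝒱 Λ)
    {U : ℕ → CWeyl 𝒱 E →ₗ[𝕂] CWeyl 𝒱 E →ₗ[𝕂] CWeyl 𝒱 E} (hU : BilinearGrowth U)
    (hk : ∀ k (a b : Weyl 𝒱 E), U k a b = (weylTerm 𝒱 E Λ k a b : CWeyl 𝒱 E)) (z : 𝕂)
    (a b : Weyl 𝒱 E) :
    bilinearSeries U z a b = (weylStar 𝒱 E Λ z a b : CWeyl 𝒱 E) := by
  refine (hU.entireGrowth (a : CWeyl 𝒱 E) (b : CWeyl 𝒱 E)).hasSum z |>.unique ?_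
  simp only [hk]
  exact hasSum_weylStar hΛe z a b

/-- The series is jointly continuous and agrees with `weylStar` on the dense image of W, hence is
its extension. Every analytic property of `cStar` is read off from this. -/
theorem cStar_eq_bilinearSeries (hΛe : IsEvenForm 𝒱 Λ)
    {U : ℕ → CWeyl 𝒱 E →ₗ[𝕂] CWeyl 𝒱 E →ₗ[𝕂] CWeyl 𝒱 E} (hU : BilinearGrowth U)
    (hk : ∀ k (a b : Weyl 𝒱 E), U k a b = (weylTerm 𝒱 E Λ k a b : CWeyl 𝒱 E)) (z : 𝕂)
    (a b : CWeyl 𝒱 E) :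
    cStar 𝒱 E Λ z a b = bilinearSeries U z a b :=
  extend_eq_of_continuous (hU.continuous_bilinearSeries z) (bilinearSeries_coe hΛe hU hk z) a b

theorem exists_bilinearGrowth_eq_cTerm (hu : BilinearGrowth (weylTermBilin 𝒱 E Λ)) :
    ∃ U : ℕ → CWeyl 𝒱 E →ₗ[𝕂] CWeyl 𝒱 E →ₗ[𝕂] CWeyl 𝒱 E, BilinearGrowth U ∧
      ∀ k a b, U k a b = cTerm 𝒱 E Λ k a b :=
  ⟨_, hu.extendBilin, fun _ _ _ => rfl⟩

theorem cTerm_coe (hu : BilinearGrowth (weylTermBilin 𝒱 E Λ)) (k : ℕ) (a b : Weyl 𝒱 E) :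
    cTerm 𝒱 E Λ k a b = (weylTerm 𝒱 E Λ k a b : CWeyl 𝒱 E) :=
  extend₂_coe (f := weylTerm 𝒱 E Λ k) (hu.continuous_apply k) a b

theorem cTerm_zero : cTerm 𝒱 E Λ 0 = cMul 𝒱 E :=
  rfl

variable {z : 𝕂} (hc : Continuous fun x : CWeyl 𝒱 E × CWeyl 𝒱 E => cStar 𝒱 E Λ z x.1 x.2)
  (hv : ∀ a b : Weyl 𝒱 E, cStar 𝒱 E Λ z a b = (weylStar 𝒱 E Λ z a b : CWeyl 𝒱 E))

include hc hv

/-- Both sides are continuous and agree on the dense image of W, where `symStar_assoc` applies. -/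
theorem cStar_assoc (hΛe : IsEvenForm 𝒱 Λ) (a b c : CWeyl 𝒱 E) :
    cStar 𝒱 E Λ z (cStar 𝒱 E Λ z a b) c = cStar 𝒱 E Λ z a (cStar 𝒱 E Λ z b c) := by
  have hco : ∀ {X : Type _} [TopologicalSpace X] {f g : X → CWeyl 𝒱 E}, Continuous f →
      Continuous g → Continuous fun x => cStar 𝒱 E Λ z (f x) (g x) :=
    fun hf hg => hc.comp (hf.prodMk hg)
  induction a, b, c using Completion.induction_on₃ with
  | hp =>
    exact isClosed_eq (hco (hco (by fun_prop) (by fun_prop)) (by fun_prop))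
      (hco (by fun_prop) (hco (by fun_prop) (by fun_prop)))
  | ih a b c =>
    rw [hv, hv, hv, hv]
    exact congrArg _ (symStar_assoc 𝒱 hΛe z a b c)

theorem weylOne_cStar (hΛe : IsEvenForm 𝒱 Λ) (a : CWeyl 𝒱 E) :
    cStar 𝒱 E Λ z (weylOne 𝒱 E : CWeyl 𝒱 E) a = a := by
  induction a using Completion.induction_on with
  | hp => exact isClosed_eq (hc.comp (Continuous.prodMk_right _)) continuous_id
  | ih a =>
    rw [hv]
    exact congrArg _ (symOne_symStar 𝒱 hΛe z a)

theorem cStar_weylOne (hΛe : IsEvenForm 𝒱 Λ) (a : CWeyl 𝒱 E) :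
    cStar 𝒱 E Λ z a (weylOne 𝒱 E : CWeyl 𝒱 E) = a := by
  induction a using Completion.induction_on with
  | hp => exact isClosed_eq (hc.comp (Continuous.prodMk_left _)) continuous_id
  | ih a =>
    rw [hv]
    exact congrArg _ (symStar_symOne 𝒱 hΛe z a)

end WeylCompletion

end GradedWeyl

end

/-! ### Assembly of the theorem -/

open scoped TensorProduct DirectSum Topology Nat
theorem mainTheorem2 {𝕂 : Type*} [RCLike 𝕂]
    {V : Type*} [AddCommGroup V] [Module 𝕂 V] [TopologicalSpace V] [PolynormableSpace 𝕂 V]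
    [T2Space V]
    (𝒱 : ZMod 2 → Submodule 𝕂 V) [DirectSum.Decomposition 𝒱]
    (h𝒱 : ∀ i, Continuous (parityProj 𝒱 i))
    (Λ : V →ₗ[𝕂] V →ₗ[𝕂] 𝕂)
    (hΛeven : ∀ i j, i ≠ j → ∀ v ∈ 𝒱 i, ∀ w ∈ 𝒱 j, Λ v w = 0)
    (hΛ : Continuous fun x : V × V => Λ x.1 x.2)
    (E : Set ℝ)
    (hE : (∃ R : ℝ, 1 / 2 ≤ R ∧ E = {R}) ∨ (∃ R : ℝ, 1 / 2 < R ∧ E = Set.Iio R)) :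
    -- the star product is a finite sum on the symmetric algebra
    (∀ a b : symAlg 𝒱, ∃ N, ∀ k ≥ N, (contraction 𝒱 Λ ^ k) (a ⊗ₜ[𝕂] b) = 0) ∧
    -- the operations extend continuously to the completion
    (∀ k, Continuous (fun x : CWeyl 𝒱 E × CWeyl 𝒱 E => cTerm 𝒱 E Λ k x.1 x.2) ∧
      ∀ a b : Weyl 𝒱 E, cTerm 𝒱 E Λ k a b = (weylTerm 𝒱 E Λ k a b : CWeyl 𝒱 E)) ∧
    (∀ z, Continuous (fun x : CWeyl 𝒱 E × CWeyl 𝒱 E => cStar 𝒱 E Λ z x.1 x.2) ∧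
      ∀ a b : Weyl 𝒱 E, cStar 𝒱 E Λ z a b = (weylStar 𝒱 E Λ z a b : CWeyl 𝒱 E)) ∧
    (Continuous (fun x : CWeyl 𝒱 E × CWeyl 𝒱 E => cMul 𝒱 E x.1 x.2) ∧
      ∀ a b : Weyl 𝒱 E, cMul 𝒱 E a b = (weylMul 𝒱 E a b : CWeyl 𝒱 E)) ∧
    -- absolute convergence of the series for the star product
    (∀ (z : 𝕂) (a b : CWeyl 𝒱 E),
      HasAbsSum 𝕂 (fun k => (z ^ k / (k.factorial : 𝕂)) • cTerm 𝒱 E Λ k a b)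
        (cStar 𝒱 E Λ z a b)) ∧
    -- analytic (entire) dependence on `z`, with this series as Taylor series at `0`
    (∀ a b : CWeyl 𝒱 E, ∃ D : ℕ → 𝕂 → CWeyl 𝒱 E,
      IsEntireWithDerivs D ∧ (∀ z, D 0 z = cStar 𝒱 E Λ z a b) ∧
      ∀ k, D k 0 = cTerm 𝒱 E Λ k a b) ∧
    -- the products form a deformation of the algebra with the symmetric tensor product:
    -- unital associative bilinear products, jointly continuous also in the parameter
    (∀ (z : 𝕂) (a a' b b' c : CWeyl 𝒱 E) (s : 𝕂),
      cStar 𝒱 E Λ z (a + a') b = cStar 𝒱 E Λ z a b + cStar 𝒱 E Λ z a' b ∧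
      cStar 𝒱 E Λ z (s • a) b = s • cStar 𝒱 E Λ z a b ∧
      cStar 𝒱 E Λ z a (b + b') = cStar 𝒱 E Λ z a b + cStar 𝒱 E Λ z a b' ∧
      cStar 𝒱 E Λ z a (s • b) = s • cStar 𝒱 E Λ z a b ∧
      cStar 𝒱 E Λ z (cStar 𝒱 E Λ z a b) c = cStar 𝒱 E Λ z a (cStar 𝒱 E Λ z b c) ∧
      cStar 𝒱 E Λ z (weylOne 𝒱 E : CWeyl 𝒱 E) a = a ∧
      cStar 𝒱 E Λ z a (weylOne 𝒱 E : CWeyl 𝒱 E) = a) ∧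
    Continuous (fun x : 𝕂 × CWeyl 𝒱 E × CWeyl 𝒱 E => cStar 𝒱 E Λ x.1 x.2.1 x.2.2) ∧
    (∀ a b : CWeyl 𝒱 E, cStar 𝒱 E Λ 0 a b = cMul 𝒱 E a b) := by
  have hne : Nonempty E := by
    rcases hE with ⟨R, -, rfl⟩ | ⟨R, -, rfl⟩
    · exact ⟨⟨R, rfl⟩⟩
    · exact ⟨⟨R - 1, sub_one_lt R⟩⟩
  have hE' : ∀ r ∈ E, ∃ r' ∈ E, r ≤ r' ∧ 1 / 2 ≤ r' := by
    rcases hE with ⟨R, hR, rfl⟩ | ⟨R, hR, rfl⟩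
    · rintro _ rfl
      exact ⟨_, rfl, le_rfl, hR⟩
    -- The maximum stays below R because R > 1/2 strictly.
    · exact fun r hr => ⟨max r (1 / 2), max_lt hr hR, le_max_left _ _, le_max_right _ _⟩
  have hu := bilinearGrowth_weylTerm h𝒱 hΛeven hΛ hE'
  obtain ⟨U, hU, hUc⟩ := exists_bilinearGrowth_eq_cTerm hu
  have hcoe : ∀ k (a b : Weyl 𝒱 E), U k a b = (weylTerm 𝒱 E Λ k a b : CWeyl 𝒱 E) :=
    fun k a b => (hUc k a b).trans (cTerm_coe hu k a b)
  have hS : ∀ z a b, cStar 𝒱 E Λ z a b = bilinearSeries U z a b :=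
    cStar_eq_bilinearSeries hΛeven hU hcoe
  have hT : ∀ k, Continuous (fun x : CWeyl 𝒱 E × CWeyl 𝒱 E => cTerm 𝒱 E Λ k x.1 x.2) := by
    intro k
    simp only [← hUc]
    exact hU.continuous_apply k
  have hc : ∀ z, Continuous (fun x : CWeyl 𝒱 E × CWeyl 𝒱 E => cStar 𝒱 E Λ z x.1 x.2) := by
    intro z
    simp only [hS]
    exact hU.continuous_bilinearSeries z
  have hv : ∀ z (a b : Weyl 𝒱 E),
      cStar 𝒱 E Λ z a b = (weylStar 𝒱 E Λ z a b : CWeyl 𝒱 E) := fun z a b =>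
    (hS z a b).trans (bilinearSeries_coe hΛeven hU hcoe z a b)
  refine ⟨exists_contraction_pow_eq_zero 𝒱 hΛeven, fun k => ⟨hT k, cTerm_coe hu k⟩,
    fun z => ⟨hc z, hv z⟩, ⟨hT 0, cTerm_coe hu 0⟩, fun z a b => ?_, fun a b => ?_,
    fun z a a' b b' c s => ⟨?_, ?_, ?_, ?_, cStar_assoc (hc z) (hv z) hΛeven a b c,
      weylOne_cStar (hc z) (hv z) hΛeven a, cStar_weylOne (hc z) (hv z) hΛeven a⟩, ?_,
    fun a b => ?_⟩
  · simp only [← hUc, hS]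
    exact (hU.entireGrowth a b).hasAbsSum z
  -- The k-th derivative in z is the exponential series of the terms shifted by k.
  · refine ⟨fun k z => expSeries (fun j => U (k + j) a b) z,
      (hU.entireGrowth a b).isEntireWithDerivs, fun z => ?_, fun k => ?_⟩
    · simp only [zero_add, hS, bilinearSeries]
    · rw [← hUc]
      exact expSeries_zero _
  · simp only [hS, hU.add_left]
  · simp only [hS, hU.smul_left]
  · simp only [hS, hU.add_right]
  · simp only [hS, hU.smul_right]
  · simp only [hS]
    exact hU.continuous
  -- At z = 0 only the term with k = 0 survives, and it is μ.
  · rw [hS, ← cTerm_zero (Λ := Λ), ← hUc]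
    exact expSeries_zero _
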